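/- Let $k\ge 0$ and $n\ge 2k$ be integers. A diagram is a set partition of the vertices $1,\dots,k$ (top row) and $1',\dots,k'$ (bottom row). For diagrams $d_1,d_2$ let $d_1\circ d_2$ be the concatenation with $d_1$ above $d_2$, and let $\ell(d_1,d_2)$ be the number of connected components lying entirely in the identified middle row, which are deleted. The partition algebra $P_k(n)$ is the complex vector space with basis the diagrams and product $d_1d_2=n^{\ell(d_1,d_2)}\,d_1\circ d_2$. Let $A_k=\mathbb{C}\text{-span}(\mathcal{A}_k)\subseteq P_k(n)$, where $\mathcal{A}_k$ is one of the following ten sets of diagrams: all diagrams ($P_k(n)$); those whose blocks have exactly one vertex in each row ($\mathbb{C}S_k$); at most one vertex in each row (rook monoid); size $2$ (Brauer); size $1$ or $2$ (rook-Brauer); and the planar diagrams in each of these five sets (planar partition, $\mathbb{C}\mathbf{1}_k$, planar rook, Temperley-Lieb, Motzkin). The rank $\mathrm{pn}(d)$ is the number of blocks of $d$ that meet both rows (propagating blocks), and $d^T$ is the reflection of $d$ exchanging the two rows. A symmetric $m$-diagram is a diagram $w$ with $w=w^T$ and $\mathrm{pn}(w)=m$ each of whose propagating blocks is connected to its own mirror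 image; order its propagating blocks by the maximal entry of their top parts. If $w$ is a symmetric $m$-diagram and $\mathrm{pn}(d\circ w\circ d^T)=m$, the twist $\sigma_{d,w}\in S_m$ is the permutation such that, for each $i$, the $i$th propagating block of $w$ is sent to the $\sigma_{d,w}(i)$th propagating block of $d\circ w\circ d^T$; that is, in $d$ placed above $w$ these two blocks are connected. For a partition $\lambda$ let $\lambda^*$ be $\lambda$ with its first row removed. Let $\Lambda_n^{A_k}$ be the set of all $\lambda\vdash n$ such that $|\lambda^*|$ is the rank of some diagram in $\mathcal{A}_k$ and, if the diagrams in $\mathcal{A}_k$ are required to be planar, $\lambda^*$ has at most one row. For $\mu\vdash m$ let $p_\mu\in\mathbb{C}S_m$ be the Young symmetrizer $\sum_{\gamma,\rho}\mathrm{sign}(\gamma)\gamma\rho$, where $\gamma$ and $\rho$ run over the column group and the row group of the column-reading tableau of shape $\mu$, and let $\chi^\mu_{S_m}$ be the character of the irreducible module $\mathbb{C}S_m\,p_\mu$. Regard $S_m$ as acting on the first $m$ strands. Let $e_m$ be $n^{-(k-m)}$ times the diagram with identity edges on the first $m$ strands and all other vertices isolated or, in the Brauer and Temperley-Lieb cases,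 $n^{-(k-m)/2}$ times the diagram with identity edges on the first $m$ strands in which, in each row, the other vertices are paired with their neighbours $\{m+1,m+2\},\{m+3,m+4\},\dots$. For $\lambda\in\Lambda_n^{A_k}$ with $|\lambda^*|=m$ put $e_\lambda=p_{\lambda^*}e_m$ in the five non-planar cases and $e_\lambda=e_m$ in the five planar cases. Let $J_{m-1}$ be the ideal of $A_k$ spanned by the diagrams in $\mathcal{A}_k$ of rank less than $m$, and let $A_k^\lambda$ be the image of $A_ke_\lambda$ in $A_k/J_{m-1}$, an $A_k$-module by left multiplication. Theorem. Let $d\in\mathcal{A}_k$ and let $\lambda\in\Lambda_n^{A_k}$ with $|\lambda^*|=m$. Then the $A_k$-module $A_k^\lambda$ is irreducible, and the value of its character $\chi^\lambda_{A_k}$ on $d$ is $$\chi^\lambda_{A_k}(d)=\sum_{w\in\mathcal{F}^m(d)} n^{\ell(d,w)}\,\chi^{\lambda^*}_{S_m}(\sigma_{d,w}),$$ where $\mathcal{F}^m(d)$ is the set of all symmetric $m$-diagrams $w\in\mathcal{A}_k$ with $d\circ w\circ d^T=w$. -/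

import Mathlib

/-! ### Classes of a join of two equivalence relations -/

theorem setoid_map_le_iff {α β : Type*} {r : Setoid α} {f : α → β} {s : Setoid β} :
    r.map f ≤ s ↔ r ≤ s.comap f := by
  constructor
  · intro h x y hxy
    exact h (Setoid.le_comap_map hxy)
  · intro h
    refine Setoid.eqvGen_le ?_
    rintro _ _ ⟨a, b, hab, rfl, rfl⟩
    exact h hab

theorem setoid_map_sup {α β : Type*} (r s : Setoid α) (f : α → β) :
    (r ⊔ s).map f = r.map f ⊔ s.map f := by
  apply le_antisymm
  · rw [setoid_map_le_iff]
    exact sup_le (setoid_map_le_iff.1 le_sup_left) (setoid_map_le_iff.1 le_sup_right)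
  · exact sup_le (setoid_map_le_iff.2 (le_sup_left.trans Setoid.le_comap_map))
      (setoid_map_le_iff.2 (le_sup_right.trans Setoid.le_comap_map))

theorem setoid_map_map {α β γ : Type*} (r : Setoid α) (f : α → β) (g : β → γ) :
    (r.map f).map g = r.map (g ∘ f) := by
  apply le_antisymm
  · rw [setoid_map_le_iff, setoid_map_le_iff]
    exact Setoid.le_comap_map (f := g ∘ f)
  · rw [setoid_map_le_iff]
    intro x y h
    exact Setoid.le_comap_map (Setoid.le_comap_map h)

theorem setoid_map_apply {α β : Type*} {r : Setoid α} {f : α → β} (hf : Function.Injective f)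
    {x y : β} : r.map f x y ↔ (∃ a b, r a b ∧ f a = x ∧ f b = y) ∨ x = y := by
  have h := Setoid.coe_map_of_ker_le r f (by
    intro a b hab
    rw [hf hab])
  rw [h]
  rfl

theorem setoid_map_apply_apply {α β : Type*} {r : Setoid α} {f : α → β}
    (hf : Function.Injective f) {a b : α} : r.map f (f a) (f b) ↔ r a b := by
  rw [setoid_map_apply hf]
  constructor
  · rintro (⟨c, d, h, h1, h2⟩ | h)
    · rwa [← hf h1, ← hf h2]
    · rw [hf h]
  · intro h
    exact Or.inl ⟨a, b, h, rfl, rfl⟩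

theorem setoid_comap_sup_map {U V : Type*} (P : Setoid V) (q : Setoid U) (g : U → V) : (P ⊔ q.map g).comap g = P.comap g ⊔ q := by
  apply le_antisymm
  · let E : Setoid U := P.comap g ⊔ q
    have hPE : ∀ {u v}, P (g u) (g v) → E u v := fun {u v} h =>
      (le_sup_left : P.comap g ≤ E) h
    let R : Setoid V :=
      { r := fun x y => P x y ∨ ∃ u v, P x (g u) ∧ E u v ∧ P (g v) y
        iseqv :=
          { refl := fun x => Or.inl (P.refl' x)
            symm := by
              rintro x y (h | ⟨u, v, h1, h2, h3⟩)
              · exact Or.inl (P.symm' h)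
              · exact Or.inr ⟨v, u, P.symm' h3, E.symm' h2, P.symm' h1⟩
            trans := by
              rintro x y z (h | ⟨u, v, h1, h2, h3⟩) (h' | ⟨u', v', h1', h2', h3'⟩)
              · exact Or.inl (P.trans' h h')
              · exact Or.inr ⟨u', v', P.trans' h h1', h2', h3'⟩
              · exact Or.inr ⟨u, v, h1, h2, P.trans' h3 h'⟩
              · exact Or.inr ⟨u, v', h1,
                  E.trans' h2 (E.trans' (hPE (P.trans' h3 h1')) h2'), h3'⟩ } }
    have hR : P ⊔ q.map g ≤ R := by
      refine sup_le (fun x y h => Or.inl h) ?_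
      rw [setoid_map_le_iff]
      intro u v h
      exact Or.inr ⟨u, v, P.refl' _, (le_sup_right : q ≤ E) h, P.refl' _⟩
    intro u v h
    rcases hR h with h | ⟨u', v', h1, h2, h3⟩
    · exact hPE h
    · exact E.trans' (hPE h1) (E.trans' h2 (hPE h3))
  · refine sup_le (fun x y h => (le_sup_left : P ≤ P ⊔ q.map g) h) ?_
    rw [← setoid_map_le_iff]
    exact le_sup_right

/-- The number of classes of `S` that are contained in `K`. -/
noncomputable def classCount {V : Type*} (S : Setoid V) (K : Set V) : ℕ :=
  {C | C ∈ S.classes ∧ C ⊆ K}.ncard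

theorem classCount_sup_map {U V W : Type*} [Finite U] [Finite V] [Finite W]
    (s : Setoid W) (q : Setoid U) {h : W → V} {g : U → V} (hh : Function.Injective h)
    (K : Set V) (L : Set W) (hL : (Set.range g)ᶜ = h '' L)
    (hK : (Set.range g)ᶜ ⊆ K) :
    classCount (s.map h ⊔ q.map g) K
      = classCount s L + classCount ((s.map h ⊔ q.map g).comap g) (g ⁻¹' K) := by
  set P := s.map h with hP
  set S := P ⊔ q.map g with hS
  have hPS : P ≤ S := le_sup_left
  -- a class of `P` away from the range of `g` is a class of the join
  have key : ∀ x, (∀ y, P x y → y ∉ Set.range g) → ∀ y, S x y → P x y := by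
    intro x hx y hxy
    let R : Setoid V :=
      { r := fun a b => P a b ∨ (¬ P x a ∧ ¬ P x b)
        iseqv :=
          { refl := fun a => Or.inl (P.refl' a)
            symm := by
              rintro a b (h | ⟨h1, h2⟩)
              · exact Or.inl (P.symm' h)
              · exact Or.inr ⟨h2, h1⟩
            trans := by
              rintro a b c (h | ⟨h1, h2⟩) (h' | ⟨h1', h2'⟩)
              · exact Or.inl (P.trans' h h')
              · exact Or.inr ⟨fun hh => h1' (P.trans' hh h), h2'⟩
              · exact Or.inr ⟨h1, fun hh => h2 (P.trans' hh (P.symm' h'))⟩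
              · exact Or.inr ⟨h1, h2'⟩ } }
    have hR : S ≤ R := by
      refine sup_le (fun a b h => Or.inl h) ?_
      rw [setoid_map_le_iff]
      intro u v _
      exact Or.inr ⟨fun h => hx _ h ⟨u, rfl⟩, fun h => hx _ h ⟨v, rfl⟩⟩
    rcases hR hxy with h | h
    · exact h
    · exact absurd (P.refl' x) h.1
  have split : {C | C ∈ S.classes ∧ C ⊆ K}
      = {C | C ∈ S.classes ∧ C ⊆ (Set.range g)ᶜ}
        ∪ {C | C ∈ S.classes ∧ C ⊆ K ∧ ¬ C ⊆ (Set.range g)ᶜ} := by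
    ext C
    simp only [Set.mem_ofPred_eq, Set.mem_union]
    constructor
    · rintro ⟨h1, h2⟩
      by_cases h3 : C ⊆ (Set.range g)ᶜ
      · exact Or.inl ⟨h1, h3⟩
      · exact Or.inr ⟨h1, h2, h3⟩
    · rintro (⟨h1, h2⟩ | ⟨h1, h2, _⟩)
      · exact ⟨h1, h2.trans hK⟩
      · exact ⟨h1, h2⟩
  have disj : Disjoint {C | C ∈ S.classes ∧ C ⊆ (Set.range g)ᶜ}
      {C | C ∈ S.classes ∧ C ⊆ K ∧ ¬ C ⊆ (Set.range g)ᶜ} := by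
    rw [Set.disjoint_left]
    rintro C ⟨_, h1⟩ ⟨_, _, h2⟩
    exact h2 h1
  have first : {C | C ∈ S.classes ∧ C ⊆ (Set.range g)ᶜ}
      = (fun D => h '' D) '' {D | D ∈ s.classes ∧ D ⊆ L} := by
    ext C
    simp only [Set.mem_ofPred_eq, Set.mem_image]
    constructor
    · rintro ⟨⟨x, rfl⟩, h2⟩
      have hx : x ∈ (Set.range g)ᶜ := h2 (S.refl' x)
      rw [hL] at hx
      obtain ⟨a, ha, rfl⟩ := hx
      have hPC : ∀ y, P (h a) y → y ∉ Set.range g := fun y hy => h2 (hPS (P.symm' hy))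
      have hSP : ∀ y, S y (h a) ↔ P y (h a) := fun y =>
        ⟨fun hy => P.symm' (key _ hPC _ (S.symm' hy)), fun hy => hPS hy⟩
      refine ⟨{b | s b a}, ⟨⟨a, rfl⟩, ?_⟩, ?_⟩
      · intro b hb
        have : h b ∈ (Set.range g)ᶜ :=
          h2 (hPS ((setoid_map_apply_apply hh).2 hb) : S (h b) (h a))
        rw [hL] at this
        obtain ⟨c, hc, hcb⟩ := this
        rwa [← hh hcb]
      · ext y
        simp only [Set.mem_image, Set.mem_ofPred_eq, hSP]
        constructor
        · rintro ⟨b, hb, rfl⟩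
          exact (setoid_map_apply_apply hh).2 hb
        · intro hy
          rcases (setoid_map_apply hh).1 hy with ⟨b, c, hbc, rfl, hc⟩ | rfl
          · rw [hh hc] at hbc
            exact ⟨b, hbc, rfl⟩
          · exact ⟨a, s.refl' a, rfl⟩
    · rintro ⟨D, ⟨⟨a, rfl⟩, hD⟩, rfl⟩
      have hsub : h '' {b | s b a} ⊆ (Set.range g)ᶜ := by
        rw [hL]
        exact Set.image_mono hD
      have hPim : ∀ y, P y (h a) ↔ y ∈ h '' {b | s b a} := by
        intro y
        constructor
        · intro hy
          rcases (setoid_map_apply hh).1 hy with ⟨b, c, hbc, rfl, hc⟩ | rfl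
          · rw [hh hc] at hbc
            exact ⟨b, hbc, rfl⟩
          · exact ⟨a, s.refl' a, rfl⟩
        · rintro ⟨b, hb, rfl⟩
          exact (setoid_map_apply_apply hh).2 hb
      refine ⟨⟨h a, ?_⟩, hsub⟩
      ext y
      rw [← hPim]
      exact ⟨fun hy => hPS hy, fun hy => P.symm'
        (key _ (fun z hz => hsub ((hPim z).1 (P.symm' hz))) _ (S.symm' hy))⟩
  have second : {D | D ∈ (S.comap g).classes ∧ D ⊆ g ⁻¹' K}
      = (fun C => g ⁻¹' C) '' {C | C ∈ S.classes ∧ C ⊆ K ∧ ¬ C ⊆ (Set.range g)ᶜ} := by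
    ext D
    simp only [Set.mem_ofPred_eq, Set.mem_image]
    constructor
    · rintro ⟨⟨u, rfl⟩, hD⟩
      refine ⟨{y | S y (g u)}, ⟨⟨g u, rfl⟩, ?_, ?_⟩, rfl⟩
      · intro y hy
        by_cases hyr : y ∈ Set.range g
        · obtain ⟨v, rfl⟩ := hyr
          exact hD hy
        · exact hK hyr
      · intro hsub
        exact hsub (S.refl' (g u)) ⟨u, rfl⟩
    · rintro ⟨C, ⟨⟨x, rfl⟩, hCK, hC⟩, rfl⟩
      rw [Set.not_subset] at hC
      obtain ⟨y, hy, hyr⟩ := hC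
      rw [Set.mem_compl_iff, not_not] at hyr
      obtain ⟨u, rfl⟩ := hyr
      refine ⟨⟨u, ?_⟩, Set.preimage_mono hCK⟩
      ext v
      exact ⟨fun hv => S.trans' hv (S.symm' hy), fun hv => S.trans' hv hy⟩
  have inj2 : Set.InjOn (fun C => g ⁻¹' C)
      {C | C ∈ S.classes ∧ C ⊆ K ∧ ¬ C ⊆ (Set.range g)ᶜ} := by
    rintro C ⟨⟨x, rfl⟩, _, hC⟩ C' ⟨⟨x', rfl⟩, _, _⟩ hCC
    rw [Set.not_subset] at hC
    obtain ⟨y, hy, hyr⟩ := hC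
    rw [Set.mem_compl_iff, not_not] at hyr
    obtain ⟨u, rfl⟩ := hyr
    have hu : S (g u) x := hy
    have hu' : S (g u) x' := by
      have : u ∈ g ⁻¹' {y | S y x'} := by
        rw [← show g ⁻¹' {y | S y x} = g ⁻¹' {y | S y x'} from hCC]
        exact hu
      exact this
    ext z
    exact ⟨fun hz => S.trans' hz (S.trans' (S.symm' hu) hu'),
      fun hz => S.trans' hz (S.trans' (S.symm' hu') hu)⟩
  unfold classCount
  rw [split, Set.ncard_union_eq disj (Set.toFinite _) (Set.toFinite _), first, second,
    Set.ncard_image_of_injective _ hh.image_injective, inj2.ncard_image]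

/-! ### Set-partition diagrams -/

/-- A diagram on two rows of `k` vertices, i.e. a set partition of the vertices; `Sum.inl i` is
the `i`-th vertex of the top row and `Sum.inr i` is the `i`-th vertex of the bottom row. -/
abbrev Diagram (k : ℕ) : Type := Setoid (Fin k ⊕ Fin k)

namespace Diagram

instance instFinite (k : ℕ) : Finite (Diagram k) :=
  Finite.of_injective (fun (d : Diagram k) x y => d x y) fun _ _ h =>
    Setoid.ext fun x y => iff_of_eq (congrFun (congrFun h x) y)

noncomputable instance instFintype (k : ℕ) : Fintype (Diagram k) := Fintype.ofFinite _

/-- The first and second of three rows. -/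
def upper {k : ℕ} : Fin k ⊕ Fin k → Fin k ⊕ Fin k ⊕ Fin k :=
  Sum.elim Sum.inl fun i => Sum.inr (Sum.inl i)

/-- The second and third of three rows. -/
def lower {k : ℕ} : Fin k ⊕ Fin k → Fin k ⊕ Fin k ⊕ Fin k :=
  Sum.elim (fun i => Sum.inr (Sum.inl i)) fun i => Sum.inr (Sum.inr i)

/-- The first and third of three rows. -/
def outer {k : ℕ} : Fin k ⊕ Fin k → Fin k ⊕ Fin k ⊕ Fin k :=
  Sum.elim Sum.inl fun i => Sum.inr (Sum.inr i)

/-- The middle one of three rows. -/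
def middle (k : ℕ) : Set (Fin k ⊕ Fin k ⊕ Fin k) :=
  Set.range fun i => Sum.inr (Sum.inl i)

/-- The connected components of `d₁` placed above `d₂`, the bottom row of `d₁` being identified
with the top row of `d₂`. -/
def stack {k : ℕ} (d₁ d₂ : Diagram k) : Setoid (Fin k ⊕ Fin k ⊕ Fin k) :=
  Setoid.map d₁ upper ⊔ Setoid.map d₂ lower

/-- Concatenation `d₁ ∘ d₂`, with `d₁` above `d₂`. -/
def comp {k : ℕ} (d₁ d₂ : Diagram k) : Diagram k := (stack d₁ d₂).comap outer

/-- The number of connected components that lie entirely in the middle row when `d₁` is placed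
above `d₂`. -/
noncomputable def loops {k : ℕ} (d₁ d₂ : Diagram k) : ℕ :=
  classCount (stack d₁ d₂) (middle k)

/-- The identity diagram, with blocks `{i, i'}`. -/
def one (k : ℕ) : Diagram k := Setoid.ker (Sum.elim id id : Fin k ⊕ Fin k → Fin k)

/-- Reflection of a diagram over the horizontal axis. -/
def transpose {k : ℕ} (d : Diagram k) : Diagram k := Setoid.comap Sum.swap d

theorem upper_injective {k : ℕ} : Function.Injective (upper (k := k)) := by
  rintro (a | a) (b | b) h <;> simp_all [upper]

theorem lower_injective {k : ℕ} : Function.Injective (lower (k := k)) := by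
  rintro (a | a) (b | b) h <;> simp_all [lower]

theorem outer_injective {k : ℕ} : Function.Injective (outer (k := k)) := by
  rintro (a | a) (b | b) h <;> simp_all [outer]

section Assoc

variable {k : ℕ}

/-- Rows one, two, three of four rows. -/
def rows123 : Fin k ⊕ Fin k ⊕ Fin k → Fin k ⊕ Fin k ⊕ Fin k ⊕ Fin k :=
  Sum.elim Sum.inl (Sum.elim (fun i => Sum.inr (Sum.inl i)) fun i => Sum.inr (Sum.inr (Sum.inl i)))

/-- Rows two, three, four of four rows. -/
def rows234 : Fin k ⊕ Fin k ⊕ Fin k → Fin k ⊕ Fin k ⊕ Fin k ⊕ Fin k := Sum.inr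

/-- Rows one, three, four of four rows. -/
def rows134 : Fin k ⊕ Fin k ⊕ Fin k → Fin k ⊕ Fin k ⊕ Fin k ⊕ Fin k :=
  Sum.elim Sum.inl fun x => Sum.inr (Sum.inr x)

/-- Rows one, two, four of four rows. -/
def rows124 : Fin k ⊕ Fin k ⊕ Fin k → Fin k ⊕ Fin k ⊕ Fin k ⊕ Fin k :=
  Sum.elim Sum.inl (Sum.elim (fun i => Sum.inr (Sum.inl i)) fun i => Sum.inr (Sum.inr (Sum.inr i)))

theorem rows123_injective : Function.Injective (rows123 (k := k)) := by
  rintro (a | a | a) (b | b | b) h <;> simp_all [rows123]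

theorem rows234_injective : Function.Injective (rows234 (k := k)) := Sum.inr_injective

theorem rows134_injective : Function.Injective (rows134 (k := k)) := by
  rintro (a | a | a) (b | b | b) h <;> simp_all [rows134]

theorem rows124_injective : Function.Injective (rows124 (k := k)) := by
  rintro (a | a | a) (b | b | b) h <;> simp_all [rows124]

theorem comap_map_of_square {A B C D : Type*} {f : A → B} {g : A → C} {h : B → D} {j : C → D}
    (hg : Function.Injective g) (hh : Function.Injective h)
    (hj : Function.Injective j) (comm : ∀ a, h (f a) = j (g a))
    (cart : ∀ b c, h b = j c → ∃ a, f a = b ∧ g a = c) (s : Setoid B) :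
    (s.map h).comap j = (s.comap f).map g := by
  ext x y
  rw [Setoid.comap_rel, setoid_map_apply hh, setoid_map_apply hg]
  constructor
  · rintro (⟨a, b, hab, ha, hb⟩ | h)
    · obtain ⟨a', rfl, rfl⟩ := cart _ _ ha
      obtain ⟨b', rfl, rfl⟩ := cart _ _ hb
      exact Or.inl ⟨a', b', hab, rfl, rfl⟩
    · exact Or.inr (hj h)
  · rintro (⟨a, b, hab, rfl, rfl⟩ | h)
    · exact Or.inl ⟨f a, f b, hab, comm a, comm b⟩
    · exact Or.inr (congrArg j h)

/-- The connected components of three stacked diagrams. -/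
def stack₃ (d₁ d₂ d₃ : Diagram k) : Setoid (Fin k ⊕ Fin k ⊕ Fin k ⊕ Fin k) :=
  (stack d₁ d₂).map rows123 ⊔ (Setoid.map d₃ lower).map rows134

theorem stack₃_eq (d₁ d₂ d₃ : Diagram k) :
    stack₃ d₁ d₂ d₃ = (stack d₂ d₃).map rows234 ⊔ (Setoid.map d₁ upper).map rows124 := by
  have e1 : (rows134 ∘ lower : Fin k ⊕ Fin k → _) = rows234 ∘ lower := by
    funext x; rcases x with x | x <;> rfl
  have e2 : (rows123 ∘ lower : Fin k ⊕ Fin k → _) = rows234 ∘ upper := by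
    funext x; rcases x with x | x <;> rfl
  have e3 : (rows123 ∘ upper : Fin k ⊕ Fin k → _) = rows124 ∘ upper := by
    funext x; rcases x with x | x <;> rfl
  unfold stack₃ stack
  rw [setoid_map_sup, setoid_map_sup, setoid_map_map, setoid_map_map, setoid_map_map,
    setoid_map_map, setoid_map_map, setoid_map_map, e1, e2, e3, sup_assoc, sup_comm]

theorem stack₃_comap_rows134 (d₁ d₂ d₃ : Diagram k) :
    (stack₃ d₁ d₂ d₃).comap rows134 = stack (comp d₁ d₂) d₃ := by
  unfold stack₃
  rw [setoid_comap_sup_map _ _ rows134,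
    comap_map_of_square (f := outer) (g := upper) upper_injective rows123_injective
      rows134_injective]
  · rfl
  · rintro (a | a) <;> rfl
  · rintro (b | b | b) (c | c | c) h <;> simp [rows123, rows134] at h
    · exact ⟨Sum.inl b, rfl, by rw [h]; rfl⟩
    · exact ⟨Sum.inr b, rfl, by rw [h]; rfl⟩

theorem stack₃_comap_rows124 (d₁ d₂ d₃ : Diagram k) :
    (stack₃ d₁ d₂ d₃).comap rows124 = stack d₁ (comp d₂ d₃) := by
  rw [stack₃_eq, setoid_comap_sup_map _ _ rows124,
    comap_map_of_square (f := outer) (g := lower) lower_injective rows234_injective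
      rows124_injective]
  · exact sup_comm _ _
  · rintro (a | a) <;> rfl
  · rintro (b | b | b) (c | c | c) h <;> simp [rows234, rows124] at h
    · exact ⟨Sum.inl b, rfl, by rw [h]; rfl⟩
    · exact ⟨Sum.inr b, rfl, by rw [h]; rfl⟩

theorem comp_assoc (d₁ d₂ d₃ : Diagram k) :
    comp (comp d₁ d₂) d₃ = comp d₁ (comp d₂ d₃) := by
  have e : (rows134 ∘ outer : Fin k ⊕ Fin k → _) = rows124 ∘ outer := by
    funext x; rcases x with x | x <;> rfl
  change (stack (comp d₁ d₂) d₃).comap outer = (stack d₁ (comp d₂ d₃)).comap outer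
  rw [← stack₃_comap_rows134, ← stack₃_comap_rows124]
  change (stack₃ d₁ d₂ d₃).comap (rows134 ∘ outer) = (stack₃ d₁ d₂ d₃).comap (rows124 ∘ outer)
  rw [e]

theorem loops_assoc (d₁ d₂ d₃ : Diagram k) :
    loops d₁ d₂ + loops (comp d₁ d₂) d₃ = loops d₂ d₃ + loops d₁ (comp d₂ d₃) := by
  let K : Set (Fin k ⊕ Fin k ⊕ Fin k ⊕ Fin k) :=
    Set.range (fun i => Sum.inr (Sum.inl i)) ∪ Set.range (fun i => Sum.inr (Sum.inr (Sum.inl i)))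
  have h1 : classCount (stack₃ d₁ d₂ d₃) K = loops d₁ d₂ + loops (comp d₁ d₂) d₃ := by
    have := classCount_sup_map (stack d₁ d₂) (Setoid.map d₃ lower) rows123_injective
      (g := rows134) K (middle k)
      (by ext x; rcases x with x | x | x | x <;> simp [rows134, rows123, middle])
      (by intro x; rcases x with x | x | x | x <;> simp [rows134, K])
    have e := stack₃_comap_rows134 d₁ d₂ d₃
    unfold stack₃ at e ⊢
    rw [this, e]
    have : rows134 ⁻¹' K = middle k := by
      ext x; rcases x with x | x | x <;> simp [rows134, middle, K]
    rw [this]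
    rfl
  have h2 : classCount (stack₃ d₁ d₂ d₃) K = loops d₂ d₃ + loops d₁ (comp d₂ d₃) := by
    have := classCount_sup_map (stack d₂ d₃) (Setoid.map d₁ upper) rows234_injective
      (g := rows124) K (middle k)
      (by ext x; rcases x with x | x | x | x <;> simp [rows124, rows234, middle])
      (by intro x; rcases x with x | x | x | x <;> simp [rows124, K])
    have e := stack₃_comap_rows124 d₁ d₂ d₃
    rw [stack₃_eq] at e ⊢
    rw [this, e]
    have : rows124 ⁻¹' K = middle k := by
      ext x; rcases x with x | x | x <;> simp [rows124, middle, K]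
    rw [this]
    rfl
  rw [← h1, h2]

theorem stack_one_left (d : Diagram k) (i : Fin k) :
    stack (one k) d (Sum.inl i) (Sum.inr (Sum.inl i)) :=
  (le_sup_left : Setoid.map (one k) upper ≤ stack (one k) d)
    (Setoid.le_comap_map (r := one k) (f := upper) (x := Sum.inl i) (y := Sum.inr i) rfl)

theorem stack_one_right (d : Diagram k) (i : Fin k) :
    stack d (one k) (Sum.inr (Sum.inl i)) (Sum.inr (Sum.inr i)) :=
  (le_sup_right : Setoid.map (one k) lower ≤ stack d (one k))
    (Setoid.le_comap_map (r := one k) (f := lower) (x := Sum.inl i) (y := Sum.inr i) rfl)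

theorem one_comp (d : Diagram k) : comp (one k) d = d := by
  let c : Fin k ⊕ Fin k ⊕ Fin k → Fin k ⊕ Fin k := Sum.elim Sum.inl id
  have hle : stack (one k) d ≤ Setoid.comap c d := by
    refine sup_le (setoid_map_le_iff.2 ?_) (setoid_map_le_iff.2 ?_)
    · intro x y h
      have h' : c (upper x) = c (upper y) := by
        have h2 : (Sum.elim id id x : Fin k) = Sum.elim id id y := h
        rcases x with x | x <;> rcases y with y | y <;> simpa [c, upper] using h2
      change d (c (upper x)) (c (upper y))
      rw [h']
    · intro x y h
      have e : ∀ x, c (lower x) = x := by rintro (x | x) <;> rfl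
      change d (c (lower x)) (c (lower y))
      rwa [e, e]
  have hl : ∀ x, stack (one k) d (outer x) (lower x) := by
    rintro (x | x)
    · exact stack_one_left d x
    · exact Setoid.refl' _ _
  apply le_antisymm (α := Setoid (Fin k ⊕ Fin k))
  · intro x y h
    have e : ∀ x, c (outer x) = x := by rintro (x | x) <;> rfl
    have := hle h
    change d (c (outer x)) (c (outer y)) at this
    rwa [e, e] at this
  · intro x y h
    exact Setoid.trans' (stack (one k) d) (hl x) (Setoid.trans' (stack (one k) d)
      ((le_sup_right : Setoid.map d lower ≤ stack (one k) d) (Setoid.le_comap_map h))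
      (Setoid.symm' (stack (one k) d) (hl y)))

theorem comp_one (d : Diagram k) : comp d (one k) = d := by
  let c : Fin k ⊕ Fin k ⊕ Fin k → Fin k ⊕ Fin k := Sum.elim Sum.inl (Sum.elim Sum.inr Sum.inr)
  have hle : stack d (one k) ≤ Setoid.comap c d := by
    refine sup_le (setoid_map_le_iff.2 ?_) (setoid_map_le_iff.2 ?_)
    · intro x y h
      have e : ∀ x, c (upper x) = x := by rintro (x | x) <;> rfl
      change d (c (upper x)) (c (upper y))
      rwa [e, e]
    · intro x y h
      have h' : c (lower x) = c (lower y) := by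
        have h2 : (Sum.elim id id x : Fin k) = Sum.elim id id y := h
        rcases x with x | x <;> rcases y with y | y <;> simpa [c, lower] using h2
      change d (c (lower x)) (c (lower y))
      rw [h']
  have hl : ∀ x, stack d (one k) (upper x) (outer x) := by
    rintro (x | x)
    · exact Setoid.refl' _ _
    · exact stack_one_right d x
  apply le_antisymm (α := Setoid (Fin k ⊕ Fin k))
  · intro x y h
    have e : ∀ x, c (outer x) = x := by rintro (x | x) <;> rfl
    have := hle h
    change d (c (outer x)) (c (outer y)) at this
    rwa [e, e] at this
  · intro x y h
    exact Setoid.trans' (stack d (one k)) (Setoid.symm' (stack d (one k)) (hl x))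
      (Setoid.trans' (stack d (one k))
      ((le_sup_left : Setoid.map d upper ≤ stack d (one k)) (Setoid.le_comap_map h)) (hl y))

theorem loops_one_left (d : Diagram k) : loops (one k) d = 0 := by
  unfold loops classCount
  rw [Set.ncard_eq_zero (Set.toFinite _), Set.eq_empty_iff_forall_notMem]
  rintro C ⟨⟨x, rfl⟩, hC⟩
  obtain ⟨i, rfl⟩ := hC (Setoid.refl' (stack (one k) d) x)
  obtain ⟨j, hj⟩ := hC (stack_one_left d i)
  simp at hj

theorem loops_one_right (d : Diagram k) : loops d (one k) = 0 := by
  unfold loops classCount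
  rw [Set.ncard_eq_zero (Set.toFinite _), Set.eq_empty_iff_forall_notMem]
  rintro C ⟨⟨x, rfl⟩, hC⟩
  obtain ⟨i, rfl⟩ := hC (Setoid.refl' (stack d (one k)) x)
  obtain ⟨j, hj⟩ := hC (Setoid.symm' (stack d (one k)) (stack_one_right d i))
  simp at hj

end Assoc

end Diagram

/-! ### The partition algebra -/

/-- The partition algebra with parameter `n`: the complex vector space with basis the diagrams and
product `d₁ d₂ = n ^ ℓ(d₁, d₂) • (d₁ ∘ d₂)`. -/
def PartitionAlgebra (k : ℕ) (_n : ℂ) : Type := Diagram k →₀ ℂ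

namespace PartitionAlgebra

variable {k : ℕ} {n : ℂ}

noncomputable instance : AddCommGroup (PartitionAlgebra k n) :=
  inferInstanceAs (AddCommGroup (Diagram k →₀ ℂ))

noncomputable instance : Module ℂ (PartitionAlgebra k n) :=
  inferInstanceAs (Module ℂ (Diagram k →₀ ℂ))

/-- The basis element of a diagram. -/
noncomputable def ofDiagram (n : ℂ) (d : Diagram k) : PartitionAlgebra k n :=
  (Finsupp.single d 1 : Diagram k →₀ ℂ)

/-- The diagram basis. -/
noncomputable def basis (k : ℕ) (n : ℂ) : Module.Basis (Diagram k) ℂ (PartitionAlgebra k n) :=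
  Module.Basis.ofRepr (LinearEquiv.refl ℂ (Diagram k →₀ ℂ))

theorem basis_apply (d : Diagram k) : basis k n d = ofDiagram n d := rfl

/-- The product, as a bilinear map. -/
noncomputable def mulHom (k : ℕ) (n : ℂ) :
    PartitionAlgebra k n →ₗ[ℂ] PartitionAlgebra k n →ₗ[ℂ] PartitionAlgebra k n :=
  (basis k n).constr ℂ fun d₁ => (basis k n).constr ℂ fun d₂ =>
    n ^ Diagram.loops d₁ d₂ • ofDiagram n (Diagram.comp d₁ d₂)

theorem mulHom_ofDiagram (d₁ d₂ : Diagram k) :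
    mulHom k n (ofDiagram n d₁) (ofDiagram n d₂)
      = n ^ Diagram.loops d₁ d₂ • ofDiagram n (Diagram.comp d₁ d₂) := by
  simp only [mulHom, ← basis_apply, Module.Basis.constr_basis]

theorem mulHom_assoc (a b c : PartitionAlgebra k n) :
    mulHom k n (mulHom k n a b) c = mulHom k n a (mulHom k n b c) := by
  have h : (LinearMap.llcomp ℂ _ _ _).compl₁₂ (mulHom k n) (mulHom k n)
      = ((LinearMap.llcomp ℂ _ _ _ : _ →ₗ[ℂ] _) (mulHom k n)).comp (mulHom k n) := by
    refine (basis k n).ext fun d₁ => (basis k n).ext fun d₂ => (basis k n).ext fun d₃ => ?_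
    simp only [LinearMap.compl₁₂_apply, LinearMap.comp_apply, LinearMap.llcomp_apply, basis_apply,
      mulHom_ofDiagram, map_smul, LinearMap.smul_apply, smul_smul, ← pow_add]
    rw [Diagram.comp_assoc, Diagram.loops_assoc]
  have := congrArg (fun f => f a b c) h
  simpa using this.symm

noncomputable instance instRing : Ring (PartitionAlgebra k n) :=
  { (inferInstance : AddCommGroup (PartitionAlgebra k n)) with
    mul := fun a b => mulHom k n a b
    one := ofDiagram n (Diagram.one k)
    left_distrib := fun a b c => map_add (mulHom k n a) b c
    right_distrib := fun a b c => by
      change mulHom k n (a + b) c = mulHom k n a c + mulHom k n b c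
      rw [map_add, LinearMap.add_apply]
    zero_mul := fun a => by
      change mulHom k n 0 a = 0
      rw [map_zero, LinearMap.zero_apply]
    mul_zero := fun a => map_zero (mulHom k n a)
    mul_assoc := mulHom_assoc
    one_mul := fun a => by
      change mulHom k n (ofDiagram n (Diagram.one k)) a = a
      have h : mulHom k n (ofDiagram n (Diagram.one k)) = LinearMap.id := by
        refine (basis k n).ext fun d => ?_
        rw [basis_apply, mulHom_ofDiagram, Diagram.one_comp, Diagram.loops_one_left, pow_zero,
          one_smul, LinearMap.id_apply]
      rw [h, LinearMap.id_apply]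
    mul_one := fun a => by
      change (mulHom k n).flip (ofDiagram n (Diagram.one k)) a = a
      have h : (mulHom k n).flip (ofDiagram n (Diagram.one k)) = LinearMap.id := by
        refine (basis k n).ext fun d => ?_
        rw [basis_apply, LinearMap.flip_apply, mulHom_ofDiagram, Diagram.comp_one,
          Diagram.loops_one_right, pow_zero, one_smul, LinearMap.id_apply]
      rw [h, LinearMap.id_apply] }

noncomputable instance instAlgebra : Algebra ℂ (PartitionAlgebra k n) :=
  Algebra.ofModule
    (fun r a b => by
      change mulHom k n (r • a) b = r • mulHom k n a b
      rw [map_smul, LinearMap.smul_apply])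
    (fun r a b => map_smul (mulHom k n a) r b)

theorem ofDiagram_mul (d₁ d₂ : Diagram k) :
    ofDiagram n d₁ * ofDiagram n d₂
      = n ^ Diagram.loops d₁ d₂ • ofDiagram n (Diagram.comp d₁ d₂) :=
  mulHom_ofDiagram d₁ d₂

end PartitionAlgebra

/-! ### The diagram subalgebras -/

namespace Diagram

variable {k : ℕ}

/-- The top parts of the propagating blocks of `d`, i.e. of the blocks that contain vertices of
both rows. A propagating block is determined by its top part. -/
noncomputable def propBlocks (d : Diagram k) : Finset (Finset (Fin k)) := by
  classical
  exact (Finset.univ.filter fun i => ∃ j, d (Sum.inl i) (Sum.inr j)).image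
    fun i => Finset.univ.filter fun i' => d (Sum.inl i) (Sum.inl i')

/-- The rank (propagating number): the number of propagating blocks. -/
noncomputable def rank (d : Diagram k) : ℕ := (propBlocks d).card

/-- The position of a vertex on the boundary of the rectangle, read clockwise from the top left
vertex `1, ..., k, k', ..., 1'`. -/
def position : Fin k ⊕ Fin k → ℕ :=
  Sum.elim (fun i => (i : ℕ)) fun i => 2 * k - 1 - (i : ℕ)

/-- The diagram can be drawn without crossings inside the rectangle formed by its vertices: no two
different blocks cross in the cyclic order of the boundary. -/
def IsPlanar (d : Diagram k) : Prop :=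
  ∀ x y z t, position x < position y → position y < position z → position z < position t →
    d x z → d y t → d x y

/-- All blocks have exactly one vertex in the top row and exactly one in the bottom row. -/
def IsPermutation (d : Diagram k) : Prop :=
  ∀ x, (∃! i, d x (Sum.inl i)) ∧ ∃! i, d x (Sum.inr i)

/-- All blocks have at most one vertex in the top row and at most one in the bottom row. -/
def IsRook (d : Diagram k) : Prop :=
  ∀ x, {i | d x (Sum.inl i)}.ncard ≤ 1 ∧ {i | d x (Sum.inr i)}.ncard ≤ 1

/-- All blocks have size two. -/
def IsBrauer (d : Diagram k) : Prop := ∀ x, {y | d x y}.ncard = 2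

/-- All blocks have size one or two. -/
def IsRookBrauer (d : Diagram k) : Prop := ∀ x, {y | d x y}.ncard = 1 ∨ {y | d x y}.ncard = 2

/-- `w` is a symmetric `m`-diagram: it equals its own reflection, it has rank `m`, and each
propagating block is connected to its own mirror image. -/
def IsSymmetricDiagram (m : ℕ) (w : Diagram k) : Prop :=
  transpose w = w ∧ rank w = m ∧
    ∀ i, (∃ j, w (Sum.inl i) (Sum.inr j)) → w (Sum.inl i) (Sum.inr i)

/-- The conjugate `d ∘ w ∘ dᵀ` of `w` by `d`. -/
def conj (d w : Diagram k) : Diagram k := comp (comp d w) (transpose d)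

/-- The place, counted from `0`, of the propagating block `B` of `w` when the propagating blocks
are ordered by their maximum entry. -/
noncomputable def blockIndex (w : Diagram k) (B : Finset (Fin k)) : ℕ :=
  ((propBlocks w).filter fun B' => B'.max < B.max).card

/-- Conjugation by `d` sends, for every `i`, the `i`-th propagating block `B` of `w` to the
`σ i`-th propagating block `B'` of `d ∘ w ∘ dᵀ`: when `d` is placed above `w`, the block `B'` in
the top row of `d` is connected to the block `B` in the top row of `w`. -/
def IsTwist {m : ℕ} (d w : Diagram k) (σ : Equiv.Perm (Fin m)) : Prop :=
  ∀ i : Fin m, ∃ B ∈ propBlocks w, ∃ B' ∈ propBlocks (conj d w),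
    blockIndex w B = i ∧ blockIndex (conj d w) B' = σ i ∧
      ∃ b ∈ B, ∃ b' ∈ B', stack d w (Sum.inl b') (Sum.inr (Sum.inl b))

open Classical in
/-- The twist `σ_{d,w}` of the conjugation of `w` by `d`, for a symmetric `m`-diagram `w` with
`rank (d ∘ w ∘ dᵀ) = m`. (In that case exactly one permutation satisfies `IsTwist d w`; in all
other cases the value is irrelevant.) -/
noncomputable def twist (m : ℕ) (d w : Diagram k) : Equiv.Perm (Fin m) :=
  if h : ∃ σ : Equiv.Perm (Fin m), IsTwist d w σ then h.choose else 1

/-- The diagram of a permutation `τ`, in which the bottom vertex `b` is joined to the top vertex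
`τ b`. -/
def ofPerm (k : ℕ) (τ : Equiv.Perm ℕ) : Diagram k :=
  Setoid.ker (Sum.elim (fun a => (a : ℕ)) fun b => τ (b : ℕ) : Fin k ⊕ Fin k → ℕ)

/-- The concatenation of `𝔭_{m+1}, ..., 𝔭_k`: the first `m` edges are identity edges and all other
vertices are isolated. -/
def isolatedTail (k m : ℕ) : Diagram k :=
  Setoid.ker (Sum.elim (fun a => ((a : ℕ), false)) fun b => ((b : ℕ), decide (m ≤ (b : ℕ))) :
    Fin k ⊕ Fin k → ℕ × Bool)

/-- The concatenation of `𝔢_{m+1}, 𝔢_{m+3}, ..., 𝔢_{k-1}` (for `k - m` even): the first `m` edges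
are identity edges and in each row the other vertices are paired with their neighbours. -/
def pairedTail (k m : ℕ) : Diagram k :=
  let f : ℕ → ℕ := fun a => if a < m then a else m + (a - m) / 2
  Setoid.ker (Sum.elim (fun a => (f a, false)) fun b => (f b, decide (m ≤ (b : ℕ))) :
    Fin k ⊕ Fin k → ℕ × Bool)

/-! ### The families of diagrams are closed under concatenation -/

section Closure

/-- The vertices of two diagrams, before identification of the middle rows. -/
abbrev Pair (k : ℕ) : Type := (Fin k ⊕ Fin k) ⊕ (Fin k ⊕ Fin k)

/-- The equivalence relation obtained from `E` by merging the classes of `p` and `q`. -/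
def merge {V : Type*} (E : Setoid V) (p q : V) : Setoid V where
  r := fun x y => E x y ∨ (E x p ∧ E q y) ∨ (E x q ∧ E p y)
  iseqv :=
    { refl := fun x => Or.inl (E.refl' x)
      symm := by
        rintro x y (h | ⟨h1, h2⟩ | ⟨h1, h2⟩)
        · exact Or.inl (E.symm' h)
        · exact Or.inr (Or.inr ⟨E.symm' h2, E.symm' h1⟩)
        · exact Or.inr (Or.inl ⟨E.symm' h2, E.symm' h1⟩)
      trans := by
        have tr := fun {a b c} => E.trans' (x := a) (y := b) (z := c)
        have sy := fun {a b} => E.symm' (x := a) (y := b)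
        rintro x y z (h | ⟨h1, h2⟩ | ⟨h1, h2⟩) (h' | ⟨h1', h2'⟩ | ⟨h1', h2'⟩)
        · exact Or.inl (tr h h')
        · exact Or.inr (Or.inl ⟨tr h h1', h2'⟩)
        · exact Or.inr (Or.inr ⟨tr h h1', h2'⟩)
        · exact Or.inr (Or.inl ⟨h1, tr h2 h'⟩)
        · exact Or.inr (Or.inl ⟨h1, h2'⟩)
        · exact Or.inl (tr h1 h2')
        · exact Or.inr (Or.inr ⟨h1, tr h2 h'⟩)
        · exact Or.inl (tr h1 h2')
        · exact Or.inr (Or.inr ⟨h1, h2'⟩) }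

theorem merge_apply {V : Type*} {E : Setoid V} {p q x y : V} :
    merge E p q x y ↔ E x y ∨ (E x p ∧ E q y) ∨ (E x q ∧ E p y) := Iff.rfl

theorem le_merge {V : Type*} {E : Setoid V} {p q : V} : E ≤ merge E p q := fun _ _ h => Or.inl h

variable {k : ℕ}

/-- Two diagrams side by side. -/
def pairSetoid (d₁ d₂ : Diagram k) : Setoid (Pair k) where
  r := Sum.LiftRel d₁ d₂
  iseqv :=
    { refl := by
        rintro (x | x)
        · exact Sum.LiftRel.inl (Setoid.refl' d₁ x)
        · exact Sum.LiftRel.inr (Setoid.refl' d₂ x)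
      symm := by
        rintro _ _ (h | h)
        · exact Sum.LiftRel.inl (Setoid.symm' d₁ h)
        · exact Sum.LiftRel.inr (Setoid.symm' d₂ h)
      trans := by
        rintro _ _ _ (h | h) (h' | h')
        · exact Sum.LiftRel.inl (Setoid.trans' d₁ h h')
        · exact Sum.LiftRel.inr (Setoid.trans' d₂ h h') }

/-- The `t`-th vertex of the bottom row of the first diagram. -/
def midLow (t : Fin k) : Pair k := Sum.inl (Sum.inr t)

/-- The `t`-th vertex of the top row of the second diagram. -/
def midHigh (t : Fin k) : Pair k := Sum.inr (Sum.inl t)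

/-- The first `t` vertices of the middle rows have been identified. -/
def glue (d₁ d₂ : Diagram k) : ℕ → Setoid (Pair k)
  | 0 => pairSetoid d₁ d₂
  | t + 1 =>
    if h : t < k then merge (glue d₁ d₂ t) (midLow ⟨t, h⟩) (midHigh ⟨t, h⟩) else glue d₁ d₂ t

/-- All vertices except the first `t` ones of the middle rows. -/
def remaining (k t : ℕ) : Set (Pair k) :=
  {x | ∀ i : Fin k, (i : ℕ) < t → x ≠ midLow i ∧ x ≠ midHigh i}

theorem remaining_succ {t : ℕ} (h : t < k) :
    remaining k (t + 1) = remaining k t \ {midLow ⟨t, h⟩, midHigh ⟨t, h⟩} := by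
  ext x
  simp only [remaining, Set.mem_ofPred_eq, Set.mem_sdiff, Set.mem_insert_iff,
    Set.mem_singleton_iff, not_or]
  constructor
  · intro hx
    exact ⟨fun i hi => hx i (by omega), hx ⟨t, h⟩ (by simp)⟩
  · rintro ⟨h1, h2⟩ i hi
    rcases Nat.lt_succ_iff_lt_or_eq.1 hi with h3 | h3
    · exact h1 i h3
    · have : i = ⟨t, h⟩ := Fin.ext h3
      rw [this]
      exact h2

theorem glue_induction (d₁ d₂ : Diagram k) (P : Setoid (Pair k) → Set (Pair k) → Prop)
    (h0 : P (pairSetoid d₁ d₂) Set.univ)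
    (step : ∀ E (t : ℕ) (h : t < k), P E (remaining k t) →
      P (merge E (midLow ⟨t, h⟩) (midHigh ⟨t, h⟩))
        (remaining k t \ {midLow ⟨t, h⟩, midHigh ⟨t, h⟩})) :
    P (glue d₁ d₂ k) (remaining k k) := by
  have : ∀ t, t ≤ k → P (glue d₁ d₂ t) (remaining k t) := by
    intro t
    induction t with
    | zero =>
      intro _
      have : remaining k 0 = Set.univ := by
        ext x
        simp [remaining]
      rw [this]
      exact h0
    | succ t ih =>
      intro ht
      have h : t < k := ht
      rw [remaining_succ h, glue, dif_pos h]
      exact step _ t h (ih (by omega))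
  exact this k le_rfl

/-- The outer rows of two diagrams. -/
def ends : Fin k ⊕ Fin k → Pair k := Sum.elim (fun i => Sum.inl (Sum.inl i)) fun i =>
  Sum.inr (Sum.inr i)

theorem ends_injective : Function.Injective (ends (k := k)) := by
  rintro (a | a) (b | b) h <;> simp_all [ends]

theorem ends_mem (x : Fin k ⊕ Fin k) : ends x ∈ remaining k k := by
  intro i _
  rcases x with x | x <;> simp [ends, midLow, midHigh]

theorem mem_remaining {x : Pair k} (hx : x ∈ remaining k k) : ∃ y, ends y = x := by
  rcases x with (x | x) | (x | x)
  · exact ⟨Sum.inl x, rfl⟩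
  · exact absurd rfl (hx x x.2).1
  · exact absurd rfl (hx x x.2).2
  · exact ⟨Sum.inr x, rfl⟩

theorem glue_mono (d₁ d₂ : Diagram k) {s t : ℕ} (h : s ≤ t) : glue d₁ d₂ s ≤ glue d₁ d₂ t := by
  induction h with
  | refl => exact le_rfl
  | step _ ih =>
    refine ih.trans ?_
    rw [glue]
    split_ifs
    · exact le_merge
    · exact le_rfl

theorem comp_iff_glue (d₁ d₂ : Diagram k) (x y : Fin k ⊕ Fin k) :
    comp d₁ d₂ x y ↔ glue d₁ d₂ k (ends x) (ends y) := by
  have hmid : ∀ i : Fin k, glue d₁ d₂ k (midLow i) (midHigh i) := by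
    intro i
    refine glue_mono d₁ d₂ (Nat.succ_le_of_lt i.2) ?_
    rw [glue, dif_pos i.2]
    exact Or.inr (Or.inl ⟨Setoid.refl' _ _, Setoid.refl' _ _⟩)
  have hpair : pairSetoid d₁ d₂ ≤ glue d₁ d₂ k := glue_mono d₁ d₂ (Nat.zero_le k)
  constructor
  · intro h
    let r : Fin k ⊕ Fin k ⊕ Fin k → Pair k :=
      Sum.elim (fun i => Sum.inl (Sum.inl i))
        (Sum.elim (fun i => Sum.inl (Sum.inr i)) fun i => Sum.inr (Sum.inr i))
    have hle : stack d₁ d₂ ≤ (glue d₁ d₂ k).comap r := by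
      refine sup_le (setoid_map_le_iff.2 ?_) (setoid_map_le_iff.2 ?_)
      · intro a b hab
        have e : ∀ a, r (upper a) = Sum.inl a := by rintro (a | a) <;> rfl
        change glue d₁ d₂ k (r (upper a)) (r (upper b))
        rw [e, e]
        exact hpair (Sum.LiftRel.inl hab)
      · intro a b hab
        have e : ∀ a, glue d₁ d₂ k (r (lower a)) (Sum.inr a) := by
          rintro (a | a)
          · exact hmid a
          · exact Setoid.refl' _ _
        have hab' : glue d₁ d₂ k (Sum.inr a) (Sum.inr b) := hpair (Sum.LiftRel.inr hab)
        exact Setoid.trans' (glue d₁ d₂ k) (e a) (Setoid.trans' (glue d₁ d₂ k) hab'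
          (Setoid.symm' (glue d₁ d₂ k) (e b)))
    have := hle h
    have e : ∀ a, r (outer a) = ends a := by rintro (a | a) <;> rfl
    change glue d₁ d₂ k (r (outer x)) (r (outer y)) at this
    rwa [e, e] at this
  · intro h
    let c : Pair k → Fin k ⊕ Fin k ⊕ Fin k := Sum.elim upper lower
    have hle : glue d₁ d₂ k ≤ (stack d₁ d₂).comap c := by
      refine glue_induction d₁ d₂ (fun E _ => E ≤ (stack d₁ d₂).comap c) ?_ ?_
      · rintro _ _ (hab | hab)
        · exact (le_sup_left : Setoid.map d₁ upper ≤ stack d₁ d₂) (Setoid.le_comap_map hab)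
        · exact (le_sup_right : Setoid.map d₂ lower ≤ stack d₁ d₂) (Setoid.le_comap_map hab)
      · intro E t ht hE a b hab
        have e : c (midLow ⟨t, ht⟩) = c (midHigh ⟨t, ht⟩) := rfl
        rcases hab with hab | ⟨h1, h2⟩ | ⟨h1, h2⟩
        · exact hE hab
        · have h1' : stack d₁ d₂ (c a) (c (midLow ⟨t, ht⟩)) := hE h1
          have h2' : stack d₁ d₂ (c (midHigh ⟨t, ht⟩)) (c b) := hE h2
          rw [e] at h1'
          exact Setoid.trans' (stack d₁ d₂) h1' h2'
        · have h1' : stack d₁ d₂ (c a) (c (midHigh ⟨t, ht⟩)) := hE h1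
          have h2' : stack d₁ d₂ (c (midLow ⟨t, ht⟩)) (c b) := hE h2
          rw [← e] at h1'
          exact Setoid.trans' (stack d₁ d₂) h1' h2'
    have := hle h
    have e : ∀ a, c (ends a) = outer a := by rintro (a | a) <;> rfl
    change stack d₁ d₂ (c (ends x)) (c (ends y)) at this
    rwa [e, e] at this

theorem midLow_ne_midHigh (i j : Fin k) : (midLow i : Pair k) ≠ midHigh j := by
  simp [midLow, midHigh]

theorem isRook_iff (d : Diagram k) :
    d.IsRook ↔ ∀ x y, d x y → x.isLeft = y.isLeft → x = y := by
  constructor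
  · intro h x y hxy he
    rcases x with x | x <;> rcases y with y | y
    · rw [(Set.ncard_le_one (Set.toFinite _)).1 (h (Sum.inl x)).1 x (Setoid.refl' d _) y hxy]
    · simp at he
    · simp at he
    · rw [(Set.ncard_le_one (Set.toFinite _)).1 (h (Sum.inr x)).2 x (Setoid.refl' d _) y hxy]
  · intro h x
    rw [Set.ncard_le_one (Set.toFinite _), Set.ncard_le_one (Set.toFinite _)]
    constructor
    · intro a ha b hb
      simpa using h _ _ (Setoid.trans' d (Setoid.symm' d ha) hb) rfl
    · intro a ha b hb
      simpa using h _ _ (Setoid.trans' d (Setoid.symm' d ha) hb) rfl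

theorem isRookBrauer_iff (d : Diagram k) :
    d.IsRookBrauer ↔ ∀ x y z, d x y → d x z → x ≠ y → x ≠ z → y = z := by
  constructor
  · intro h x y z hy hz hxy hxz
    by_contra hyz
    have hsub : ({x, y, z} : Set (Fin k ⊕ Fin k)) ⊆ {y | d x y} := by
      rintro w (rfl | rfl | rfl)
      · exact Setoid.refl' d _
      · exact hy
      · exact hz
    have h3 := Set.ncard_le_ncard hsub (Set.toFinite _)
    rw [Set.ncard_eq_three.2 ⟨x, y, z, hxy, hxz, hyz, rfl⟩] at h3
    rcases h x with h | h <;> omega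
  · intro h x
    by_cases hx : ∃ y, d x y ∧ x ≠ y
    · obtain ⟨y, hy, hxy⟩ := hx
      right
      rw [Set.ncard_eq_two]
      refine ⟨x, y, hxy, ?_⟩
      ext z
      constructor
      · intro hz
        by_cases hxz : x = z
        · exact Or.inl hxz.symm
        · exact Or.inr (h x y z hy hz hxy hxz).symm
      · rintro (rfl | rfl)
        · exact Setoid.refl' d _
        · exact hy
    · left
      rw [Set.ncard_eq_one]
      refine ⟨x, ?_⟩
      ext z
      constructor
      · intro hz
        by_contra hxz
        exact hx ⟨z, hz, fun h => hxz h.symm⟩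
      · rintro rfl
        exact Setoid.refl' d _

theorem isBrauer_iff (d : Diagram k) :
    d.IsBrauer ↔ d.IsRookBrauer ∧ ∀ x, ∃ y, d x y ∧ x ≠ y := by
  constructor
  · refine fun h => ⟨fun x => Or.inr (h x), fun x => ?_⟩
    obtain ⟨y, hy, hyx⟩ := Set.exists_ne_of_one_lt_ncard (a := x) (by rw [h x]; omega)
    exact ⟨y, hy, hyx.symm⟩
  · rintro ⟨h1, h2⟩ x
    obtain ⟨y, hy, hxy⟩ := h2 x
    rcases h1 x with h | h
    · rw [Set.ncard_eq_one] at h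
      obtain ⟨a, ha⟩ := h
      have hx : x ∈ ({a} : Set _) := ha ▸ Setoid.refl' d x
      have hy' : y ∈ ({a} : Set _) := ha ▸ hy
      rw [Set.mem_singleton_iff] at hx hy'
      exact absurd (hx.trans hy'.symm) hxy
    · exact h

theorem isPermutation_iff (d : Diagram k) : d.IsPermutation ↔ d.IsRook ∧ d.IsBrauer := by
  constructor
  · intro h
    have hr : d.IsRook := by
      intro x
      obtain ⟨⟨i, _, hi⟩, j, _, hj⟩ := h x
      rw [Set.ncard_le_one (Set.toFinite _), Set.ncard_le_one (Set.toFinite _)]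
      exact ⟨fun a ha b hb => (hi a ha).trans (hi b hb).symm,
        fun a ha b hb => (hj a ha).trans (hj b hb).symm⟩
    rw [isBrauer_iff, isRookBrauer_iff]
    rw [isRook_iff] at hr
    refine ⟨(isRook_iff d).2 hr, ?_, ?_⟩
    · intro x y z hy hz hxy hxz
      have h1 := fun he => hxy (hr x y hy he)
      have h2 := fun he => hxz (hr x z hz he)
      refine hr y z (Setoid.trans' d (Setoid.symm' d hy) hz) ?_
      rcases x with x | x <;> rcases y with y | y <;> rcases z with z | z <;> simp_all
    · intro x
      obtain ⟨⟨i, hi, _⟩, j, hj, _⟩ := h x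
      rcases x with x | x
      · exact ⟨Sum.inr j, hj, by simp⟩
      · exact ⟨Sum.inl i, hi, by simp⟩
  · rintro ⟨hr, hb⟩ x
    rw [isRook_iff] at hr
    obtain ⟨y, hy, hxy⟩ := ((isBrauer_iff d).1 hb).2 x
    have hne := fun he => hxy (hr x y hy he)
    have htop : ∃ i, d x (Sum.inl i) := by
      rcases x with x | x
      · exact ⟨x, Setoid.refl' d _⟩
      · rcases y with y | y
        · exact ⟨y, hy⟩
        · simp at hne
    have hbot : ∃ i, d x (Sum.inr i) := by
      rcases x with x | x
      · rcases y with y | y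
        · simp at hne
        · exact ⟨y, hy⟩
      · exact ⟨x, Setoid.refl' d _⟩
    obtain ⟨i, hi⟩ := htop
    obtain ⟨j, hj⟩ := hbot
    refine ⟨⟨i, hi, fun a ha => ?_⟩, j, hj, fun a ha => ?_⟩
    · simpa using hr _ _ (Setoid.trans' d (Setoid.symm' d ha) hi) rfl
    · simpa using hr _ _ (Setoid.trans' d (Setoid.symm' d ha) hj) rfl

theorem midLow_mem {t : ℕ} (ht : t < k) : (midLow ⟨t, ht⟩ : Pair k) ∈ remaining k t :=
  fun i hi => ⟨by simp [midLow, Fin.ext_iff]; omega, by simp [midLow, midHigh]⟩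

theorem midHigh_mem {t : ℕ} (ht : t < k) : (midHigh ⟨t, ht⟩ : Pair k) ∈ remaining k t :=
  fun i hi => ⟨by simp [midLow, midHigh], by simp [midHigh, Fin.ext_iff]; omega⟩

/-- All blocks contain at most one vertex of `S` of each kind. -/
def OneOfEach {V : Type*} (f : V → Bool) (E : Setoid V) (S : Set V) : Prop :=
  ∀ x ∈ S, ∀ y ∈ S, E x y → f x = f y → x = y

theorem OneOfEach.merge {V : Type*} {f : V → Bool} {E : Setoid V} {S : Set V}
    (hE : OneOfEach f E S) {p q : V} (hp : p ∈ S) (hq : q ∈ S) (fp : f p = false)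
    (fq : f q = true) : OneOfEach f (merge E p q) (S \ {p, q}) := by
  rintro x ⟨hx, hxpq⟩ y ⟨hy, hypq⟩ hxy he
  simp only [Set.mem_insert_iff, Set.mem_singleton_iff, not_or] at hxpq hypq
  rcases hxy with h | ⟨h1, h2⟩ | ⟨h1, h2⟩
  · exact hE x hx y hy h he
  · have a1 := hE x hx p hp h1
    have a2 := hE q hq y hy h2
    cases hf : f x
    · exact absurd (a1 (hf.trans fp.symm)) hxpq.1
    · exact absurd (a2 (fq.trans (hf.symm.trans he))).symm hypq.2
  · have a1 := hE x hx q hq h1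
    have a2 := hE p hp y hy h2
    cases hf : f x
    · exact absurd (a2 (fp.trans (hf.symm.trans he))).symm hypq.1
    · exact absurd (a1 (hf.trans fq.symm)) hxpq.2

theorem oneOfEach_pair {d₁ d₂ : Diagram k} (h₁ : d₁.IsRook) (h₂ : d₂.IsRook) :
    OneOfEach (Sum.elim Sum.isLeft Sum.isLeft) (pairSetoid d₁ d₂) Set.univ := by
  rw [isRook_iff] at h₁ h₂
  intro x _ y _ hxy he
  rcases hxy with hxy | hxy
  · exact congrArg Sum.inl (h₁ _ _ hxy he)
  · exact congrArg Sum.inr (h₂ _ _ hxy he)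

theorem IsRook.comp {d₁ d₂ : Diagram k} (h₁ : d₁.IsRook) (h₂ : d₂.IsRook) :
    IsRook (comp d₁ d₂) := by
  have key := glue_induction d₁ d₂ (OneOfEach (Sum.elim Sum.isLeft Sum.isLeft))
    (oneOfEach_pair h₁ h₂)
    (fun E t ht hE => hE.merge (midLow_mem ht) (midHigh_mem ht) rfl rfl)
  rw [isRook_iff]
  intro x y hxy he
  have hl : ∀ x : Fin k ⊕ Fin k,
      (Sum.elim Sum.isLeft Sum.isLeft (ends x) : Bool) = x.isLeft := by
    rintro (x | x) <;> rfl
  refine ends_injective (key _ (ends_mem x) _ (ends_mem y) ((comp_iff_glue d₁ d₂ x y).1 hxy) ?_)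
  rw [hl, hl, he]

/-- All blocks contain at most two vertices of `S`. -/
def SmallOn {V : Type*} (E : Setoid V) (S : Set V) : Prop :=
  ∀ x ∈ S, ∀ y ∈ S, ∀ z ∈ S, E x y → E x z → x ≠ y → x ≠ z → y = z

theorem SmallOn.merge {V : Type*} {E : Setoid V} {S : Set V} (h : SmallOn E S) {p q : V}
    (hp : p ∈ S) (hq : q ∈ S) (hpq : p ≠ q) : SmallOn (merge E p q) (S \ {p, q}) := by
  have tr := fun {a b c} => E.trans' (x := a) (y := b) (z := c)
  have sy := fun {a b} => E.symm' (x := a) (y := b)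
  rintro x ⟨hx, hx'⟩ y ⟨hy, hy'⟩ z ⟨hz, hz'⟩ h1 h2 hxy hxz
  simp only [Set.mem_insert_iff, Set.mem_singleton_iff, not_or] at hx' hy' hz'
  rcases h1 with h1 | ⟨h1, h1'⟩ | ⟨h1, h1'⟩ <;> rcases h2 with h2 | ⟨h2, h2'⟩ | ⟨h2, h2'⟩
  · exact h x hx y hy z hz h1 h2 hxy hxz
  · exact absurd (h x hx y hy p hp h1 h2 hxy hx'.1) hy'.1
  · exact absurd (h x hx y hy q hq h1 h2 hxy hx'.2) hy'.2
  · exact absurd (h x hx z hz p hp h2 h1 hxz hx'.1) hz'.1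
  · exact h q hq y hy z hz h1' h2' (Ne.symm hy'.2) (Ne.symm hz'.2)
  · exact absurd (h x hx p hp q hq h1 h2 hx'.1 hx'.2) hpq
  · exact absurd (h x hx z hz q hq h2 h1 hxz hx'.2) hz'.2
  · exact absurd (h x hx q hq p hp h1 h2 hx'.2 hx'.1) hpq.symm
  · exact h p hp y hy z hz h1' h2' (Ne.symm hy'.1) (Ne.symm hz'.1)

theorem smallOn_pair {d₁ d₂ : Diagram k} (h₁ : d₁.IsRookBrauer) (h₂ : d₂.IsRookBrauer) :
    SmallOn (pairSetoid d₁ d₂) Set.univ := by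
  rw [isRookBrauer_iff] at h₁ h₂
  rintro x - y - z - hxy hxz h h'
  rcases hxy with hxy | hxy
  · rcases hxz with hxz | hxz
    rw [h₁ _ _ _ hxy hxz (fun e => h (by rw [e])) (fun e => h' (by rw [e]))]
  · rcases hxz with hxz | hxz
    rw [h₂ _ _ _ hxy hxz (fun e => h (by rw [e])) (fun e => h' (by rw [e]))]

theorem IsRookBrauer.comp {d₁ d₂ : Diagram k} (h₁ : d₁.IsRookBrauer) (h₂ : d₂.IsRookBrauer) :
    IsRookBrauer (comp d₁ d₂) := by
  have key := glue_induction d₁ d₂ SmallOn (smallOn_pair h₁ h₂) fun E t ht hE =>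
    hE.merge (midLow_mem ht) (midHigh_mem ht) (midLow_ne_midHigh _ _)
  rw [isRookBrauer_iff]
  intro x y z hy hz hxy hxz
  rw [comp_iff_glue] at hy hz
  exact ends_injective (key _ (ends_mem x) _ (ends_mem y) _ (ends_mem z) hy hz
    (ends_injective.ne hxy) (ends_injective.ne hxz))

theorem IsBrauer.comp {d₁ d₂ : Diagram k} (h₁ : d₁.IsBrauer) (h₂ : d₂.IsBrauer) :
    IsBrauer (comp d₁ d₂) := by
  rw [isBrauer_iff] at *
  have key := glue_induction d₁ d₂
    (fun E S => SmallOn E S ∧ ∀ x ∈ S, ∃ y ∈ S, E x y ∧ x ≠ y)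
    (by
      refine ⟨smallOn_pair h₁.1 h₂.1, ?_⟩
      rintro (x | x) -
      · obtain ⟨y, hy, hxy⟩ := h₁.2 x
        exact ⟨Sum.inl y, trivial, Sum.LiftRel.inl hy, by simpa using hxy⟩
      · obtain ⟨y, hy, hxy⟩ := h₂.2 x
        exact ⟨Sum.inr y, trivial, Sum.LiftRel.inr hy, by simpa using hxy⟩)
    (by
      rintro E t ht ⟨hE, hE'⟩
      have hp := midLow_mem ht
      have hq := midHigh_mem ht
      have hpq := midLow_ne_midHigh (k := k) ⟨t, ht⟩ ⟨t, ht⟩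
      refine ⟨hE.merge hp hq hpq, ?_⟩
      generalize (midLow ⟨t, ht⟩ : Pair k) = p at *
      generalize (midHigh ⟨t, ht⟩ : Pair k) = q at *
      have sy := fun {a b} => E.symm' (x := a) (y := b)
      rintro x ⟨hx, hx'⟩
      simp only [Set.mem_insert_iff, Set.mem_singleton_iff, not_or] at hx'
      have partner : ∀ p ∈ remaining k t, ∀ q ∈ remaining k t, p ≠ q → x ≠ p → x ≠ q → E x p →
          ∃ z ∈ remaining k t, z ≠ p ∧ z ≠ q ∧ E q z ∧ x ≠ z := by
        intro p hp q hq hpq hxp hxq h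
        obtain ⟨z, hz, hqz, hne⟩ := hE' q hq
        refine ⟨z, hz, ?_, hne.symm, hqz, ?_⟩
        · rintro rfl
          exact hxq (hE z hz x hx q hq (sy h) (sy hqz) (Ne.symm hxp) hpq)
        · rintro rfl
          exact hpq (hE x hx p hp q hq h (sy hqz) hxp hxq)
      obtain ⟨y, hy, hxy, hne⟩ := hE' x hx
      by_cases hyp : y = p
      · subst hyp
        obtain ⟨z, hz, z1, z2, z3, z4⟩ := partner y hp q hq hpq hx'.1 hx'.2 hxy
        exact ⟨z, ⟨hz, by simp [z1, z2]⟩, Or.inr (Or.inl ⟨hxy, z3⟩), z4⟩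
      by_cases hyq : y = q
      · subst hyq
        obtain ⟨z, hz, z1, z2, z3, z4⟩ := partner y hq p hp (Ne.symm hpq) hx'.2 hx'.1 hxy
        exact ⟨z, ⟨hz, by simp [z1, z2]⟩, Or.inr (Or.inr ⟨hxy, z3⟩), z4⟩
      exact ⟨y, ⟨hy, by simp [hyp, hyq]⟩, Or.inl hxy, hne⟩)
  refine ⟨h₁.1.comp h₂.1, fun x => ?_⟩
  obtain ⟨y, hy, hxy, hne⟩ := key.2 _ (ends_mem x)
  obtain ⟨y, rfl⟩ := mem_remaining hy
  exact ⟨y, (comp_iff_glue _ _ _ _).2 hxy, fun h => hne (by rw [h])⟩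

theorem IsPermutation.comp {d₁ d₂ : Diagram k} (h₁ : d₁.IsPermutation) (h₂ : d₂.IsPermutation) :
    IsPermutation (comp d₁ d₂) := by
  rw [isPermutation_iff] at *
  exact ⟨h₁.1.comp h₂.1, h₁.2.comp h₂.2⟩

/-- No two different blocks cross on `S`, with respect to the order given by `f`. -/
def NoncrossingOn {V : Type*} (f : V → ℕ) (E : Setoid V) (S : Set V) : Prop :=
  ∀ a ∈ S, ∀ b ∈ S, ∀ c ∈ S, ∀ d ∈ S, f a < f b → f b < f c → f c < f d → E a c → E b d → E a b

theorem NoncrossingOn.merge {V : Type*} {f : V → ℕ} {E : Setoid V} {S : Set V}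
    (h : NoncrossingOn f E S) (hf : Function.Injective f) {p q : V} (hp : p ∈ S) (hq : q ∈ S)
    (hpq : f p < f q) (hadj : ∀ x ∈ S, f x ≤ f p ∨ f q ≤ f x) :
    NoncrossingOn f (merge E p q) (S \ {p, q}) := by
  have tr := fun {a b c} => E.trans' (x := a) (y := b) (z := c)
  have sy := fun {a b} => E.symm' (x := a) (y := b)
  -- one of the two links is original and the other one passes through the merged points
  have main : ∀ a b c d p' q', a ∈ S → b ∈ S → c ∈ S → d ∈ S → p' ∈ S → q' ∈ S →
      f a < f b → f b < f c → f c < f d →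
      (f a < f p' → f p' < f c → f a < f q' ∧ f q' < f c) →
      (f a > f p' → f a > f q') → (f c < f p' → f c < f q') →
      E a c → E b p' → E q' d → f a ≠ f p' → f c ≠ f p' → E a b ∨ (E a q' ∧ E p' b) := by
    intro a b c d p' q' ha hb hc hd hp' hq' hab hbc hcd i1 i2 i3 hac hbp hqd n1 n2
    rcases lt_or_gt_of_ne n1 with h1 | h1
    · rcases lt_or_gt_of_ne n2 with h2 | h2
      · exact Or.inl (h a ha b hb c hc p' hp' hab hbc h2 hac hbp)
      · obtain ⟨h3, h4⟩ := i1 h1 h2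
        exact Or.inr ⟨h a ha q' hq' c hc d hd h3 h4 hcd hac hqd, sy hbp⟩
    · exact Or.inl (sy (tr hbp (h p' hp' a ha b hb c hc h1 hab hbc (sy hbp) hac)))
  have main' : ∀ a b c d p' q', a ∈ S → b ∈ S → c ∈ S → d ∈ S → p' ∈ S → q' ∈ S →
      f a < f b → f b < f c → f c < f d →
      (f b < f p' → f p' < f d → f b < f q' ∧ f q' < f d) →
      E b d → E c p' → E q' a → f b ≠ f p' → f d ≠ f p' → E a b ∨ (E a q' ∧ E p' b) := by
    intro a b c d p' q' ha hb hc hd hp' hq' hab hbc hcd i1 hbd hcp hqa n1 n2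
    rcases lt_or_gt_of_ne n1 with h1 | h1
    · rcases lt_or_gt_of_ne n2 with h2 | h2
      · have hbc' := h b hb c hc d hd p' hp' hbc hcd h2 hbd hcp
        exact Or.inr ⟨sy hqa, tr (sy hcp) (sy hbc')⟩
      · obtain ⟨h3, h4⟩ := i1 h1 h2
        exact Or.inl (h a ha b hb q' hq' d hd hab h3 h4 (sy hqa) hbd)
    · have := h p' hp' b hb c hc d hd h1 hbc hcd (sy hcp) hbd
      exact Or.inr ⟨sy hqa, this⟩
  rintro a ⟨ha, ha'⟩ b ⟨hb, hb'⟩ c ⟨hc, hc'⟩ d ⟨hd, hd'⟩ hab hbc hcd hac hbd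
  simp only [Set.mem_insert_iff, Set.mem_singleton_iff, not_or] at ha' hb' hc' hd'
  have nep : ∀ x, x ≠ p → f x ≠ f p := fun x hx => hf.ne hx
  have neq : ∀ x, x ≠ q → f x ≠ f q := fun x hx => hf.ne hx
  have := nep a ha'.1
  have := nep b hb'.1
  have := nep c hc'.1
  have := nep d hd'.1
  have := neq a ha'.2
  have := neq b hb'.2
  have := neq c hc'.2
  have := neq d hd'.2
  have := hadj a ha
  have := hadj b hb
  have := hadj c hc
  have := hadj d hd
  rw [merge_apply] at hac hbd ⊢
  rcases hac with hac | ⟨h1, h2⟩ | ⟨h1, h2⟩ <;> rcases hbd with hbd | ⟨h3, h4⟩ | ⟨h3, h4⟩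
  · exact Or.inl (h a ha b hb c hc d hd hab hbc hcd hac hbd)
  · rcases main a b c d p q ha hb hc hd hp hq hab hbc hcd (by omega) (by omega) (by omega)
      hac h3 h4 (by omega) (by omega) with h | h
    · exact Or.inl h
    · exact Or.inr (Or.inr h)
  · rcases main a b c d q p ha hb hc hd hq hp hab hbc hcd (by omega) (by omega) (by omega)
      hac h3 h4 (by omega) (by omega) with h | h
    · exact Or.inl h
    · exact Or.inr (Or.inl h)
  · rcases main' a b c d q p ha hb hc hd hq hp hab hbc hcd (by omega)
      hbd (sy h2) (sy h1) (by omega) (by omega) with h | h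
    · exact Or.inl h
    · exact Or.inr (Or.inl h)
  · exact Or.inl (tr h1 (sy h3))
  · exact Or.inr (Or.inl ⟨h1, sy h3⟩)
  · rcases main' a b c d p q ha hb hc hd hp hq hab hbc hcd (by omega)
      hbd (sy h2) (sy h1) (by omega) (by omega) with h | h
    · exact Or.inl h
    · exact Or.inr (Or.inr h)
  · exact Or.inr (Or.inr ⟨h1, sy h3⟩)
  · exact Or.inl (tr h1 (sy h3))

theorem position_lt (x : Fin k ⊕ Fin k) : position x < 2 * k := by
  rcases x with x | x <;> simp [position] <;> omega

theorem position_injective : Function.Injective (position (k := k)) := by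
  rintro (a | a) (b | b) h <;> simp [position] at h <;> (try simp) <;> omega

theorem IsPlanar.comp {d₁ d₂ : Diagram k} (h₁ : d₁.IsPlanar) (h₂ : d₂.IsPlanar) :
    IsPlanar (comp d₁ d₂) := by
  let f : Pair k → ℕ := Sum.elim position fun x => 2 * k + position x
  have hf : Function.Injective f := by
    rintro (a | a) (b | b) h
    · rw [position_injective h]
    · have := position_lt a
      simp [f] at h
      omega
    · have := position_lt b
      simp [f] at h
      omega
    · have h' : position a = position b := by simpa [f] using h
      rw [position_injective h']
  have key := glue_induction d₁ d₂ (NoncrossingOn f)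
    (by
      rintro a - b - c - d - hab hbc hcd hac hbd
      rcases hac with @⟨a, c, hac⟩ | @⟨a, c, hac⟩
      · rcases hbd with @⟨b, d, hbd⟩ | @⟨b, d, hbd⟩
        · exact Sum.LiftRel.inl (h₁ a b c d hab hbc hcd hac hbd)
        · have := position_lt c
          simp [f] at hbc
          omega
      · rcases hbd with @⟨b, d, hbd⟩ | @⟨b, d, hbd⟩
        · have := position_lt b
          simp [f] at hab
          omega
        · exact Sum.LiftRel.inr (h₂ a b c d (by simpa [f] using hab) (by simpa [f] using hbc)
            (by simpa [f] using hcd) hac hbd))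
    (by
      intro E t ht hE
      refine hE.merge hf (midLow_mem ht) (midHigh_mem ht) ?_ ?_
      · simp [f, midLow, midHigh, position]
        omega
      · intro x hx
        by_contra hcon
        rw [not_or, not_le, not_le] at hcon
        obtain ⟨c1, c2⟩ := hcon
        rcases x with (x | x) | (x | x) <;> simp [f, midLow, midHigh, position] at c1 c2
        · omega
        · by_cases hxt : (x : ℕ) < t
          · exact (hx x hxt).1 rfl
          · omega
        · by_cases hxt : (x : ℕ) < t
          · exact (hx x hxt).2 rfl
          · omega
        · omega)
  intro x y z t hxy hyz hzt hxz hyt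
  rw [comp_iff_glue] at hxz hyt ⊢
  have mono : ∀ x y : Fin k ⊕ Fin k, position x < position y → f (ends x) < f (ends y) := by
    intro x y h
    rcases x with x | x <;> rcases y with y | y <;> simp [f, ends, position] at h ⊢ <;> omega
  exact key _ (ends_mem x) _ (ends_mem y) _ (ends_mem z) _ (ends_mem t) (mono _ _ hxy)
    (mono _ _ hyz) (mono _ _ hzt) hxz hyt

theorem isPermutation_one : IsPermutation (one k) := by
  intro x
  rcases x with x | x <;>
    exact ⟨⟨x, rfl, fun y hy => Eq.symm hy⟩, x, rfl, fun y hy => Eq.symm hy⟩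

theorem isPlanar_one : IsPlanar (one k) := by
  intro x y z t hxy hyz hzt hxz hyt
  have h1 : (Sum.elim id id x : Fin k) = Sum.elim id id z := hxz
  have h2 : (Sum.elim id id y : Fin k) = Sum.elim id id t := hyt
  exfalso
  rcases x with x | x <;> rcases y with y | y <;> rcases z with z | z <;> rcases t with t | t <;>
    simp [position] at h1 h2 hxy hyz hzt <;> subst h1 <;> subst h2 <;> omega

theorem exists_of_stack_outer {d₁ d₂ : Diagram k} {i j : Fin k}
    (h : stack d₁ d₂ (Sum.inl i) (Sum.inr (Sum.inr j))) : ∃ b, d₂ (Sum.inl b) (Sum.inr j) := by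
  by_contra hcon
  push Not at hcon
  let c : Fin k ⊕ Fin k ⊕ Fin k → Prop :=
    Sum.elim (fun _ => False) (Sum.elim (fun _ => False) fun j' => d₂ (Sum.inr j') (Sum.inr j))
  have hle : stack d₁ d₂ ≤ Setoid.ker c := by
    refine sup_le (setoid_map_le_iff.2 ?_) (setoid_map_le_iff.2 ?_)
    · rintro (x | x) (y | y) _ <;> exact rfl
    · intro x y hxy
      have e : ∀ x, c (lower x) ↔ d₂ x (Sum.inr j) := by
        rintro (x | x)
        · exact iff_of_false id (hcon x)
        · exact Iff.rfl
      change c (lower x) = c (lower y)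
      rw [eq_iff_iff, e, e]
      exact ⟨fun hx => Setoid.trans' d₂ (Setoid.symm' d₂ hxy) hx,
        fun hy => Setoid.trans' d₂ hxy hy⟩
  have h' : False = d₂ (Sum.inr j) (Sum.inr j) := hle h
  exact h' ▸ Setoid.refl' d₂ _

theorem mem_propBlocks {d : Diagram k} {B : Finset (Fin k)} :
    B ∈ propBlocks d ↔ ∃ i, (∃ j, d (Sum.inl i) (Sum.inr j)) ∧
      ∀ i', i' ∈ B ↔ d (Sum.inl i) (Sum.inl i') := by
  classical
  simp only [propBlocks, Finset.mem_image, Finset.mem_filter, Finset.mem_univ, true_and,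
    Finset.ext_iff]
  exact exists_congr fun i => and_congr_right fun _ => forall_congr' fun i' => iff_comm

/-- Multiplication cannot increase the rank. -/
theorem rank_comp_le (d₁ d₂ : Diagram k) : rank (comp d₁ d₂) ≤ rank d₂ := by
  classical
  rcases isEmpty_or_nonempty (Fin k) with hk | hk
  · simp [rank, propBlocks, Finset.univ_eq_empty]
  have hex : ∀ B ∈ propBlocks (comp d₁ d₂), ∃ b i j, d₂ (Sum.inl b) (Sum.inr j) ∧
      comp d₁ d₂ (Sum.inl i) (Sum.inr j) ∧
      ∀ i', i' ∈ B ↔ comp d₁ d₂ (Sum.inl i) (Sum.inl i') := by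
    intro B hB
    obtain ⟨i, ⟨j, hij⟩, hB⟩ := mem_propBlocks.1 hB
    obtain ⟨b, hb⟩ := exists_of_stack_outer (show stack d₁ d₂ _ _ from hij)
    exact ⟨b, i, j, hb, hij, hB⟩
  choose! b i j hb hij hB using hex
  refine Finset.card_le_card_of_injOn
    (fun B => Finset.univ.filter fun i' => d₂ (Sum.inl (b B)) (Sum.inl i')) ?_ ?_
  · intro B hB'
    exact mem_propBlocks.2 ⟨b B, ⟨j B, hb B hB'⟩, fun i' => by simp⟩
  · intro B hB1 B' hB2 h
    have hbb : d₂ (Sum.inl (b B)) (Sum.inl (b B')) := by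
      have : b B' ∈ Finset.univ.filter fun i' => d₂ (Sum.inl (b B)) (Sum.inl i') := by
        rw [show (Finset.univ.filter fun i' => d₂ (Sum.inl (b B)) (Sum.inl i')) = _ from h]
        simp
      simpa using this
    have hjj : comp d₁ d₂ (Sum.inr (j B)) (Sum.inr (j B')) := by
      have : d₂ (Sum.inr (j B)) (Sum.inr (j B')) :=
        Setoid.trans' d₂ (Setoid.symm' d₂ (hb B hB1)) (Setoid.trans' d₂ hbb (hb B' hB2))
      exact (le_sup_right : Setoid.map d₂ lower ≤ stack d₁ d₂) (Setoid.le_comap_map this)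
    have hii : comp d₁ d₂ (Sum.inl (i B)) (Sum.inl (i B')) :=
      Setoid.trans' (comp d₁ d₂) (hij B hB1) (Setoid.trans' (comp d₁ d₂) hjj
        (Setoid.symm' (comp d₁ d₂) (hij B' hB2)))
    ext x
    rw [hB B hB1, hB B' hB2]
    exact ⟨fun hx => Setoid.trans' (comp d₁ d₂) (Setoid.symm' (comp d₁ d₂) hii) hx,
      fun hx => Setoid.trans' (comp d₁ d₂) hii hx⟩

end Closure

end Diagram

/-- The partition algebra and its diagram subalgebras. -/
inductive DiagramFamily : Type
  | partition
  | symmetricGroup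
  | rook
  | brauer
  | rookBrauer
  | planarPartition
  | identity
  | temperleyLieb
  | planarRook
  | motzkin

/-- The trace, on the `A`-module `M`, of the action of `a`. -/
noncomputable def moduleCharacter {A : Type*} [Ring A] [Algebra ℂ A] (M : Type*) [AddCommGroup M]
    [Module ℂ M] [Module A M] [IsScalarTower ℂ A M] (a : A) : ℂ :=
  LinearMap.trace ℂ M (Algebra.lsmul ℂ ℂ M a)

/-! ### Irreducible modules of symmetric groups -/

namespace YoungDiagram

/-- The diagram `λ*` obtained from `λ` by removing its first row. -/
def removeFirstRow (lam : YoungDiagram) : YoungDiagram where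
  cells := (lam.cells.filter fun c => 1 ≤ c.1).image fun c => (c.1 - 1, c.2)
  isLowerSet := by
    rintro ⟨i, j⟩ ⟨i', j'⟩ ⟨h1, h2⟩ h
    simp only [Finset.coe_image, Finset.coe_filter, Set.mem_image, Set.mem_ofPred_eq, Prod.mk.injEq,
      Prod.exists, mem_cells] at h ⊢
    simp only at h1 h2
    obtain ⟨a, b, ⟨hab, ha⟩, rfl, rfl⟩ := h
    exact ⟨i' + 1, j', ⟨lam.up_left_mem (by omega) h2 hab, by omega⟩, by omega, rfl⟩

theorem card_columnOrder (μ : YoungDiagram) :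
    (μ.cells.map (Equiv.trans (Equiv.prodComm ℕ ℕ) toLex).toEmbedding).card = μ.card :=
  Finset.card_map _

/-- The box of the entry `a` in the column-reading tableau of shape `μ`, in which the entries
increase consecutively down the columns, taken from left to right. -/
noncomputable def columnReading (μ : YoungDiagram) (a : Fin μ.card) : ℕ × ℕ :=
  (ofLex (Finset.orderEmbOfFin _ μ.card_columnOrder a)).swap

open Classical in
/-- The permutations that preserve the rows of the column-reading tableau. -/
noncomputable def rowGroup (μ : YoungDiagram) : Finset (Equiv.Perm (Fin μ.card)) :=
  Finset.univ.filter fun ρ => ∀ a, (μ.columnReading (ρ a)).1 = (μ.columnReading a).1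

open Classical in
/-- The permutations that preserve the columns of the column-reading tableau. -/
noncomputable def columnGroup (μ : YoungDiagram) : Finset (Equiv.Perm (Fin μ.card)) :=
  Finset.univ.filter fun γ => ∀ a, (μ.columnReading (γ a)).2 = (μ.columnReading a).2

/-- The image of the Young symmetrizer `∑ sign(γ) γ ρ` under a map of `S_m` to a complex vector
space, extended linearly. -/
noncomputable def youngSymmetrizer (μ : YoungDiagram) {A : Type*} [AddCommGroup A] [Module ℂ A]
    (f : Equiv.Perm (Fin μ.card) → A) : A :=
  ∑ γ ∈ μ.columnGroup, ∑ ρ ∈ μ.rowGroup, ((Equiv.Perm.sign γ : ℤ) : ℂ) • f (γ * ρ)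

/-- The irreducible module `ℂ[S_m] p_μ` of the symmetric group, a left ideal of the group
algebra. -/
noncomputable def spechtModule (μ : YoungDiagram) :
    Ideal (MonoidAlgebra ℂ (Equiv.Perm (Fin μ.card))) :=
  Ideal.span {μ.youngSymmetrizer fun σ => MonoidAlgebra.single σ 1}

/-- The irreducible character of the symmetric group `S_m` indexed by `μ`. -/
noncomputable def symmetricCharacter (μ : YoungDiagram) (σ : Equiv.Perm (Fin μ.card)) : ℂ :=
  moduleCharacter μ.spechtModule (MonoidAlgebra.single σ (1 : ℂ))

end YoungDiagram

/-! ### Irreducible modules of the diagram algebras -/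

namespace DiagramFamily

/-- The diagram basis of the algebra. -/
def diagrams (F : DiagramFamily) (k : ℕ) : Set (Diagram k) :=
  match F with
  | partition => Set.univ
  | symmetricGroup => {d | d.IsPermutation}
  | rook => {d | d.IsRook}
  | brauer => {d | d.IsBrauer}
  | rookBrauer => {d | d.IsRookBrauer}
  | planarPartition => {d | d.IsPlanar}
  | identity => {d | d.IsPermutation ∧ d.IsPlanar}
  | temperleyLieb => {d | d.IsBrauer ∧ d.IsPlanar}
  | planarRook => {d | d.IsRook ∧ d.IsPlanar}
  | motzkin => {d | d.IsRookBrauer ∧ d.IsPlanar}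

/-- The algebras all of whose diagrams are planar. -/
def Planar : DiagramFamily → Prop
  | planarPartition | identity | temperleyLieb | planarRook | motzkin => True
  | partition | symmetricGroup | rook | brauer | rookBrauer => False

/-- The algebras in which all blocks have size two and non-propagating vertices come in pairs. -/
def Paired : DiagramFamily → Prop
  | brauer | temperleyLieb => True
  | _ => False

theorem one_mem (F : DiagramFamily) (k : ℕ) : Diagram.one k ∈ F.diagrams k := by
  have h1 := (Diagram.isPermutation_iff (Diagram.one k)).1 Diagram.isPermutation_one
  have h2 := ((Diagram.isBrauer_iff (Diagram.one k)).1 h1.2).1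
  have h3 := Diagram.isPlanar_one (k := k)
  cases F
  exacts [trivial, Diagram.isPermutation_one, h1.1, h1.2, h2, h3,
    ⟨Diagram.isPermutation_one, h3⟩, ⟨h1.2, h3⟩, ⟨h1.1, h3⟩, ⟨h2, h3⟩]

theorem comp_mem (F : DiagramFamily) {k : ℕ} {d₁ d₂ : Diagram k} (h₁ : d₁ ∈ F.diagrams k)
    (h₂ : d₂ ∈ F.diagrams k) : Diagram.comp d₁ d₂ ∈ F.diagrams k := by
  cases F
  exacts [trivial, Diagram.IsPermutation.comp h₁ h₂, Diagram.IsRook.comp h₁ h₂,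
    Diagram.IsBrauer.comp h₁ h₂, Diagram.IsRookBrauer.comp h₁ h₂, Diagram.IsPlanar.comp h₁ h₂,
    ⟨Diagram.IsPermutation.comp h₁.1 h₂.1, Diagram.IsPlanar.comp h₁.2 h₂.2⟩,
    ⟨Diagram.IsBrauer.comp h₁.1 h₂.1, Diagram.IsPlanar.comp h₁.2 h₂.2⟩,
    ⟨Diagram.IsRook.comp h₁.1 h₂.1, Diagram.IsPlanar.comp h₁.2 h₂.2⟩,
    ⟨Diagram.IsRookBrauer.comp h₁.1 h₂.1, Diagram.IsPlanar.comp h₁.2 h₂.2⟩]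

variable (F : DiagramFamily) (k : ℕ) (n : ℂ)

/-- The complex span of the diagrams of the family that have rank less than `m`. -/
noncomputable def rankSpan (m : ℕ) : Submodule ℂ (PartitionAlgebra k n) :=
  Submodule.span ℂ {a | ∃ d ∈ F.diagrams k, d.rank < m ∧ a = PartitionAlgebra.ofDiagram n d}

/-- The diagram algebra `A_k`: the complex span of its diagrams. -/
noncomputable def algebra : Subalgebra ℂ (PartitionAlgebra k n) :=
  Submodule.toSubalgebra
    (Submodule.span ℂ {a | ∃ d ∈ F.diagrams k, a = PartitionAlgebra.ofDiagram n d})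
    (Submodule.subset_span ⟨Diagram.one k, F.one_mem k, rfl⟩)
    (by
      intro x y hx hy
      induction hx, hy using Submodule.span_induction₂ with
      | mem_mem a b ha hb =>
        obtain ⟨d₁, h₁, rfl⟩ := ha
        obtain ⟨d₂, h₂, rfl⟩ := hb
        rw [PartitionAlgebra.ofDiagram_mul]
        exact Submodule.smul_mem _ _ (Submodule.subset_span ⟨_, F.comp_mem h₁ h₂, rfl⟩)
      | zero_left b _ => rw [zero_mul]; exact Submodule.zero_mem _
      | zero_right a _ => rw [mul_zero]; exact Submodule.zero_mem _
      | add_left a b c _ _ _ h h' => rw [add_mul]; exact Submodule.add_mem _ h h'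
      | add_right a b c _ _ _ h h' => rw [mul_add]; exact Submodule.add_mem _ h h'
      | smul_left r a b _ _ h => rw [smul_mul_assoc]; exact Submodule.smul_mem _ _ h
      | smul_right r a b _ _ h => rw [mul_smul_comm]; exact Submodule.smul_mem _ _ h)

/-- A diagram of the family, as an element of the algebra. -/
noncomputable def element {F : DiagramFamily} {k : ℕ} (n : ℂ) (d : Diagram k)
    (hd : d ∈ F.diagrams k) : F.algebra k n :=
  ⟨PartitionAlgebra.ofDiagram n d, Submodule.subset_span ⟨d, hd, rfl⟩⟩

/-- The ideal `J_{m-1}` of `A_k`, spanned over the complex numbers by the diagrams of rank less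
than `m`. It is regarded as an `A_k`-submodule of the partition algebra. -/
noncomputable def rankIdeal (m : ℕ) : Submodule (F.algebra k n) (PartitionAlgebra k n) where
  carrier := F.rankSpan k n m
  add_mem' := fun ha hb => (F.rankSpan k n m).add_mem ha hb
  zero_mem' := (F.rankSpan k n m).zero_mem
  smul_mem' := by
    rintro ⟨x, hx⟩ y hy
    change x ∈ Submodule.span ℂ _ at hx
    change y ∈ Submodule.span ℂ _ at hy
    change x * y ∈ Submodule.span ℂ _
    induction hx, hy using Submodule.span_induction₂ with
    | mem_mem a b ha hb =>
      obtain ⟨d₁, h₁, rfl⟩ := ha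
      obtain ⟨d₂, h₂, hr, rfl⟩ := hb
      rw [PartitionAlgebra.ofDiagram_mul]
      exact Submodule.smul_mem _ _ (Submodule.subset_span
        ⟨_, F.comp_mem h₁ h₂, (Diagram.rank_comp_le d₁ d₂).trans_lt hr, rfl⟩)
    | zero_left b _ => rw [zero_mul]; exact Submodule.zero_mem _
    | zero_right a _ => rw [mul_zero]; exact Submodule.zero_mem _
    | add_left a b c _ _ _ h h' => rw [add_mul]; exact Submodule.add_mem _ h h'
    | add_right a b c _ _ _ h h' => rw [mul_add]; exact Submodule.add_mem _ h h'
    | smul_left r a b _ _ h => rw [smul_mul_assoc]; exact Submodule.smul_mem _ _ h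
    | smul_right r a b _ _ h => rw [mul_smul_comm]; exact Submodule.smul_mem _ _ h

/-- The set of possible ranks of diagrams of the family. -/
def ranks : Set ℕ := {m | ∃ d ∈ F.diagrams k, d.rank = m}

/-- The set `Λ` that indexes the irreducible modules of `A_k`: all partitions whose size is a
possible rank and, for the planar algebras, only those with at most one row. -/
def labels : Set YoungDiagram :=
  {μ | μ.card ∈ F.ranks k ∧ (F.Planar → ∀ c ∈ μ.cells, c.1 = 0)}

/-- The set `Λ_n` of the partitions `λ` of `N` with `λ*` in `Λ`. -/
def shiftedLabels (N : ℕ) : Set YoungDiagram :=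
  {lam | lam.card = N ∧ lam.removeFirstRow ∈ F.labels k}

open Classical in
/-- The idempotent `e_m`. -/
noncomputable def tailIdempotent (m : ℕ) : PartitionAlgebra k n :=
  if F.Paired then (n ^ ((k - m) / 2))⁻¹ • PartitionAlgebra.ofDiagram n (Diagram.pairedTail k m)
  else (n ^ (k - m))⁻¹ • PartitionAlgebra.ofDiagram n (Diagram.isolatedTail k m)

open Classical in
/-- The Young symmetrizer `p_μ` as an element of the partition algebra, where `S_m` acts on the
first `m` strands. For the planar algebras the role of the group algebra of `S_m` is played by its
trivial subalgebra, and the minimal idempotent is the identity. -/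
noncomputable def labelSymmetrizer (μ : YoungDiagram) : PartitionAlgebra k n :=
  if F.Planar then 1
  else μ.youngSymmetrizer fun σ => PartitionAlgebra.ofDiagram n
    (Diagram.ofPerm k (σ.extendDomain Fin.equivSubtype))

/-- The element `e_λ = p_{λ*} e_m`, where `m = |λ*|`. -/
noncomputable def labelElement (lam : YoungDiagram) : PartitionAlgebra k n :=
  F.labelSymmetrizer k n lam.removeFirstRow * F.tailIdempotent k n lam.removeFirstRow.card

/-- The `A_k`-module indexed by `λ`: the image of the left ideal `A_k e_λ` in the quotient by
`J_{m-1}`, where `m = |λ*|`. -/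
noncomputable def irreducibleModule (lam : YoungDiagram) :
    Submodule (F.algebra k n)
      (PartitionAlgebra k n ⧸ F.rankIdeal k n lam.removeFirstRow.card) :=
  (Submodule.span (F.algebra k n) {F.labelElement k n lam}).map
    (F.rankIdeal k n lam.removeFirstRow.card).mkQ

open Classical in
/-- The set of the symmetric `m`-diagrams of the family that are fixed under conjugation by `d`. -/
noncomputable def fixedDiagrams {k : ℕ} (m : ℕ) (d : Diagram k) : Finset (Diagram k) :=
  Finset.univ.filter fun w =>
    w ∈ F.diagrams k ∧ w.IsSymmetricDiagram m ∧ Diagram.conj d w = w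

end DiagramFamily

/-!
Why the modules are irreducible and where their characters come from.

*Semisimplicity.* Send a diagram `d` to the indicator function of the labellings of its `2 k`
vertices by `n` labels that are constant on the blocks of `d`. As `n ≥ 2 k`, the vertices can be
labelled so that precisely the vertices of a common block agree, and therefore the linear extension
to `P_k(n)` is injective (`PartitionAlgebra.labelMap_injective`). The inner product of two such
functions is a power of `n`, and counting the components of a stack of diagrams in two ways
(`Diagram.loops_add_classCount`) shows that multiplication by `d` is adjoint to multiplication by
`dᵀ`. This is a positive definite form on `P_k(n)`, and each of the ten families is closed under
transposition, so orthogonal complements of `A_k`-submodules are submodules: `P_k(n)` and its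
subquotients are semisimple over `A_k` (`DiagramFamily.isSemisimpleModule`).

*Irreducibility.* Let `t` be the diagram underlying `e_m`. If `d` is a diagram of the family for
which `t ∘ d ∘ t` has rank `m`, then `t ∘ d ∘ t = t ∘ g` for a permutation `g` of the first `m`
strands, and `g = 1` in the planar families. Hence, modulo diagrams of smaller rank,
`e_λ A_k e_λ` is spanned by the elements `p g p t` with `p` the Young symmetrizer, and by the
classical lemma of von Neumann all of these are multiples of `e_λ`
(`DiagramFamily.exists_generator_mul_mul`). In a semisimple module, a vector with this property
generates a simple submodule (`isSimpleModule_span_singleton`).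

*Characters.* Modulo smaller rank, `A_k t` has as a basis the halves: the diagrams of rank `m`
whose bottom row looks like that of `t`. Multiplication by the idempotent multiple of `e_λ` is a
projection of the span of the halves onto `A_k^λ`, so the trace of `d` is a sum over the halves
(`DiagramFamily.moduleCharacter_halfModule`). Each half `x` has a symmetric diagram
`x ∘ xᵀ`, and the halves with a given symmetric diagram `w` form a torsor under the permutations
of the `m` strands that lie in the family. A half contributes to the trace only if
`d ∘ w ∘ dᵀ = w`, and then `d` moves the halves of `w` by the twist
(`DiagramFamily.comp_halfDiagram`). The sum over one torsor is a character value of `ℂ S_m`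
(`YoungDiagram.symmetricCharacter_eq_sum`), because the trace on `ℂ S_m p` is found in the same
way.
-/

/-! ### Concatenation and loops in terms of the middle row -/

namespace Diagram

section Middle

variable {k : ℕ}

/-- The set partition that a diagram induces on its top row. -/
def topRel (d : Diagram k) : Setoid (Fin k) := Setoid.comap Sum.inl d

/-- The set partition that a diagram induces on its bottom row. -/
def botRel (d : Diagram k) : Setoid (Fin k) := Setoid.comap Sum.inr d

/-- The top vertices that lie in propagating blocks. -/
def propTop (d : Diagram k) : Set (Fin k) := {i | ∃ j, d (Sum.inl i) (Sum.inr j)}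

/-- The bottom vertices that lie in propagating blocks. -/
def propBot (d : Diagram k) : Set (Fin k) := {j | ∃ i, d (Sum.inl i) (Sum.inr j)}

/-- The partition of the middle row into the traces of the components of the stack. -/
def mid (d₁ d₂ : Diagram k) : Setoid (Fin k) := botRel d₁ ⊔ topRel d₂

/-- A vertex of the stack of `d₁` and `d₂` is joined to a vertex of the middle row without
leaving the half of the stack that it belongs to. -/
def Attached (d₁ d₂ : Diagram k) : Fin k ⊕ Fin k ⊕ Fin k → Fin k → Prop
  | Sum.inl a, i => d₁ (Sum.inl a) (Sum.inr i)
  | Sum.inr (Sum.inl a), i => mid d₁ d₂ a i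
  | Sum.inr (Sum.inr b), i => d₂ (Sum.inl i) (Sum.inr b)

/-- Two vertices of the same outer row lie in one block of the corresponding diagram. -/
def SameOuter (d₁ d₂ : Diagram k) : Fin k ⊕ Fin k ⊕ Fin k → Fin k ⊕ Fin k ⊕ Fin k → Prop
  | Sum.inl a, Sum.inl b => d₁ (Sum.inl a) (Sum.inl b)
  | Sum.inr (Sum.inr a), Sum.inr (Sum.inr b) => d₂ (Sum.inr a) (Sum.inr b)
  | _, _ => False

theorem botRel_le_mid (d₁ d₂ : Diagram k) : botRel d₁ ≤ mid d₁ d₂ := le_sup_left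

theorem topRel_le_mid (d₁ d₂ : Diagram k) : topRel d₂ ≤ mid d₁ d₂ := le_sup_right

theorem Attached.mid_of {d₁ d₂ : Diagram k} {x : Fin k ⊕ Fin k ⊕ Fin k} {i j : Fin k}
    (hi : Attached d₁ d₂ x i) (hj : Attached d₁ d₂ x j) : mid d₁ d₂ i j := by
  rcases x with a | a | a
  · exact botRel_le_mid d₁ d₂ (Setoid.trans' d₁ (Setoid.symm' d₁ hi) hj)
  · exact (mid d₁ d₂).trans' ((mid d₁ d₂).symm' hi) hj
  · exact topRel_le_mid d₁ d₂ (Setoid.trans' d₂ hi (Setoid.symm' d₂ hj))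

theorem SameOuter.symm {d₁ d₂ : Diagram k} {x y : Fin k ⊕ Fin k ⊕ Fin k}
    (h : SameOuter d₁ d₂ x y) : SameOuter d₁ d₂ y x := by
  rcases x with a | a | a <;> rcases y with b | b | b <;> try exact h
  · exact Setoid.symm' d₁ h
  · exact Setoid.symm' d₂ h

theorem SameOuter.trans {d₁ d₂ : Diagram k} {x y z : Fin k ⊕ Fin k ⊕ Fin k}
    (h : SameOuter d₁ d₂ x y) (h' : SameOuter d₁ d₂ y z) : SameOuter d₁ d₂ x z := by
  rcases x with a | a | a <;> rcases y with b | b | b <;> try exact h.elim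
  · rcases z with c | c | c <;> try exact h'.elim
    exact Setoid.trans' d₁ h h'
  · rcases z with c | c | c <;> try exact h'.elim
    exact Setoid.trans' d₂ h h'

theorem SameOuter.attached {d₁ d₂ : Diagram k} {x y : Fin k ⊕ Fin k ⊕ Fin k} {i : Fin k}
    (h : SameOuter d₁ d₂ x y) (h' : Attached d₁ d₂ y i) : Attached d₁ d₂ x i := by
  rcases x with a | a | a <;> rcases y with b | b | b <;> try exact h.elim
  · exact Setoid.trans' d₁ h h'
  · exact Setoid.trans' d₂ h' (Setoid.symm' d₂ h)

/-- The explicit form of the components of a stack. -/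
def stackRel (d₁ d₂ : Diagram k) : Setoid (Fin k ⊕ Fin k ⊕ Fin k) where
  r x y := SameOuter d₁ d₂ x y ∨
    ∃ i j, Attached d₁ d₂ x i ∧ mid d₁ d₂ i j ∧ Attached d₁ d₂ y j
  iseqv :=
    { refl := by
        rintro (a | a | a)
        · exact Or.inl (Setoid.refl' d₁ _)
        · exact Or.inr ⟨a, a, Setoid.refl' _ _, Setoid.refl' _ _, Setoid.refl' _ _⟩
        · exact Or.inl (Setoid.refl' d₂ _)
      symm := by
        rintro x y (h | ⟨i, j, h1, h2, h3⟩)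
        · exact Or.inl h.symm
        · exact Or.inr ⟨j, i, h3, Setoid.symm' _ h2, h1⟩
      trans := by
        rintro x y z (h | ⟨i, j, h1, h2, h3⟩) (h' | ⟨i', j', h1', h2', h3'⟩)
        · exact Or.inl (h.trans h')
        · exact Or.inr ⟨i', j', h.attached h1', h2', h3'⟩
        · exact Or.inr ⟨i, j, h1, h2, h'.symm.attached h3⟩
        · exact Or.inr ⟨i, j', h1,
            Setoid.trans' _ h2 (Setoid.trans' _ (h3.mid_of h1') h2'), h3'⟩ }

theorem stack_upper {d₁ d₂ : Diagram k} {x y : Fin k ⊕ Fin k} (h : d₁ x y) :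
    stack d₁ d₂ (upper x) (upper y) :=
  (le_sup_left : Setoid.map d₁ upper ≤ stack d₁ d₂) (Setoid.le_comap_map h)

theorem stack_lower {d₁ d₂ : Diagram k} {x y : Fin k ⊕ Fin k} (h : d₂ x y) :
    stack d₁ d₂ (lower x) (lower y) :=
  (le_sup_right : Setoid.map d₂ lower ≤ stack d₁ d₂) (Setoid.le_comap_map h)

theorem stack_eq_stackRel (d₁ d₂ : Diagram k) : stack d₁ d₂ = stackRel d₁ d₂ := by
  apply le_antisymm
  · refine sup_le (setoid_map_le_iff.2 ?_) (setoid_map_le_iff.2 ?_)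
    · rintro (x | x) (y | y) h
      · exact Or.inl h
      · exact Or.inr ⟨y, y, h, Setoid.refl' _ _, Setoid.refl' _ _⟩
      · exact Or.inr ⟨x, x, Setoid.refl' _ _, Setoid.refl' _ _, Setoid.symm' d₁ h⟩
      · exact Or.inr ⟨x, y, Setoid.refl' _ _, botRel_le_mid d₁ d₂ h, Setoid.refl' _ _⟩
    · rintro (x | x) (y | y) h
      · exact Or.inr ⟨x, y, Setoid.refl' _ _, topRel_le_mid d₁ d₂ h, Setoid.refl' _ _⟩
      · exact Or.inr ⟨x, x, Setoid.refl' _ _, Setoid.refl' _ _, h⟩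
      · exact Or.inr ⟨y, y, Setoid.symm' d₂ h, Setoid.refl' _ _, Setoid.refl' _ _⟩
      · exact Or.inl h
  · have hmid : mid d₁ d₂ ≤ (stack d₁ d₂).comap fun i => Sum.inr (Sum.inl i) :=
      sup_le (fun i j h => stack_upper (x := Sum.inr i) (y := Sum.inr j) h)
        (fun i j h => stack_lower (x := Sum.inl i) (y := Sum.inl j) h)
    have hatt : ∀ x i, Attached d₁ d₂ x i → stack d₁ d₂ x (Sum.inr (Sum.inl i)) := by
      rintro (a | a | a) i h
      · exact stack_upper (x := Sum.inl a) (y := Sum.inr i) h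
      · exact hmid h
      · exact Setoid.symm' _ (stack_lower (x := Sum.inl i) (y := Sum.inr a) h)
    rintro x y (h | ⟨i, j, h1, h2, h3⟩)
    · rcases x with a | a | a <;> rcases y with b | b | b <;> try exact h.elim
      · exact stack_upper (x := Sum.inl a) (y := Sum.inl b) h
      · exact stack_lower (x := Sum.inr a) (y := Sum.inr b) h
    · exact Setoid.trans' _ (hatt x i h1)
        (Setoid.trans' _ (hmid h2) (Setoid.symm' _ (hatt y j h3)))

theorem stack_apply {d₁ d₂ : Diagram k} {x y : Fin k ⊕ Fin k ⊕ Fin k} :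
    stack d₁ d₂ x y ↔ SameOuter d₁ d₂ x y ∨
      ∃ i j, Attached d₁ d₂ x i ∧ mid d₁ d₂ i j ∧ Attached d₁ d₂ y j := by
  rw [stack_eq_stackRel]
  rfl

theorem stack_mid_mid {d₁ d₂ : Diagram k} {i j : Fin k} :
    stack d₁ d₂ (Sum.inr (Sum.inl i)) (Sum.inr (Sum.inl j)) ↔ mid d₁ d₂ i j := by
  rw [stack_apply]
  constructor
  · rintro (h | ⟨i', j', h1, h2, h3⟩)
    · exact h.elim
    · exact Setoid.trans' _ h1 (Setoid.trans' _ h2 (Setoid.symm' _ h3))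
  · intro h
    exact Or.inr ⟨i, j, Setoid.refl' _ _, h, Setoid.refl' _ _⟩

theorem stack_inl_mid {d₁ d₂ : Diagram k} {a i : Fin k} :
    stack d₁ d₂ (Sum.inl a) (Sum.inr (Sum.inl i)) ↔
      ∃ j, d₁ (Sum.inl a) (Sum.inr j) ∧ mid d₁ d₂ j i := by
  rw [stack_apply]
  constructor
  · rintro (h | ⟨i', j', h1, h2, h3⟩)
    · exact h.elim
    · exact ⟨i', h1, Setoid.trans' _ h2 (Setoid.symm' _ h3)⟩
  · rintro ⟨j, h1, h2⟩
    exact Or.inr ⟨j, i, h1, h2, Setoid.refl' _ _⟩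

theorem comp_inl_inl {d₁ d₂ : Diagram k} {a b : Fin k} :
    comp d₁ d₂ (Sum.inl a) (Sum.inl b) ↔ d₁ (Sum.inl a) (Sum.inl b) ∨
      ∃ i j, d₁ (Sum.inl a) (Sum.inr i) ∧ mid d₁ d₂ i j ∧ d₁ (Sum.inl b) (Sum.inr j) :=
  stack_apply (x := Sum.inl a) (y := Sum.inl b)

theorem comp_inl_inr {d₁ d₂ : Diagram k} {a b : Fin k} :
    comp d₁ d₂ (Sum.inl a) (Sum.inr b) ↔
      ∃ i j, d₁ (Sum.inl a) (Sum.inr i) ∧ mid d₁ d₂ i j ∧ d₂ (Sum.inl j) (Sum.inr b) :=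
  (stack_apply (x := Sum.inl a) (y := Sum.inr (Sum.inr b))).trans (iff_of_eq (false_or _))

theorem comp_inr_inr {d₁ d₂ : Diagram k} {a b : Fin k} :
    comp d₁ d₂ (Sum.inr a) (Sum.inr b) ↔ d₂ (Sum.inr a) (Sum.inr b) ∨
      ∃ i j, d₂ (Sum.inl i) (Sum.inr a) ∧ mid d₁ d₂ i j ∧ d₂ (Sum.inl j) (Sum.inr b) :=
  stack_apply (x := Sum.inr (Sum.inr a)) (y := Sum.inr (Sum.inr b))

theorem ext_rel {d d' : Diagram k} (h₁ : topRel d = topRel d') (h₂ : botRel d = botRel d')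
    (h₃ : ∀ a b, d (Sum.inl a) (Sum.inr b) ↔ d' (Sum.inl a) (Sum.inr b)) : d = d' := by
  refine Setoid.ext ?_
  rintro (a | a) (b | b)
  · exact iff_of_eq (congrArg (fun s : Setoid (Fin k) => s a b) h₁)
  · exact h₃ a b
  · exact (Setoid.comm' d).trans ((h₃ b a).trans (Setoid.comm' d'))
  · exact iff_of_eq (congrArg (fun s : Setoid (Fin k) => s a b) h₂)

theorem loops_eq_classCount (d₁ d₂ : Diagram k) :
    loops d₁ d₂ = classCount (mid d₁ d₂) {i | i ∉ propBot d₁ ∧ i ∉ propTop d₂} := by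
  have hinj : Function.Injective fun i : Fin k => (Sum.inr (Sum.inl i) : Fin k ⊕ Fin k ⊕ Fin k) :=
    fun i j h => by simpa using h
  unfold loops classCount
  rw [← Set.ncard_image_of_injective _ hinj.image_injective]
  congr 1
  ext C
  simp only [Set.mem_image, Set.mem_ofPred_eq]
  constructor
  · rintro ⟨⟨x, rfl⟩, hC⟩
    obtain ⟨i, rfl⟩ := hC (Setoid.refl' (stack d₁ d₂) x)
    refine ⟨{j | mid d₁ d₂ j i}, ⟨⟨i, rfl⟩, ?_⟩, ?_⟩
    · intro j hj
      have hj' := stack_mid_mid.2 hj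
      constructor
      · rintro ⟨a, ha⟩
        obtain ⟨l, hl⟩ := hC (show Sum.inl a ∈ _ from
          (stack_inl_mid.2 ⟨j, ha, hj⟩ : stack d₁ d₂ (Sum.inl a) (Sum.inr (Sum.inl i))))
        simp at hl
      · rintro ⟨a, ha⟩
        obtain ⟨l, hl⟩ := hC (show Sum.inr (Sum.inr a) ∈ _ from
          (Setoid.trans' _ (Setoid.symm' _ (stack_lower (x := Sum.inl j) (y := Sum.inr a) ha)) hj' :
            stack d₁ d₂ (Sum.inr (Sum.inr a)) (Sum.inr (Sum.inl i))))
        simp at hl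
    · ext y
      constructor
      · rintro ⟨j, hj, rfl⟩
        exact stack_mid_mid.2 hj
      · intro hy
        obtain ⟨j, rfl⟩ := hC hy
        exact ⟨j, stack_mid_mid.1 hy, rfl⟩
  · rintro ⟨D, ⟨⟨i, rfl⟩, hD⟩, rfl⟩
    refine ⟨⟨Sum.inr (Sum.inl i), ?_⟩, ?_⟩
    · ext y
      constructor
      · rintro ⟨j, hj, rfl⟩
        exact stack_mid_mid.2 hj
      · intro hy
        rcases y with a | a | a
        · obtain ⟨j, h1, h2⟩ := stack_inl_mid.1 hy
          exact absurd ⟨a, h1⟩ (hD h2).1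
        · exact ⟨a, stack_mid_mid.1 hy, rfl⟩
        · rcases stack_apply.1 hy with h | ⟨i', j', h1, h2, h3⟩
          · exact h.elim
          · exact absurd ⟨a, h1⟩ (hD (Setoid.trans' _ h2 (Setoid.symm' _ h3))).2
    · rintro _ ⟨j, _, rfl⟩
      exact ⟨j, rfl⟩

/-- The number of loops depends on the lower diagram only through its top half. -/
theorem loops_congr_right (d : Diagram k) {x y : Diagram k} (h : topRel x = topRel y)
    (h' : propTop x = propTop y) : loops d x = loops d y := by
  rw [loops_eq_classCount, loops_eq_classCount, mid, mid, h, h']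

theorem loops_eq_zero_of_propTop (d : Diagram k) {x : Diagram k} (h : propTop x = Set.univ) :
    loops d x = 0 := by
  rw [loops_eq_classCount, classCount, Set.ncard_eq_zero (Set.toFinite _),
    Set.eq_empty_iff_forall_notMem]
  rintro C ⟨⟨i, rfl⟩, hC⟩
  exact (hC (Setoid.refl' (mid d x) i)).2 (h ▸ Set.mem_univ i)

/-! ### Reflection and rank -/

theorem transpose_transpose (d : Diagram k) : transpose (transpose d) = d := by
  refine ext_rel rfl rfl fun a b => Iff.rfl

theorem topRel_transpose (d : Diagram k) : topRel (transpose d) = botRel d := rfl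

theorem transpose_inl_inr {d : Diagram k} {a b : Fin k} :
    transpose d (Sum.inl a) (Sum.inr b) ↔ d (Sum.inl b) (Sum.inr a) :=
  Setoid.comm' d

theorem propTop_transpose (d : Diagram k) : propTop (transpose d) = propBot d :=
  Set.ext fun _ => exists_congr fun _ => transpose_inl_inr

theorem propBot_transpose (d : Diagram k) : propBot (transpose d) = propTop d :=
  Set.ext fun _ => exists_congr fun _ => transpose_inl_inr

theorem mid_transpose (d₁ d₂ : Diagram k) :
    mid (transpose d₂) (transpose d₁) = mid d₁ d₂ := sup_comm _ _

theorem transpose_comp (d₁ d₂ : Diagram k) :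
    transpose (comp d₁ d₂) = comp (transpose d₂) (transpose d₁) := by
  refine ext_rel ?_ ?_ ?_
  · ext a b
    change comp d₁ d₂ (Sum.inr a) (Sum.inr b) ↔ comp _ _ (Sum.inl a) (Sum.inl b)
    rw [comp_inl_inl, comp_inr_inr, mid_transpose]
    simp only [transpose_inl_inr]
    rfl
  · ext a b
    change comp d₁ d₂ (Sum.inl a) (Sum.inl b) ↔ comp _ _ (Sum.inr a) (Sum.inr b)
    rw [comp_inl_inl, comp_inr_inr, mid_transpose]
    simp only [transpose_inl_inr]
    rfl
  · intro a b
    rw [transpose_inl_inr, comp_inl_inr, comp_inl_inr, mid_transpose]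
    simp only [transpose_inl_inr]
    constructor
    · rintro ⟨i, j, h1, h2, h3⟩
      exact ⟨j, i, h3, Setoid.symm' _ h2, h1⟩
    · rintro ⟨i, j, h1, h2, h3⟩
      exact ⟨j, i, h3, Setoid.symm' _ h2, h1⟩

theorem rank_le_rank_transpose (d : Diagram k) : rank d ≤ rank (transpose d) := by
  classical
  have hex : ∀ B : propBlocks d, ∃ i j, d (Sum.inl i) (Sum.inr j) ∧
      ∀ i', i' ∈ B.1 ↔ d (Sum.inl i) (Sum.inl i') := by
    rintro ⟨B, hB⟩
    obtain ⟨i, ⟨j, hij⟩, hB⟩ := mem_propBlocks.1 hB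
    exact ⟨i, j, hij, hB⟩
  choose i j hij hB using hex
  unfold rank
  rw [← Finset.card_attach]
  refine Finset.card_le_card_of_injOn
    (fun B => Finset.univ.filter fun j' => d (Sum.inr (j B)) (Sum.inr j')) ?_ ?_
  · intro B _
    exact mem_propBlocks.2 ⟨j B, ⟨i B, transpose_inl_inr.2 (hij B)⟩, fun i' => by simp; rfl⟩
  · intro B _ B' _ h
    have hjj : d (Sum.inr (j B)) (Sum.inr (j B')) := by
      have : j B' ∈ Finset.univ.filter fun j' => d (Sum.inr (j B)) (Sum.inr j') := by
        rw [show (Finset.univ.filter fun j' => d (Sum.inr (j B)) (Sum.inr j')) = _ from h]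
        simp
      simpa using this
    have hii : d (Sum.inl (i B)) (Sum.inl (i B')) :=
      Setoid.trans' d (hij B) (Setoid.trans' d hjj (Setoid.symm' d (hij B')))
    refine Subtype.ext (Finset.ext fun x => ?_)
    rw [hB, hB]
    exact ⟨fun hx => Setoid.trans' d (Setoid.symm' d hii) hx, fun hx => Setoid.trans' d hii hx⟩

theorem rank_transpose (d : Diagram k) : rank (transpose d) = rank d :=
  le_antisymm ((rank_le_rank_transpose _).trans_eq (by rw [transpose_transpose]))
    (rank_le_rank_transpose d)

theorem rank_comp_le_left (d₁ d₂ : Diagram k) : rank (comp d₁ d₂) ≤ rank d₁ := by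
  rw [← rank_transpose, transpose_comp, ← rank_transpose d₁]
  exact rank_comp_le _ _

end Middle

end Diagram

/-! ### Reflection preserves the families -/

namespace Diagram

section TransposeClosure

variable {k : ℕ} {d : Diagram k}

theorem ncard_transpose_class (d : Diagram k) (x : Fin k ⊕ Fin k) :
    {y | transpose d x y}.ncard = {y | d x.swap y}.ncard := by
  rw [← Set.ncard_image_of_injective {y | transpose d x y} Sum.swap_leftInverse.injective]
  congr 1
  ext y
  constructor
  · rintro ⟨z, hz, rfl⟩
    exact hz
  · intro hy
    refine ⟨y.swap, ?_, Sum.swap_swap y⟩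
    change d x.swap y.swap.swap
    rwa [Sum.swap_swap]

theorem IsPermutation.transpose (h : d.IsPermutation) : IsPermutation (transpose d) :=
  fun x => ⟨(h x.swap).2, (h x.swap).1⟩

theorem IsRook.transpose (h : d.IsRook) : IsRook (transpose d) :=
  fun x => ⟨(h x.swap).2, (h x.swap).1⟩

theorem IsBrauer.transpose (h : d.IsBrauer) : IsBrauer (transpose d) :=
  fun x => (ncard_transpose_class d x).trans (h x.swap)

theorem IsRookBrauer.transpose (h : d.IsRookBrauer) : IsRookBrauer (transpose d) := by
  intro x
  rw [ncard_transpose_class]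
  exact h x.swap

theorem position_swap (x : Fin k ⊕ Fin k) : position x.swap = 2 * k - 1 - position x := by
  rcases x with x | x <;> simp [position]; omega

theorem IsPlanar.transpose (h : d.IsPlanar) : IsPlanar (transpose d) := by
  intro x y z t hxy hyz hzt hxz hyt
  have hlt : ∀ {a b : Fin k ⊕ Fin k}, position a < position b →
      position b.swap < position a.swap := by
    intro a b hab
    have := position_lt b
    rw [position_swap, position_swap]
    omega
  have h1 := h _ _ _ _ (hlt hzt) (hlt hyz) (hlt hxy) (Setoid.symm' d hyt) (Setoid.symm' d hxz)
  exact Setoid.trans' d hxz (Setoid.trans' d (Setoid.symm' d h1) (Setoid.symm' d hyt))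

end TransposeClosure

end Diagram

theorem DiagramFamily.transpose_mem (F : DiagramFamily) {k : ℕ} {d : Diagram k}
    (h : d ∈ F.diagrams k) : Diagram.transpose d ∈ F.diagrams k := by
  cases F
  exacts [trivial, Diagram.IsPermutation.transpose h, Diagram.IsRook.transpose h,
    Diagram.IsBrauer.transpose h, Diagram.IsRookBrauer.transpose h, Diagram.IsPlanar.transpose h,
    ⟨Diagram.IsPermutation.transpose h.1, Diagram.IsPlanar.transpose h.2⟩,
    ⟨Diagram.IsBrauer.transpose h.1, Diagram.IsPlanar.transpose h.2⟩,
    ⟨Diagram.IsRook.transpose h.1, Diagram.IsPlanar.transpose h.2⟩,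
    ⟨Diagram.IsRookBrauer.transpose h.1, Diagram.IsPlanar.transpose h.2⟩]

/-! ### A positive definite invariant form and semisimplicity -/

theorem setoid_map_comap_of_injective {U V : Type*} (s : Setoid U) {h : U → V}
    (hh : Function.Injective h) : (s.map h).comap h = s :=
  Setoid.ext fun _ _ => setoid_map_apply_apply hh

theorem setoid_map_id {U : Type*} (s : Setoid U) : s.map id = s :=
  setoid_map_comap_of_injective s Function.injective_id

theorem classCount_univ {V : Type*} (S : Setoid V) : classCount S Set.univ = Nat.card (Quotient S) := by
  rw [Nat.card_congr S.quotientEquivClasses, classCount, ← Nat.card_coe_set_eq]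
  simp

namespace Diagram

/-- Exchange of the first two of three rows. -/
def swapRows {k : ℕ} : Fin k ⊕ Fin k ⊕ Fin k → Fin k ⊕ Fin k ⊕ Fin k :=
  Sum.elim (fun i => Sum.inr (Sum.inl i)) (Sum.elim Sum.inl fun i => Sum.inr (Sum.inr i))

theorem swapRows_injective {k : ℕ} : Function.Injective (swapRows (k := k)) := by
  rintro (a | a | a) (b | b | b) h <;> simp_all [swapRows]

/-- Both sides count the components of the closed graph that has `x`, `a` and `b` drawn between
the rows one and two, two and three, one and three. -/
theorem loops_add_classCount {k : ℕ} (x a b : Diagram k) :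
    loops x a + classCount (comp x a ⊔ b : Setoid _) Set.univ
      = loops (transpose x) b + classCount (a ⊔ comp (transpose x) b : Setoid _) Set.univ := by
  have h1 := classCount_sup_map (stack x a) b Function.injective_id (g := outer) Set.univ
    (middle k)
    (by ext y; rcases y with y | y | y <;> simp [outer, middle]) (Set.subset_univ _)
  have h2 := classCount_sup_map (stack (transpose x) b) a swapRows_injective (g := lower) Set.univ
    (middle k)
    (by ext y; rcases y with y | y | y <;> simp [lower, middle, swapRows]) (Set.subset_univ _)
  rw [setoid_comap_sup_map, setoid_map_id] at h1
  have e1 : (swapRows ∘ outer : Fin k ⊕ Fin k → _) = lower := by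
    funext y; rcases y with y | y <;> rfl
  have e2 : (swapRows ∘ lower : Fin k ⊕ Fin k → _) = outer := by
    funext y; rcases y with y | y <;> rfl
  have e3 : (swapRows ∘ upper : Fin k ⊕ Fin k → _) = upper ∘ Sum.swap := by
    funext y; rcases y with y | y <;> rfl
  have e4 : Setoid.map (transpose x) Sum.swap = x := by
    refine Setoid.ext fun u v => ?_
    rw [← Sum.swap_swap u, ← Sum.swap_swap v]
    exact setoid_map_apply_apply Sum.swap_leftInverse.injective
  have e5 : ((stack (transpose x) b).map swapRows).comap lower = comp (transpose x) b := by
    rw [← e1]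
    exact congrArg (Setoid.comap outer)
      (setoid_map_comap_of_injective (stack (transpose x) b) swapRows_injective)
  rw [setoid_comap_sup_map, e5, stack, setoid_map_sup, setoid_map_map, setoid_map_map, e2, e3,
    ← setoid_map_map, e4] at h2
  rw [Set.preimage_univ] at h1 h2
  change classCount (stack x a ⊔ b.map outer) Set.univ
    = loops x a + classCount (comp x a ⊔ b : Setoid _) Set.univ at h1
  change _ = loops (transpose x) b
    + classCount (comp (transpose x) b ⊔ a : Setoid _) Set.univ at h2
  rw [sup_comm a, ← h1, ← h2, stack]
  congr 1
  ac_rfl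

end Diagram

namespace PartitionAlgebra

section Form

variable {k : ℕ}

open Classical in
/-- The indicator function of the labellings of the vertices by `N` labels that are constant on
the blocks of a diagram; it lists the matrix entries of the action of `d` on a tensor power of an
`N`-dimensional space. -/
noncomputable def labelVector (N : ℕ) (d : Diagram k) :
    EuclideanSpace ℂ (Fin k ⊕ Fin k → Fin N) :=
  WithLp.toLp 2 fun f => if d ≤ Setoid.ker f then 1 else 0

/-- The linear extension of `labelVector` to the partition algebra. -/
noncomputable def labelMap (k N : ℕ) (n : ℂ) :
    PartitionAlgebra k n →ₗ[ℂ] EuclideanSpace ℂ (Fin k ⊕ Fin k → Fin N) :=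
  (basis k n).constr ℂ (labelVector N)

theorem labelMap_ofDiagram (N : ℕ) (n : ℂ) (d : Diagram k) :
    labelMap k N n (ofDiagram n d) = labelVector N d := by
  rw [labelMap, ← basis_apply, Module.Basis.constr_basis]

theorem inner_labelVector (N : ℕ) (d d' : Diagram k) :
    inner ℂ (labelVector N d) (labelVector N d')
      = (N : ℂ) ^ classCount (d ⊔ d' : Setoid _) Set.univ := by
  classical
  have h : ∀ f : Fin k ⊕ Fin k → Fin N,
      inner ℂ (labelVector N d f) (labelVector N d' f)
        = if (d ⊔ d' : Setoid _) ≤ Setoid.ker f then (1 : ℂ) else 0 := by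
    intro f
    by_cases h1 : d ≤ Setoid.ker f <;> by_cases h2 : d' ≤ Setoid.ker f <;>
      simp [labelVector, sup_le_iff, h1, h2]
  rw [PiLp.inner_apply, Finset.sum_congr rfl fun f _ => h f, Finset.sum_boole,
    classCount_univ]
  have e : Fintype.card {f : Fin k ⊕ Fin k → Fin N // (d ⊔ d' : Setoid _) ≤ Setoid.ker f}
      = N ^ Nat.card (Quotient (d ⊔ d' : Setoid _)) := by
    rw [← Nat.card_eq_fintype_card, Nat.card_congr (Setoid.liftEquiv _), Nat.card_fun,
      Nat.card_eq_fintype_card, Fintype.card_fin]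
  rw [← Fintype.card_subtype, e, Nat.cast_pow]

theorem induction_on {n : ℂ} {p : PartitionAlgebra k n → Prop} (a : PartitionAlgebra k n)
    (h0 : p 0) (hadd : ∀ a b, p a → p b → p (a + b)) (hsmul : ∀ (c : ℂ) a, p a → p (c • a))
    (hd : ∀ d, p (ofDiagram n d)) : p a := by
  have ha : a ∈ Submodule.span ℂ (Set.range (basis k n)) := by
    rw [(basis k n).span_eq]
    trivial
  induction ha using Submodule.span_induction with
  | mem x hx =>
    obtain ⟨d, rfl⟩ := hx
    exact hd d
  | zero => exact h0
  | add a b _ _ ha hb => exact hadd a b ha hb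
  | smul c a _ ha => exact hsmul c a ha

/-- Multiplication by a reflected diagram is adjoint to multiplication by the diagram. -/
theorem inner_labelMap_mul (N : ℕ) (x : Diagram k) (a b : PartitionAlgebra k (N : ℂ)) :
    inner ℂ (labelMap k N N (ofDiagram _ x * a)) (labelMap k N N b)
      = inner ℂ (labelMap k N N a) (labelMap k N N (ofDiagram _ (Diagram.transpose x) * b)) := by
  induction a using induction_on with
  | h0 => simp
  | hadd a a' h h' => simp only [mul_add, map_add, inner_add_left, h, h']
  | hsmul c a h => simp only [mul_smul_comm, map_smul, inner_smul_left, h]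
  | hd a =>
    induction b using induction_on with
    | h0 => simp
    | hadd a a' h h' => simp only [mul_add, map_add, inner_add_right, h, h']
    | hsmul c a h => simp only [mul_smul_comm, map_smul, inner_smul_right, h]
    | hd b =>
      simp only [ofDiagram_mul, map_smul, inner_smul_left, inner_smul_right, labelMap_ofDiagram,
        inner_labelVector, map_pow, Complex.conj_natCast, ← pow_add]
      rw [Diagram.loops_add_classCount]

theorem exists_ker_eq {V : Type*} [Fintype V] {N : ℕ} (h : Fintype.card V ≤ N) (s : Setoid V) :
    ∃ f : V → Fin N, Setoid.ker f = s := by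
  classical
  obtain ⟨e⟩ : Nonempty (Quotient s ↪ Fin N) := by
    rw [Function.Embedding.nonempty_iff_card_le, Fintype.card_fin]
    exact (Fintype.card_quotient_le s).trans h
  refine ⟨fun v => e (Quotient.mk s v), Setoid.ext fun a b => ?_⟩
  change e _ = e _ ↔ _
  rw [e.injective.eq_iff]
  exact Quotient.eq

/-- There are enough labels to realise every diagram as the kernel of a labelling. -/
theorem labelMap_injective {N : ℕ} (h : 2 * k ≤ N) (n : ℂ) :
    Function.Injective (labelMap k N n) := by
  classical
  rw [injective_iff_map_eq_zero]
  intro a ha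
  have key : ∀ d : Diagram k, (basis k n).repr a d = 0 := by
    intro d
    induction d using (inferInstance : WellFoundedLT (Diagram k)).induction with
    | ind d ih =>
      obtain ⟨f, hf⟩ := exists_ker_eq (N := N) (by simp; omega) d
      have hf0 : labelMap k N n a f = 0 := by rw [ha]; rfl
      rw [labelMap, Module.Basis.constr_apply_fintype] at hf0
      simp only [WithLp.ofLp_sum, Finset.sum_apply, WithLp.ofLp_smul, Pi.smul_apply] at hf0
      rw [Finset.sum_eq_single d] at hf0
      · simpa [labelVector, hf, Module.Basis.equivFun_apply] using hf0
      · intro d' _ hd'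
        by_cases hle : d' ≤ d
        · rw [Module.Basis.equivFun_apply, ih d' (lt_of_le_of_ne hle hd'), zero_smul]
        · simp [labelVector, hf, hle]
      · simp
  exact (basis k n).repr.map_eq_zero_iff.1 (Finsupp.ext key)

end Form

end PartitionAlgebra

namespace DiagramFamily

/-- The partition algebra is a semisimple module over each diagram algebra: orthogonal complements
with respect to the invariant form are submodules. -/
theorem isSemisimpleModule (F : DiagramFamily) {k N : ℕ} (h : 2 * k ≤ N) :
    IsSemisimpleModule (F.algebra k (N : ℂ)) (PartitionAlgebra k (N : ℂ)) := by
  let ρ := PartitionAlgebra.labelMap k N (N : ℂ)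
  have hρ : Function.Injective ρ := PartitionAlgebra.labelMap_injective h _
  refine (isSemisimpleModule_iff _ _).2 ⟨fun W => ?_⟩
  let W' : Submodule (F.algebra k (N : ℂ)) (PartitionAlgebra k (N : ℂ)) :=
    { carrier := {v | ∀ u ∈ W, inner ℂ (ρ u) (ρ v) = 0}
      add_mem' := fun {a b} ha hb u hu => by
        rw [map_add, inner_add_right, ha u hu, hb u hu, add_zero]
      zero_mem' := fun u _ => by rw [map_zero, inner_zero_right]
      smul_mem' := by
        rintro ⟨x, hx⟩ v hv u hu
        change x ∈ Submodule.span ℂ _ at hx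
        change inner ℂ (ρ u) (ρ (x * v)) = 0
        induction hx using Submodule.span_induction with
        | mem x hx =>
          obtain ⟨d, hd, rfl⟩ := hx
          have := PartitionAlgebra.inner_labelMap_mul N (Diagram.transpose d) u v
          rw [Diagram.transpose_transpose] at this
          rw [← this]
          exact hv _ (W.smul_mem (element _ _ (F.transpose_mem hd)) hu)
        | zero => rw [zero_mul, map_zero, inner_zero_right]
        | add x y _ _ h h' => rw [add_mul, map_add, inner_add_right, h, h', add_zero]
        | smul c x _ h => rw [smul_mul_assoc, map_smul, inner_smul_right, h, mul_zero] }
  refine ⟨W', disjoint_iff_inf_le.2 ?_, codisjoint_iff_le_sup.2 ?_⟩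
  · rintro v ⟨hv, hv'⟩
    exact hρ ((inner_self_eq_zero.1 (hv' v hv)).trans (map_zero ρ).symm)
  · intro v _
    obtain ⟨y, hy, z, hz, hyz⟩ :=
      ((W.restrictScalars ℂ).map ρ).exists_add_mem_mem_orthogonal (ρ v)
    obtain ⟨u, hu, rfl⟩ := hy
    refine Submodule.mem_sup.2 ⟨u, hu, v - u, ?_, add_sub_cancel u v⟩
    intro u' hu'
    have : ρ (v - u) = z := by rw [map_sub, hyz, add_sub_cancel_left]
    rw [this]
    exact hz _ ⟨u', hu', rfl⟩

end DiagramFamily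

/-! ### Traces on retracts of coordinate spaces -/

/-- The trace of an endomorphism of a space `M` that is a retract of a coordinate space: the
vectors `v x` together with the coordinates `ι · x` need only reproduce the elements of `M`. -/
theorem trace_eq_sum_of_reproducing {M X : Type*} [AddCommGroup M] [Module ℂ M] [Fintype X]
    (f : M →ₗ[ℂ] M) (ι : M →ₗ[ℂ] X → ℂ) (v : X → M) (h : ∀ u, ∑ x, ι u x • v x = u) :
    LinearMap.trace ℂ M f = ∑ x, ι (f (v x)) x := by
  classical
  let π : (X → ℂ) →ₗ[ℂ] M := Fintype.linearCombination ℂ v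
  have hπ : π ∘ₗ ι = LinearMap.id := LinearMap.ext fun u => by
    simp [π, Fintype.linearCombination_apply, h]
  have hfin : Module.Finite ℂ M := Module.Finite.of_surjective π fun u =>
    ⟨ι u, by rw [← LinearMap.comp_apply, hπ, LinearMap.id_apply]⟩
  have h1 : f = (f ∘ₗ π) ∘ₗ ι := by rw [LinearMap.comp_assoc, hπ, LinearMap.comp_id]
  rw [h1, LinearMap.trace_comp_comm', LinearMap.trace_eq_matrix_trace ℂ (Pi.basisFun ℂ X),
    Matrix.trace]
  refine Finset.sum_congr rfl fun x _ => ?_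
  rw [← h1]
  simp [π, Fintype.linearCombination_apply, Pi.single_apply]

theorem MonoidAlgebra.sum_coeff_smul_single {G : Type*} [Fintype G] (x : MonoidAlgebra ℂ G) :
    ∑ g, x.coeff g • MonoidAlgebra.single g (1 : ℂ) = x := by
  classical
  ext g
  simp [MonoidAlgebra.coeff_sum]

theorem apply_swap_of_eq {α β : Type*} [DecidableEq α] (f : α → β) {a b : α} (h : f a = f b)
    (c : α) : f (Equiv.swap a b c) = f c := by
  rw [Equiv.swap_apply_def]
  split_ifs with h1 h2
  · rw [h1, h]
  · rw [h2, h]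
  · rfl

/-! ### Young symmetrizers -/

namespace YoungDiagram

section Symmetrizer

variable (μ : YoungDiagram)

theorem columnReading_injective : Function.Injective μ.columnReading := fun _ _ h =>
  (Finset.orderEmbOfFin _ μ.card_columnOrder).injective
    (ofLex.injective (Prod.swap_injective h))

theorem columnReading_mem (a : Fin μ.card) : μ.columnReading a ∈ μ := by
  have h := Finset.orderEmbOfFin_mem _ μ.card_columnOrder a
  rw [Finset.mem_map] at h
  obtain ⟨c, hc, hca⟩ := h
  rw [columnReading, ← hca]
  exact hc

theorem exists_columnReading_eq {c : ℕ × ℕ} (hc : c ∈ μ) : ∃ a, μ.columnReading a = c := by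
  have h : toLex c.swap ∈ Set.range (Finset.orderEmbOfFin _ μ.card_columnOrder) := by
    rw [Finset.range_orderEmbOfFin]
    exact Finset.mem_coe.2 (Finset.mem_map.2 ⟨c, hc, rfl⟩)
  obtain ⟨a, ha⟩ := h
  refine ⟨a, ?_⟩
  rw [columnReading, ha]
  rfl

variable {μ}

theorem mem_rowGroup {ρ : Equiv.Perm (Fin μ.card)} :
    ρ ∈ μ.rowGroup ↔ ∀ a, (μ.columnReading (ρ a)).1 = (μ.columnReading a).1 := by
  simp [rowGroup]

theorem mem_columnGroup {γ : Equiv.Perm (Fin μ.card)} :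
    γ ∈ μ.columnGroup ↔ ∀ a, (μ.columnReading (γ a)).2 = (μ.columnReading a).2 := by
  simp [columnGroup]

theorem rowGroup_mul {ρ ρ' : Equiv.Perm (Fin μ.card)} (h : ρ ∈ μ.rowGroup)
    (h' : ρ' ∈ μ.rowGroup) : ρ * ρ' ∈ μ.rowGroup := by
  rw [mem_rowGroup] at *
  intro a
  rw [Equiv.Perm.mul_apply, h, h']

theorem rowGroup_inv {ρ : Equiv.Perm (Fin μ.card)} (h : ρ ∈ μ.rowGroup) : ρ⁻¹ ∈ μ.rowGroup := by
  rw [mem_rowGroup] at *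
  intro a
  rw [← h]
  simp

theorem columnGroup_mul {ρ ρ' : Equiv.Perm (Fin μ.card)} (h : ρ ∈ μ.columnGroup)
    (h' : ρ' ∈ μ.columnGroup) : ρ * ρ' ∈ μ.columnGroup := by
  rw [mem_columnGroup] at *
  intro a
  rw [Equiv.Perm.mul_apply, h, h']

theorem columnGroup_inv {ρ : Equiv.Perm (Fin μ.card)} (h : ρ ∈ μ.columnGroup) :
    ρ⁻¹ ∈ μ.columnGroup := by
  rw [mem_columnGroup] at *
  intro a
  rw [← h]
  simp

theorem one_mem_rowGroup : (1 : Equiv.Perm (Fin μ.card)) ∈ μ.rowGroup :=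
  mem_rowGroup.2 fun _ => rfl

theorem one_mem_columnGroup : (1 : Equiv.Perm (Fin μ.card)) ∈ μ.columnGroup :=
  mem_columnGroup.2 fun _ => rfl

theorem eq_one_of_mem_both {σ : Equiv.Perm (Fin μ.card)} (h : σ ∈ μ.rowGroup)
    (h' : σ ∈ μ.columnGroup) : σ = 1 :=
  Equiv.ext fun a => μ.columnReading_injective
    (Prod.ext (mem_rowGroup.1 h a) (mem_columnGroup.1 h' a))

/-- If `σ` moves no two entries of one row into one column, then the row of `a` meets the column
of `σ a` inside the diagram. For `c` the length of that column, one counts the entries in the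
first `c` rows by the columns of their images and compares with the count for `σ = 1`. -/
theorem row_column_mem {σ : Equiv.Perm (Fin μ.card)}
    (h : ∀ a b, (μ.columnReading a).1 = (μ.columnReading b).1 →
      (μ.columnReading (σ a)).2 = (μ.columnReading (σ b)).2 → a = b) (a : Fin μ.card) :
    ((μ.columnReading a).1, (μ.columnReading (σ a)).2) ∈ μ := by
  classical
  set T := μ.columnReading with hT
  set c := μ.colLen (T (σ a)).2 with hc
  have hrow : ∀ b, (T b).1 < μ.colLen (T b).2 := fun b =>
    mem_iff_lt_colLen.1 (μ.columnReading_mem b)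
  let D : ℕ → Finset (Fin μ.card) := fun j => Finset.univ.filter fun b => (T b).2 = j
  let S : ℕ → Finset (Fin μ.card) := fun j => Finset.univ.filter fun b => (T (σ b)).2 = j
  have hcard : ∀ j, (S j).card = (D j).card := fun j =>
    Finset.card_equiv σ fun b => by simp [S, D]
  have hle : ∀ j, ((S j).filter fun b => (T b).1 < c).card
      ≤ ((D j).filter fun b => (T b).1 < c).card := by
    intro j
    by_cases hj : c ≤ μ.colLen j
    · have h1 : ((S j).filter fun b => (T b).1 < c).card ≤ (Finset.range c).card := by
        refine Finset.card_le_card_of_injOn (fun b => (T b).1) ?_ ?_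
        · intro b hb
          simpa using (Finset.mem_filter.1 hb).2
        · intro b hb b' hb' hbb
          have e1 : (T (σ b)).2 = j := by simpa [S] using (Finset.mem_filter.1 hb).1
          have e2 : (T (σ b')).2 = j := by simpa [S] using (Finset.mem_filter.1 hb').1
          exact h b b' hbb (e1.trans e2.symm)
      refine h1.trans (Finset.card_le_card_of_surjOn (fun b => (T b).1) ?_)
      intro i hi
      have hi' : i < c := by simpa using hi
      obtain ⟨b, hb⟩ := μ.exists_columnReading_eq (c := (i, j))
        (mem_iff_lt_colLen.2 (hi'.trans_le hj))
      refine ⟨b, ?_, ?_⟩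
      · simp [D, hT, hb, hi']
      · simp [hT, hb]
    · have h2 : (D j).filter (fun b => (T b).1 < c) = D j := by
        rw [Finset.filter_eq_self]
        intro b hb
        have e1 : (T b).2 = j := by simpa [D] using hb
        have := hrow b
        rw [e1] at this
        omega
      rw [h2, ← hcard]
      exact Finset.card_filter_le _ _
  let J := Finset.univ.image fun b => (T b).2
  have sumD : (Finset.univ.filter fun b => (T b).1 < c).card
      = ∑ j ∈ J, ((D j).filter fun b => (T b).1 < c).card := by
    rw [Finset.card_eq_sum_card_fiberwise (f := fun b => (T b).2) (t := J)
      (fun b _ => Finset.mem_coe.2 (Finset.mem_image_of_mem _ (Finset.mem_univ b)))]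
    refine Finset.sum_congr rfl fun j _ => ?_
    rw [Finset.filter_comm]
  have sumS : (Finset.univ.filter fun b => (T b).1 < c).card
      = ∑ j ∈ J, ((S j).filter fun b => (T b).1 < c).card := by
    rw [Finset.card_eq_sum_card_fiberwise (f := fun b => (T (σ b)).2) (t := J)
      (fun b _ => Finset.mem_coe.2 (Finset.mem_image_of_mem (fun b => (T b).2)
        (Finset.mem_univ (σ b))))]
    refine Finset.sum_congr rfl fun j _ => ?_
    rw [Finset.filter_comm]
  have heq := (Finset.sum_eq_sum_iff_of_le fun j _ => hle j).1 (sumS.symm.trans sumD)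
    (T (σ a)).2 (Finset.mem_image_of_mem (fun b => (T b).2) (Finset.mem_univ (σ a)))
  have hD : (D (T (σ a)).2).filter (fun b => (T b).1 < c) = D (T (σ a)).2 := by
    rw [Finset.filter_eq_self]
    intro b hb
    have e1 : (T b).2 = (T (σ a)).2 := by simpa [D] using hb
    have := hrow b
    rwa [e1] at this
  rw [hD, ← hcard] at heq
  have hS := Finset.eq_of_subset_of_card_le (Finset.filter_subset _ _) heq.ge
  have ha : a ∈ S (T (σ a)).2 := by simp [S]
  rw [← hS] at ha
  exact mem_iff_lt_colLen.2 (Finset.mem_filter.1 ha).2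

theorem exists_eq_column_mul_row {σ : Equiv.Perm (Fin μ.card)}
    (h : ∀ a b, (μ.columnReading a).1 = (μ.columnReading b).1 →
      (μ.columnReading (σ a)).2 = (μ.columnReading (σ b)).2 → a = b) :
    ∃ γ ∈ μ.columnGroup, ∃ ρ ∈ μ.rowGroup, σ = γ * ρ := by
  choose r hr using fun a => μ.exists_columnReading_eq (row_column_mem h a)
  have hinj : Function.Injective r := by
    intro a b hab
    have := (hr a).symm.trans ((congrArg μ.columnReading hab).trans (hr b))
    exact h a b (Prod.ext_iff.1 this).1 (Prod.ext_iff.1 this).2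
  let ρ : Equiv.Perm (Fin μ.card) := Equiv.ofBijective r (Finite.injective_iff_bijective.1 hinj)
  have hρ : ∀ a, μ.columnReading (ρ a)
      = ((μ.columnReading a).1, (μ.columnReading (σ a)).2) := hr
  refine ⟨σ * ρ⁻¹, mem_columnGroup.2 fun b => ?_, ρ, mem_rowGroup.2 fun a => ?_, by group⟩
  · have := hρ (ρ⁻¹ b)
    rw [← Equiv.Perm.mul_apply, mul_inv_cancel, Equiv.Perm.one_apply] at this
    rw [Equiv.Perm.mul_apply, this]
  · rw [hρ]

/-- The Young symmetrizer in the group algebra. -/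
noncomputable def groupSymmetrizer (μ : YoungDiagram) :
    MonoidAlgebra ℂ (Equiv.Perm (Fin μ.card)) :=
  μ.youngSymmetrizer fun σ => MonoidAlgebra.single σ 1

theorem single_mul_groupSymmetrizer {γ : Equiv.Perm (Fin μ.card)} (hγ : γ ∈ μ.columnGroup) :
    MonoidAlgebra.single γ (1 : ℂ) * μ.groupSymmetrizer
      = ((Equiv.Perm.sign γ : ℤ) : ℂ) • μ.groupSymmetrizer := by
  rw [groupSymmetrizer, youngSymmetrizer, Finset.mul_sum, Finset.smul_sum]
  refine Finset.sum_equiv (Equiv.mulLeft γ) (fun γ' => ?_) (fun γ' _ => ?_)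
  · refine ⟨columnGroup_mul hγ, fun h => ?_⟩
    have := columnGroup_mul (columnGroup_inv hγ) h
    simpa using this
  · rw [Finset.mul_sum, Finset.smul_sum]
    refine Finset.sum_congr rfl fun ρ _ => ?_
    rw [mul_smul_comm, MonoidAlgebra.single_mul_single, smul_smul, mul_one, Equiv.coe_mulLeft,
      Equiv.Perm.sign_mul, mul_assoc]
    congr 1
    rcases Int.units_eq_one_or (Equiv.Perm.sign γ) with h | h <;> simp [h]

theorem groupSymmetrizer_mul_single {ρ : Equiv.Perm (Fin μ.card)} (hρ : ρ ∈ μ.rowGroup) :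
    μ.groupSymmetrizer * MonoidAlgebra.single ρ (1 : ℂ) = μ.groupSymmetrizer := by
  rw [groupSymmetrizer, youngSymmetrizer, Finset.sum_mul]
  refine Finset.sum_congr rfl fun γ _ => ?_
  rw [Finset.sum_mul]
  refine Finset.sum_equiv (Equiv.mulRight ρ) (fun ρ' => ?_) (fun ρ' _ => ?_)
  · refine ⟨fun h => rowGroup_mul h hρ, fun h => ?_⟩
    have := rowGroup_mul h (rowGroup_inv hρ)
    simpa using this
  · rw [smul_mul_assoc, MonoidAlgebra.single_mul_single, mul_one, Equiv.coe_mulRight, mul_assoc]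

theorem coeff_groupSymmetrizer (σ : Equiv.Perm (Fin μ.card)) :
    μ.groupSymmetrizer.coeff σ = ∑ γ ∈ μ.columnGroup, ∑ ρ ∈ μ.rowGroup,
      if γ * ρ = σ then ((Equiv.Perm.sign γ : ℤ) : ℂ) else 0 := by
  classical
  simp only [groupSymmetrizer, youngSymmetrizer, MonoidAlgebra.coeff_sum, MonoidAlgebra.coeff_smul,
    MonoidAlgebra.coeff_single, Finsupp.finsetSum_apply, Finsupp.smul_apply, Finsupp.single_apply,
    smul_eq_mul, mul_ite, mul_one, mul_zero]

theorem coeff_groupSymmetrizer_one : μ.groupSymmetrizer.coeff 1 = 1 := by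
  rw [coeff_groupSymmetrizer, Finset.sum_eq_single 1, Finset.sum_eq_single 1]
  · simp
  · intro ρ _ hρ
    rw [if_neg]
    simpa using hρ
  · intro h
    exact absurd one_mem_rowGroup h
  · intro γ hγ hγ1
    refine Finset.sum_eq_zero fun ρ hρ => if_neg fun h => hγ1 ?_
    rw [mul_eq_one_iff_eq_inv] at h
    exact eq_one_of_mem_both (h ▸ rowGroup_inv hρ) hγ
  · intro h
    exact absurd one_mem_columnGroup h

/-- An element on which the column group acts by the sign from the left and the row group acts
trivially from the right is a multiple of the Young symmetrizer. -/
theorem eq_smul_groupSymmetrizer {x : MonoidAlgebra ℂ (Equiv.Perm (Fin μ.card))}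
    (hc : ∀ γ ∈ μ.columnGroup, MonoidAlgebra.single γ (1 : ℂ) * x
      = ((Equiv.Perm.sign γ : ℤ) : ℂ) • x)
    (hr : ∀ ρ ∈ μ.rowGroup, x * MonoidAlgebra.single ρ (1 : ℂ) = x) :
    x = x.coeff 1 • μ.groupSymmetrizer := by
  have main : ∀ y : MonoidAlgebra ℂ (Equiv.Perm (Fin μ.card)),
      (∀ γ ∈ μ.columnGroup, MonoidAlgebra.single γ (1 : ℂ) * y
        = ((Equiv.Perm.sign γ : ℤ) : ℂ) • y) →
      (∀ ρ ∈ μ.rowGroup, y * MonoidAlgebra.single ρ (1 : ℂ) = y) → y.coeff 1 = 0 → y = 0 := by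
    intro y hc hr h0
    ext σ
    have hrow : ∀ ρ ∈ μ.rowGroup, ∀ τ, y.coeff (τ * ρ) = y.coeff τ := by
      intro ρ hρ τ
      have := congrArg (fun z => z.coeff (τ * ρ)) (hr ρ hρ)
      simpa using this.symm
    have hcol : ∀ γ ∈ μ.columnGroup, ∀ τ,
        y.coeff (γ * τ) = ((Equiv.Perm.sign γ : ℤ) : ℂ) * y.coeff τ := by
      intro γ hγ τ
      have h1 := congrArg (fun z => z.coeff (γ * τ)) (hc γ hγ)
      have h2 : y.coeff τ = ((Equiv.Perm.sign γ : ℤ) : ℂ) * y.coeff (γ * τ) := by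
        simpa using h1
      rw [h2, ← mul_assoc]
      rcases Int.units_eq_one_or (Equiv.Perm.sign γ) with h | h <;> simp [h]
    by_cases h : ∀ a b, (μ.columnReading a).1 = (μ.columnReading b).1 →
        (μ.columnReading (σ a)).2 = (μ.columnReading (σ b)).2 → a = b
    · obtain ⟨γ, hγ, ρ, hρ, rfl⟩ := exists_eq_column_mul_row h
      rw [hrow ρ hρ, ← mul_one γ, hcol γ hγ, h0, mul_zero]
      rfl
    · -- a transposition in the row group is conjugate under `σ` to one in the column group
      push Not at h
      obtain ⟨a, b, h1, h2, hab⟩ := h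
      have hρ : Equiv.swap a b ∈ μ.rowGroup :=
        mem_rowGroup.2 fun e => apply_swap_of_eq (fun e => (μ.columnReading e).1) h1 e
      have hγ : Equiv.swap (σ a) (σ b) ∈ μ.columnGroup :=
        mem_columnGroup.2 fun e => apply_swap_of_eq (fun e => (μ.columnReading e).2) h2 e
      have e : Equiv.swap (σ a) (σ b) * σ = σ * Equiv.swap a b := by
        rw [Equiv.mul_swap_eq_swap_mul]
      have := hcol _ hγ σ
      rw [e, hrow _ hρ, Equiv.Perm.sign_swap (σ.injective.ne hab)] at this
      have h3 : y.coeff σ = - y.coeff σ := by simpa using this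
      simpa using self_eq_neg.1 h3
  rw [← sub_eq_zero]
  refine main _ ?_ ?_ ?_
  · intro γ hγ
    rw [mul_sub, mul_smul_comm, single_mul_groupSymmetrizer hγ, hc γ hγ, smul_sub, smul_comm]
  · intro ρ hρ
    rw [sub_mul, smul_mul_assoc, groupSymmetrizer_mul_single hρ, hr ρ hρ]
  · rw [MonoidAlgebra.coeff_sub, MonoidAlgebra.coeff_smul, Finsupp.sub_apply, Finsupp.smul_apply,
      coeff_groupSymmetrizer_one, smul_eq_mul, mul_one, sub_self]

theorem groupSymmetrizer_mul_mul (x : MonoidAlgebra ℂ (Equiv.Perm (Fin μ.card))) :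
    μ.groupSymmetrizer * x * μ.groupSymmetrizer
      = (μ.groupSymmetrizer * x * μ.groupSymmetrizer).coeff 1 • μ.groupSymmetrizer := by
  apply eq_smul_groupSymmetrizer
  · intro γ hγ
    rw [← mul_assoc, ← mul_assoc, single_mul_groupSymmetrizer hγ, smul_mul_assoc, smul_mul_assoc]
  · intro ρ hρ
    rw [mul_assoc, groupSymmetrizer_mul_single hρ]

/-- Right multiplication by an element `x` of a finite group algebra has trace `|G| x(1)`; hence
an element with non-zero coefficient at the identity does not square to zero. -/
theorem _root_.MonoidAlgebra.mul_self_ne_zero {G : Type*} [Group G] [Finite G]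
    {x : MonoidAlgebra ℂ G} (hx : x.coeff 1 ≠ 0) : x * x ≠ 0 := by
  have := Fintype.ofFinite G
  intro h
  let f : MonoidAlgebra ℂ G →ₗ[ℂ] MonoidAlgebra ℂ G := LinearMap.mulRight ℂ x
  have hf : IsNilpotent f := ⟨2, LinearMap.ext fun y => by
    simp [f, pow_two, mul_assoc, h]⟩
  have h1 : LinearMap.trace ℂ _ f = 0 :=
    (LinearMap.isNilpotent_trace_of_isNilpotent hf).eq_zero
  let ι : MonoidAlgebra ℂ G →ₗ[ℂ] G → ℂ :=
    { toFun := fun y g => y.coeff g, map_add' := fun _ _ => rfl, map_smul' := fun _ _ => rfl }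
  rw [trace_eq_sum_of_reproducing f ι (fun g => MonoidAlgebra.single g 1)
    MonoidAlgebra.sum_coeff_smul_single] at h1
  have h2 : ∀ g : G, ι (f (MonoidAlgebra.single g 1)) g = x.coeff 1 := fun g => by
    change (MonoidAlgebra.single g 1 * x).coeff g = _
    simp
  simp only [h2, Finset.sum_const, Finset.card_univ, nsmul_eq_mul, mul_eq_zero] at h1
  rcases h1 with h1 | h1
  · exact Fintype.card_ne_zero (Nat.cast_eq_zero.1 h1)
  · exact hx h1

theorem groupSymmetrizer_mul_self (μ : YoungDiagram) : ∃ c : ℂ, c ≠ 0 ∧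
    μ.groupSymmetrizer * μ.groupSymmetrizer = c • μ.groupSymmetrizer := by
  have h := groupSymmetrizer_mul_mul (μ := μ) 1
  rw [mul_one] at h
  refine ⟨_, fun h0 => ?_, h⟩
  rw [h0, zero_smul] at h
  exact MonoidAlgebra.mul_self_ne_zero (by rw [coeff_groupSymmetrizer_one]; exact one_ne_zero) h

theorem symmetricCharacter_eq_sum {c : ℂ} (hc : c ≠ 0)
    (h : μ.groupSymmetrizer * μ.groupSymmetrizer = c • μ.groupSymmetrizer)
    (σ : Equiv.Perm (Fin μ.card)) :
    μ.symmetricCharacter σ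
      = ∑ τ, c⁻¹ * μ.groupSymmetrizer.coeff ((σ * τ)⁻¹ * τ) := by
  let ι : μ.spechtModule →ₗ[ℂ] Equiv.Perm (Fin μ.card) → ℂ :=
    { toFun := fun y g => y.1.coeff g, map_add' := fun _ _ => rfl, map_smul' := fun _ _ => rfl }
  let v : Equiv.Perm (Fin μ.card) → μ.spechtModule := fun τ =>
    ⟨(c⁻¹ • MonoidAlgebra.single τ (1 : ℂ)) * μ.groupSymmetrizer,
      Ideal.mul_mem_left _ _ (Ideal.subset_span rfl)⟩
  have hv : ∀ u, ∑ τ, ι u τ • v τ = u := by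
    rintro ⟨u, hu⟩
    refine Subtype.ext ?_
    obtain ⟨y, rfl⟩ := Ideal.mem_span_singleton'.1 hu
    change ((∑ τ, ι ⟨_, hu⟩ τ • v τ : μ.spechtModule) : MonoidAlgebra ℂ _)
      = y * μ.groupSymmetrizer
    rw [Submodule.coe_sum]
    calc _ = c⁻¹ • ((∑ τ, (y * μ.groupSymmetrizer).coeff τ • MonoidAlgebra.single τ (1 : ℂ))
        * μ.groupSymmetrizer) := by
          rw [Finset.sum_mul, Finset.smul_sum]
          refine Finset.sum_congr rfl fun τ _ => ?_
          change (y * μ.groupSymmetrizer).coeff τ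
            • ((c⁻¹ • MonoidAlgebra.single τ (1 : ℂ)) * μ.groupSymmetrizer) = _
          rw [smul_mul_assoc, smul_mul_assoc, smul_comm]
      _ = _ := by
          rw [MonoidAlgebra.sum_coeff_smul_single, mul_assoc, h, mul_smul_comm, smul_smul,
            inv_mul_cancel₀ hc, one_smul]
  rw [symmetricCharacter, moduleCharacter, trace_eq_sum_of_reproducing _ ι v hv]
  refine Finset.sum_congr rfl fun τ _ => ?_
  change (MonoidAlgebra.single σ (1 : ℂ)
    * ((c⁻¹ • MonoidAlgebra.single τ (1 : ℂ)) * μ.groupSymmetrizer)).coeff τ = _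
  rw [smul_mul_assoc, mul_smul_comm, ← mul_assoc, MonoidAlgebra.single_mul_single, mul_one,
    MonoidAlgebra.coeff_smul, Finsupp.smul_apply, MonoidAlgebra.coeff_single_mul_apply, one_mul,
    smul_eq_mul]

/-- A diagram with a single row gives the trivial character. -/
theorem symmetricCharacter_eq_one (h : ∀ c ∈ μ.cells, c.1 = 0) (σ : Equiv.Perm (Fin μ.card)) :
    μ.symmetricCharacter σ = 1 := by
  have hrow : ∀ ρ, ρ ∈ μ.rowGroup := fun ρ => mem_rowGroup.2 fun a => by
    rw [h _ (μ.columnReading_mem _), h _ (μ.columnReading_mem _)]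
  have hcoeff : ∀ g, μ.groupSymmetrizer.coeff g = 1 := by
    intro g
    have := congrArg (fun z => z.coeff g) (groupSymmetrizer_mul_single (hrow g))
    rw [← this]
    simp [coeff_groupSymmetrizer_one]
  obtain ⟨c, hc, hcc⟩ := μ.groupSymmetrizer_mul_self
  have hc' : c = Fintype.card (Equiv.Perm (Fin μ.card)) := by
    have h1 : μ.groupSymmetrizer * μ.groupSymmetrizer
        = (Fintype.card (Equiv.Perm (Fin μ.card)) : ℂ) • μ.groupSymmetrizer := by
      nth_rewrite 2 [← MonoidAlgebra.sum_coeff_smul_single μ.groupSymmetrizer]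
      rw [Finset.mul_sum, Finset.sum_congr rfl fun g _ => by
        rw [hcoeff, one_smul, groupSymmetrizer_mul_single (hrow g)], Finset.sum_const,
        Finset.card_univ, Nat.cast_smul_eq_nsmul]
    have := congrArg (fun z => z.coeff 1) (hcc.symm.trans h1)
    simpa [coeff_groupSymmetrizer_one] using this
  rw [symmetricCharacter_eq_sum hc hcc]
  simp only [hcoeff, mul_one, Finset.sum_const, Finset.card_univ, nsmul_eq_mul, ← hc']
  exact mul_inv_cancel₀ hc

end Symmetrizer

end YoungDiagram

/-! ### Permutation diagrams -/

namespace Diagram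

section PermDiagram

variable {k : ℕ}

/-- The diagram in which the bottom vertex `b` is joined to the top vertex `π b`. -/
def permDiagram (π : Equiv.Perm (Fin k)) : Diagram k :=
  Setoid.ker (Sum.elim id π : Fin k ⊕ Fin k → Fin k)

theorem topRel_permDiagram (π : Equiv.Perm (Fin k)) : topRel (permDiagram π) = ⊥ :=
  Setoid.ext fun _ _ => Iff.rfl

theorem mid_permDiagram (d : Diagram k) (π : Equiv.Perm (Fin k)) :
    mid d (permDiagram π) = botRel d := by
  rw [mid, topRel_permDiagram, sup_bot_eq]

theorem comp_permDiagram {d : Diagram k} {π : Equiv.Perm (Fin k)} {x y : Fin k ⊕ Fin k} :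
    comp d (permDiagram π) x y ↔ d (Sum.map id π x) (Sum.map id π y) := by
  have cross : ∀ a b, comp d (permDiagram π) (Sum.inl a) (Sum.inr b)
      ↔ d (Sum.inl a) (Sum.inr (π b)) := by
    intro a b
    rw [comp_inl_inr, mid_permDiagram]
    constructor
    · rintro ⟨i, j, h1, h2, h3⟩
      have h3 : j = π b := h3
      exact h3 ▸ Setoid.trans' d h1 h2
    · intro h
      exact ⟨π b, π b, h, Setoid.refl' _ _, rfl⟩
  rcases x with a | a <;> rcases y with b | b
  · rw [comp_inl_inl, mid_permDiagram]
    refine ⟨?_, Or.inl⟩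
    rintro (h | ⟨i, j, h1, h2, h3⟩)
    · exact h
    · exact Setoid.trans' d h1 (Setoid.trans' d h2 (Setoid.symm' d h3))
  · exact cross a b
  · rw [Setoid.comm', cross]
    exact Setoid.comm' d
  · rw [comp_inr_inr, mid_permDiagram]
    constructor
    · rintro (h | ⟨i, j, h1, h2, h3⟩)
      · have h : π a = π b := h
        change d (Sum.inr (π a)) (Sum.inr (π b))
        rw [h]
      · have h1 : i = π a := h1
        have h3 : j = π b := h3
        subst h1 h3
        exact h2
    · intro h
      exact Or.inr ⟨π a, π b, rfl, h, rfl⟩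

theorem permDiagram_comp (π ρ : Equiv.Perm (Fin k)) :
    comp (permDiagram π) (permDiagram ρ) = permDiagram (π * ρ) := by
  refine Setoid.ext fun x y => comp_permDiagram.trans ?_
  rcases x with a | a <;> rcases y with b | b <;> exact Iff.rfl

theorem permDiagram_one : permDiagram (1 : Equiv.Perm (Fin k)) = one k := rfl

theorem transpose_permDiagram (π : Equiv.Perm (Fin k)) :
    transpose (permDiagram π) = permDiagram π⁻¹ := by
  refine ext_rel ?_ ?_ ?_
  · ext a b
    exact π.injective.eq_iff
  · ext a b
    exact (π⁻¹).injective.eq_iff.symm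
  · intro a b
    change π a = b ↔ a = π⁻¹ b
    rw [Equiv.Perm.eq_inv_iff_eq]

theorem loops_permDiagram (d : Diagram k) (π : Equiv.Perm (Fin k)) :
    loops d (permDiagram π) = 0 :=
  loops_eq_zero_of_propTop d (Set.eq_univ_of_forall fun i => ⟨π⁻¹ i, (π.apply_symm_apply i).symm⟩)

theorem topRel_comp_permDiagram (d : Diagram k) (π : Equiv.Perm (Fin k)) :
    topRel (comp d (permDiagram π)) = topRel d :=
  Setoid.ext fun _ _ => comp_permDiagram

theorem propTop_comp_permDiagram (d : Diagram k) (π : Equiv.Perm (Fin k)) :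
    propTop (comp d (permDiagram π)) = propTop d := by
  ext a
  constructor
  · rintro ⟨j, hj⟩
    exact ⟨π j, comp_permDiagram.1 hj⟩
  · rintro ⟨j, hj⟩
    refine ⟨π⁻¹ j, comp_permDiagram.2 ?_⟩
    change d (Sum.inl a) (Sum.inr (π (π.symm j)))
    rwa [π.apply_symm_apply]

theorem isPermutation_permDiagram (π : Equiv.Perm (Fin k)) : IsPermutation (permDiagram π) := by
  rintro (a | a)
  · exact ⟨⟨a, rfl, fun _ h => Eq.symm h⟩, π⁻¹ a, (π.apply_symm_apply a).symm, fun _ h =>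
      (Equiv.Perm.eq_inv_iff_eq).2 (Eq.symm h)⟩
  · exact ⟨⟨π a, rfl, fun _ h => Eq.symm h⟩, a, rfl, fun _ h => (π.injective h).symm⟩

/-- The extension of a permutation of the first `m` strands to all strands. -/
noncomputable def extendPerm {m : ℕ} (hm : m ≤ k) (g : Equiv.Perm (Fin m)) :
    Equiv.Perm (Fin k) :=
  Equiv.Perm.viaEmbeddingHom (Fin.castLEEmb hm) g

theorem extendPerm_castLE {m : ℕ} (hm : m ≤ k) (g : Equiv.Perm (Fin m)) (i : Fin m) :
    extendPerm hm g (Fin.castLE hm i) = Fin.castLE hm (g i) :=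
  Equiv.Perm.viaEmbedding_apply g (Fin.castLEEmb hm) i

theorem extendPerm_of_le {m : ℕ} (hm : m ≤ k) (g : Equiv.Perm (Fin m)) {i : Fin k}
    (h : m ≤ (i : ℕ)) : extendPerm hm g i = i := by
  refine Equiv.Perm.viaEmbedding_apply_of_notMem g (Fin.castLEEmb hm) i ?_
  rintro ⟨j, rfl⟩
  have := j.2
  simp at h
  omega

/-- The diagram of a permutation of the first `m` strands. -/
noncomputable def strandPerm {m : ℕ} (hm : m ≤ k) (g : Equiv.Perm (Fin m)) : Diagram k :=
  permDiagram (extendPerm hm g)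

theorem ofPerm_extendDomain {m : ℕ} (hm : m ≤ k) (g : Equiv.Perm (Fin m)) :
    ofPerm k (g.extendDomain Fin.equivSubtype) = strandPerm hm g := by
  have h : ∀ b : Fin k, g.extendDomain Fin.equivSubtype (b : ℕ) = (extendPerm hm g b : ℕ) := by
    intro b
    by_cases hb : (b : ℕ) < m
    · have e : b = Fin.castLE hm ⟨b, hb⟩ := rfl
      rw [e, extendPerm_castLE]
      exact Equiv.Perm.extendDomain_apply_subtype g Fin.equivSubtype hb
    · rw [extendPerm_of_le hm g (not_lt.1 hb),
        Equiv.Perm.extendDomain_apply_not_subtype g Fin.equivSubtype hb]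
  have e : (Sum.elim (fun a => (a : ℕ)) fun b => g.extendDomain Fin.equivSubtype (b : ℕ) :
      Fin k ⊕ Fin k → ℕ) = (fun i : Fin k => (i : ℕ)) ∘ Sum.elim id (extendPerm hm g) := by
    funext x
    rcases x with x | x
    · rfl
    · exact h x
  refine Setoid.ext fun x y => ?_
  change (_ : ℕ) = _ ↔ _
  rw [e]
  exact Fin.val_injective.eq_iff

theorem strandPerm_comp {m : ℕ} (hm : m ≤ k) (g h : Equiv.Perm (Fin m)) :
    comp (strandPerm hm g) (strandPerm hm h) = strandPerm hm (g * h) := by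
  rw [strandPerm, strandPerm, permDiagram_comp, strandPerm, extendPerm, extendPerm, extendPerm,
    map_mul]

theorem strandPerm_one {m : ℕ} (hm : m ≤ k) : strandPerm hm 1 = one k := by
  rw [strandPerm, extendPerm, map_one, permDiagram_one]

theorem transpose_strandPerm {m : ℕ} (hm : m ≤ k) (g : Equiv.Perm (Fin m)) :
    transpose (strandPerm hm g) = strandPerm hm g⁻¹ := by
  rw [strandPerm, transpose_permDiagram, strandPerm, extendPerm, extendPerm, map_inv]

end PermDiagram

/-! ### Diagrams with a prescribed bottom half -/

section Tail

variable {k m : ℕ} {f : ℕ → ℕ}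

/-- The diagram with identity edges on the first `m` strands whose other vertices are joined, in
each row separately, when they have the same label under `f`. -/
def labelTail (k m : ℕ) (f : ℕ → ℕ) : Diagram k :=
  Setoid.ker (Sum.elim (fun a => (f a, false)) fun b => (f b, decide (m ≤ (b : ℕ))) :
    Fin k ⊕ Fin k → ℕ × Bool)

/-- The labels of a tail: `f` separates the first `m` strands from each other and from the rest. -/
structure IsTailLabel (m : ℕ) (f : ℕ → ℕ) : Prop where
  apply_of_lt : ∀ a, a < m → f a = a
  le_apply : ∀ a, m ≤ a → m ≤ f a

theorem IsTailLabel.eq_of_lt (hf : IsTailLabel m f) {a b : ℕ} (ha : a < m) (h : f a = f b) :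
    a = b := by
  rw [hf.apply_of_lt a ha] at h
  by_cases hb : b < m
  · rw [h, hf.apply_of_lt b hb]
  · have := hf.le_apply b (not_lt.1 hb)
    omega

theorem IsTailLabel.lt_iff (hf : IsTailLabel m f) {a b : ℕ} (h : f a = f b) : a < m ↔ b < m :=
  ⟨fun ha => hf.eq_of_lt ha h ▸ ha, fun hb => hf.eq_of_lt hb h.symm ▸ hb⟩

/-- The bottom half of `x` is that of the tail diagram. -/
structure HasTail (m : ℕ) (f : ℕ → ℕ) (x : Diagram k) : Prop where
  bot : ∀ a b : Fin k, x (Sum.inr a) (Sum.inr b) ↔ f a = f b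
  prop : ∀ j : Fin k, j ∈ propBot x ↔ (j : ℕ) < m

theorem labelTail_inl_inl {a b : Fin k} :
    labelTail k m f (Sum.inl a) (Sum.inl b) ↔ f a = f b :=
  Prod.ext_iff.trans (and_iff_left rfl)

theorem labelTail_inl_inr (hf : IsTailLabel m f) {a b : Fin k} :
    labelTail k m f (Sum.inl a) (Sum.inr b) ↔ a = b ∧ (b : ℕ) < m := by
  refine Prod.ext_iff.trans ?_
  change f a = f b ∧ false = decide (m ≤ (b : ℕ)) ↔ _
  rw [eq_comm (a := false), decide_eq_false_iff_not, not_le]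
  refine and_congr_left fun hb => ?_
  exact ⟨fun h => Fin.ext (hf.eq_of_lt ((hf.lt_iff h).2 hb) h), fun h => by rw [h]⟩

theorem labelTail_inr_inr (hf : IsTailLabel m f) {a b : Fin k} :
    labelTail k m f (Sum.inr a) (Sum.inr b) ↔ f a = f b := by
  refine Prod.ext_iff.trans ?_
  change f a = f b ∧ decide (m ≤ (a : ℕ)) = decide (m ≤ (b : ℕ)) ↔ _
  refine and_iff_left_of_imp fun h => ?_
  rw [decide_eq_decide, ← not_lt, ← not_lt, hf.lt_iff h]

theorem transpose_labelTail (hf : IsTailLabel m f) :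
    transpose (labelTail k m f) = labelTail k m f := by
  refine ext_rel ?_ ?_ ?_
  · ext a b
    exact (labelTail_inr_inr hf).trans labelTail_inl_inl.symm
  · ext a b
    exact labelTail_inl_inl.trans (labelTail_inr_inr hf).symm
  · intro a b
    rw [transpose_inl_inr, labelTail_inl_inr hf, labelTail_inl_inr hf]
    constructor <;> rintro ⟨rfl, h⟩ <;> exact ⟨rfl, h⟩

theorem hasTail_labelTail (hf : IsTailLabel m f) : HasTail m f (labelTail k m f) where
  bot _ _ := labelTail_inr_inr hf
  prop j := ⟨fun ⟨_, h⟩ => ((labelTail_inl_inr hf).1 h).2,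
    fun h => ⟨j, (labelTail_inl_inr hf).2 ⟨rfl, h⟩⟩⟩

theorem HasTail.eq_of_rel {x : Diagram k} (hf : IsTailLabel m f) (hx : HasTail m f x) (hm : m ≤ k)
    {i j : Fin m} (h : x (Sum.inr (Fin.castLE hm i)) (Sum.inr (Fin.castLE hm j))) : i = j :=
  Fin.ext (hf.eq_of_lt i.2 ((hx.bot _ _).1 h))

theorem HasTail.exists_inl {x : Diagram k} (hx : HasTail m f x) (hm : m ≤ k) (i : Fin m) :
    ∃ a, x (Sum.inl a) (Sum.inr (Fin.castLE hm i)) :=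
  (hx.prop _).2 i.2

theorem HasTail.exists_index {x : Diagram k} (hx : HasTail m f x) (hm : m ≤ k) {a : Fin k}
    (ha : a ∈ propTop x) : ∃ i : Fin m, x (Sum.inl a) (Sum.inr (Fin.castLE hm i)) := by
  obtain ⟨j, hj⟩ := ha
  exact ⟨⟨j, (hx.prop j).1 ⟨a, hj⟩⟩, hj⟩

theorem HasTail.ext {x y : Diagram k} (hx : HasTail m f x) (hy : HasTail m f y) (hm : m ≤ k)
    (h : topRel x = topRel y)
    (h' : ∀ a (i : Fin m), x (Sum.inl a) (Sum.inr (Fin.castLE hm i))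
      ↔ y (Sum.inl a) (Sum.inr (Fin.castLE hm i))) : x = y := by
  refine ext_rel h (Setoid.ext fun a b => (hx.bot a b).trans (hy.bot a b).symm) fun a b => ?_
  by_cases hb : (b : ℕ) < m
  · exact h' a ⟨b, hb⟩
  · exact iff_of_false (fun h => hb ((hx.prop b).1 ⟨a, h⟩)) fun h => hb ((hy.prop b).1 ⟨a, h⟩)

theorem HasTail.rank {x : Diagram k} (hf : IsTailLabel m f) (hx : HasTail m f x) (hm : m ≤ k) :
    rank x = m := by
  classical
  have h : propBlocks x = Finset.univ.image fun i : Fin m =>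
      Finset.univ.filter fun a => x (Sum.inl a) (Sum.inr (Fin.castLE hm i)) := by
    ext B
    rw [mem_propBlocks, Finset.mem_image]
    constructor
    · rintro ⟨a, ha, hB⟩
      obtain ⟨i, hi⟩ := hx.exists_index hm ha
      refine ⟨i, Finset.mem_univ _, Finset.ext fun b => ?_⟩
      rw [hB, Finset.mem_filter, and_iff_right (Finset.mem_univ _)]
      exact ⟨fun h => Setoid.trans' x hi (Setoid.symm' x h),
        fun h => Setoid.trans' x (Setoid.symm' x h) hi⟩
    · rintro ⟨i, _, rfl⟩
      obtain ⟨a, ha⟩ := hx.exists_inl hm i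
      refine ⟨a, ⟨_, ha⟩, fun b => ?_⟩
      rw [Finset.mem_filter, and_iff_right (Finset.mem_univ _)]
      exact ⟨fun h => Setoid.trans' x ha (Setoid.symm' x h),
        fun h => Setoid.trans' x (Setoid.symm' x h) ha⟩
  rw [Diagram.rank, h, Finset.card_image_of_injective, Finset.card_univ, Fintype.card_fin]
  intro i j hij
  obtain ⟨a, ha⟩ := hx.exists_inl hm i
  have ha' : a ∈ Finset.univ.filter fun a => x (Sum.inl a) (Sum.inr (Fin.castLE hm j)) := by
    rw [← show _ = Finset.univ.filter fun a => x (Sum.inl a) (Sum.inr (Fin.castLE hm j)) from hij]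
    simpa using ha
  exact hx.eq_of_rel hf hm (Setoid.trans' x (Setoid.symm' x ha) (by simpa using ha'))

theorem HasTail.comp_labelTail {x : Diagram k} (hf : IsTailLabel m f) (hx : HasTail m f x) :
    comp x (labelTail k m f) = x := by
  have hmid : mid x (labelTail k m f) = botRel x := by
    have : topRel (labelTail k m f) = botRel x :=
      Setoid.ext fun a b => labelTail_inl_inl.trans (hx.bot a b).symm
    rw [mid, this, sup_idem]
  refine ext_rel ?_ ?_ ?_
  · ext a b
    refine comp_inl_inl.trans ⟨?_, Or.inl⟩
    rw [hmid]
    rintro (h | ⟨i, j, h1, h2, h3⟩)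
    · exact h
    · exact Setoid.trans' x h1 (Setoid.trans' x h2 (Setoid.symm' x h3))
  · ext a b
    refine comp_inr_inr.trans (Iff.trans ⟨?_, Or.inl⟩
      ((labelTail_inr_inr hf).trans (hx.bot a b).symm))
    rw [hmid, labelTail_inr_inr hf, ← hx.bot]
    simp only [labelTail_inl_inr hf]
    rintro (h | ⟨i, j, h1, h2, h3⟩)
    · exact h
    · exact h1.1 ▸ h3.1 ▸ h2
  · intro a b
    rw [comp_inl_inr, hmid]
    simp only [labelTail_inl_inr hf]
    constructor
    · rintro ⟨i, j, h1, h2, rfl, _⟩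
      exact Setoid.trans' x h1 h2
    · intro h
      exact ⟨b, b, h, Setoid.refl' _ _, rfl, (hx.prop b).1 ⟨a, h⟩⟩

theorem HasTail.loops_labelTail {x : Diagram k} (hf : IsTailLabel m f) (hx : HasTail m f x) :
    loops x (labelTail k m f) = loops (labelTail k m f) (labelTail k m f) := by
  have h := loops_assoc x (labelTail k m f) (labelTail k m f)
  rw [hx.comp_labelTail hf, (hasTail_labelTail hf).comp_labelTail hf] at h
  omega

/-- If the rank of `d ∘ t` is the largest possible, then all identity strands of the tail diagram
`t` propagate in `d ∘ t` and remain separate. -/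
theorem hasTail_of_rank_comp {d : Diagram k} (hf : IsTailLabel m f) (hm : m ≤ k)
    (h : rank (comp d (labelTail k m f)) = m) : HasTail m f (comp d (labelTail k m f)) := by
  classical
  set y := comp d (labelTail k m f) with hy
  have hlt : ∀ a j, y (Sum.inl a) (Sum.inr j) → (j : ℕ) < m := by
    intro a j haj
    obtain ⟨i, l, _, _, h3⟩ := comp_inl_inr.1 haj
    exact ((labelTail_inl_inr hf).1 h3).2
  have hex : ∀ B : propBlocks y, ∃ i : Fin k, ∃ j : Fin m,
      y (Sum.inl i) (Sum.inr (Fin.castLE hm j)) ∧ ∀ i', i' ∈ B.1 ↔ y (Sum.inl i) (Sum.inl i') := by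
    rintro ⟨B, hB⟩
    obtain ⟨i, ⟨j, hij⟩, hB⟩ := mem_propBlocks.1 hB
    exact ⟨i, ⟨j, hlt i j hij⟩, hij, hB⟩
  choose i j hij hB using hex
  have hinj : Function.Injective j := by
    intro B B' hBB
    have hii : y (Sum.inl (i B)) (Sum.inl (i B')) :=
      Setoid.trans' y (hij B) (Setoid.symm' y (hBB ▸ hij B'))
    refine Subtype.ext (Finset.ext fun x => ?_)
    rw [hB, hB]
    exact ⟨fun hx => Setoid.trans' y (Setoid.symm' y hii) hx, fun hx => Setoid.trans' y hii hx⟩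
  have hsurj : Function.Surjective j := by
    refine ((Fintype.bijective_iff_injective_and_card j).2 ⟨hinj, ?_⟩).2
    rw [Fintype.card_coe, Fintype.card_fin]
    exact h
  have hsep : ∀ a b : Fin m, y (Sum.inr (Fin.castLE hm a)) (Sum.inr (Fin.castLE hm b)) → a = b := by
    intro a b hab
    obtain ⟨B, rfl⟩ := hsurj a
    obtain ⟨B', rfl⟩ := hsurj b
    have hii : y (Sum.inl (i B)) (Sum.inl (i B')) :=
      Setoid.trans' y (hij B) (Setoid.trans' y hab (Setoid.symm' y (hij B')))
    congr 1
    refine Subtype.ext (Finset.ext fun x => ?_)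
    rw [hB, hB]
    exact ⟨fun hx => Setoid.trans' y (Setoid.symm' y hii) hx, fun hx => Setoid.trans' y hii hx⟩
  constructor
  · intro a b
    rw [hy, comp_inr_inr, labelTail_inr_inr hf]
    refine ⟨?_, Or.inl⟩
    rintro (h | ⟨p, q, h1, h2, h3⟩)
    · exact h
    · have ha := ((labelTail_inl_inr hf).1 h1).2
      have hb := ((labelTail_inl_inr hf).1 h3).2
      have hab : y (Sum.inr a) (Sum.inr b) := comp_inr_inr.2 (Or.inr ⟨p, q, h1, h2, h3⟩)
      have := hsep ⟨a, ha⟩ ⟨b, hb⟩ hab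
      rw [Fin.mk.injEq] at this
      rw [this]
  · intro b
    constructor
    · rintro ⟨a, ha⟩
      exact hlt a b ha
    · intro hb
      obtain ⟨B, hB'⟩ := hsurj ⟨b, hb⟩
      refine ⟨i B, ?_⟩
      have := hij B
      rw [hB'] at this
      exact this

theorem HasTail.comp_left {d x : Diagram k} (hf : IsTailLabel m f) (hx : HasTail m f x)
    (hm : m ≤ k) (h : Diagram.rank (comp d x) = m) : HasTail m f (comp d x) := by
  rw [← hx.comp_labelTail hf, ← comp_assoc] at h ⊢
  exact hasTail_of_rank_comp hf hm h

theorem apply_extendPerm_eq_iff (hf : IsTailLabel m f) (hm : m ≤ k) (g : Equiv.Perm (Fin m))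
    (a b : Fin k) : f (extendPerm hm g a) = f (extendPerm hm g b) ↔ f a = f b := by
  have key : ∀ a : Fin k, (a : ℕ) < m → (extendPerm hm g a : ℕ) < m := by
    intro a ha
    have e : a = Fin.castLE hm ⟨a, ha⟩ := rfl
    rw [e, extendPerm_castLE]
    exact (g _).2
  have key' : ∀ a : Fin k, (extendPerm hm g a : ℕ) < m → (a : ℕ) < m := by
    intro a ha
    by_contra h
    rw [extendPerm_of_le hm g (not_lt.1 h)] at ha
    exact h ha
  by_cases ha : (a : ℕ) < m
  · exact ⟨fun h => by rw [(extendPerm hm g).injective (Fin.ext (hf.eq_of_lt (key a ha) h))],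
      fun h => by rw [Fin.ext (hf.eq_of_lt ha h)]⟩
  by_cases hb : (b : ℕ) < m
  · exact iff_of_false (fun h => ha (key' a ((hf.lt_iff h).2 (key b hb))))
      fun h => ha ((hf.lt_iff h).2 hb)
  · rw [extendPerm_of_le hm g (not_lt.1 ha), extendPerm_of_le hm g (not_lt.1 hb)]

theorem comp_strandPerm_castLE (hm : m ≤ k) {x : Diagram k} {g : Equiv.Perm (Fin m)} {a : Fin k}
    {i : Fin m} : comp x (strandPerm hm g) (Sum.inl a) (Sum.inr (Fin.castLE hm i))
      ↔ x (Sum.inl a) (Sum.inr (Fin.castLE hm (g i))) := by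
  rw [strandPerm, comp_permDiagram, ← extendPerm_castLE]
  rfl

theorem HasTail.comp_strandPerm {x : Diagram k} (hf : IsTailLabel m f) (hx : HasTail m f x)
    (hm : m ≤ k) (g : Equiv.Perm (Fin m)) : HasTail m f (comp x (strandPerm hm g)) where
  bot a b := by
    rw [strandPerm, comp_permDiagram, ← apply_extendPerm_eq_iff hf hm g]
    exact hx.bot _ _
  prop j := by
    by_cases hj : (j : ℕ) < m
    · refine iff_of_true ?_ hj
      obtain ⟨a, ha⟩ := hx.exists_inl hm (g ⟨j, hj⟩)
      exact ⟨a, (comp_strandPerm_castLE hm (i := ⟨j, hj⟩)).2 ha⟩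
    · refine iff_of_false ?_ hj
      rintro ⟨a, ha⟩
      rw [strandPerm, comp_permDiagram] at ha
      change x (Sum.inl a) (Sum.inr (extendPerm hm g j)) at ha
      rw [extendPerm_of_le hm g (not_lt.1 hj)] at ha
      exact hj ((hx.prop j).1 ⟨a, ha⟩)

/-- Diagrams with the same top half and the same tail differ by a permutation of the strands. -/
theorem HasTail.exists_strandPerm {x y : Diagram k} (hf : IsTailLabel m f) (hx : HasTail m f x)
    (hy : HasTail m f y) (hm : m ≤ k) (h : topRel x = topRel y) (h' : propTop x = propTop y) :
    ∃ g : Equiv.Perm (Fin m), y = comp x (strandPerm hm g) := by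
  have hrel : ∀ a b, x (Sum.inl a) (Sum.inl b) ↔ y (Sum.inl a) (Sum.inl b) := fun a b =>
    iff_of_eq (congrArg (fun s : Setoid (Fin k) => s a b) h)
  choose a ha using fun i => hy.exists_inl hm i
  choose s hs using fun i => hx.exists_index hm (a := a i) (h' ▸ ⟨_, ha i⟩)
  have hinj : Function.Injective s := by
    intro i j hij
    have h1 : x (Sum.inl (a i)) (Sum.inl (a j)) :=
      Setoid.trans' x (hs i) (Setoid.symm' x (hij ▸ hs j))
    exact hy.eq_of_rel hf hm (Setoid.trans' y (Setoid.symm' y (ha i))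
      (Setoid.trans' y ((hrel _ _).1 h1) (ha j)))
  refine ⟨Equiv.ofBijective s (Finite.injective_iff_bijective.1 hinj),
    hy.ext (hx.comp_strandPerm hf hm _) hm ?_ ?_⟩
  · rw [strandPerm, topRel_comp_permDiagram, h]
  · intro b i
    rw [comp_strandPerm_castLE]
    constructor
    · intro hb
      exact Setoid.trans' x ((hrel _ _).2 (Setoid.trans' y hb (Setoid.symm' y (ha i)))) (hs i)
    · intro hb
      exact Setoid.trans' y ((hrel _ _).1 (Setoid.trans' x hb (Setoid.symm' x (hs i)))) (ha i)

theorem HasTail.strandPerm_injective {x : Diagram k} (hf : IsTailLabel m f) (hx : HasTail m f x)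
    (hm : m ≤ k) : Function.Injective fun g => comp x (strandPerm hm g) := by
  intro g h hgh
  refine Equiv.ext fun i => ?_
  obtain ⟨a, ha⟩ := hx.exists_inl hm (g i)
  have h1 := (comp_strandPerm_castLE hm).2 ha
  rw [show comp x (strandPerm hm g) = comp x (strandPerm hm h) from hgh,
    comp_strandPerm_castLE] at h1
  exact hx.eq_of_rel hf hm (Setoid.trans' x (Setoid.symm' x ha) h1)

theorem HasTail.lt_of_isPlanar {x : Diagram k} (hf : IsTailLabel m f) (hx : HasTail m f x)
    (hm : m ≤ k) (hp : x.IsPlanar) {i j : Fin m} (hij : i < j) {a b : Fin k}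
    (ha : x (Sum.inl a) (Sum.inr (Fin.castLE hm i)))
    (hb : x (Sum.inl b) (Sum.inr (Fin.castLE hm j))) : a < b := by
  by_contra hab
  have hji : x (Sum.inl b) (Sum.inl a) := by
    rcases (not_lt.1 hab).eq_or_lt with h | h
    · rw [h]
    · refine hp (Sum.inl b) (Sum.inl a) (Sum.inr (Fin.castLE hm j)) (Sum.inr (Fin.castLE hm i))
        ?_ ?_ ?_ hb ha <;> simp [position] <;> omega
  exact hij.ne' (hx.eq_of_rel hf hm (Setoid.trans' x (Setoid.symm' x hb)
    (Setoid.trans' x hji ha)))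

/-- In the planar case the strands cannot be permuted. -/
theorem HasTail.strandPerm_eq_one {x : Diagram k} (hf : IsTailLabel m f) (hx : HasTail m f x)
    (hm : m ≤ k) (hp : x.IsPlanar) {g : Equiv.Perm (Fin m)}
    (hp' : (comp x (strandPerm hm g)).IsPlanar) : g = 1 := by
  have hmono : StrictMono g := by
    intro i j hij
    obtain ⟨a, ha⟩ := hx.exists_inl hm (g i)
    obtain ⟨b, hb⟩ := hx.exists_inl hm (g j)
    have hab := (hx.comp_strandPerm hf hm g).lt_of_isPlanar hf hm hp' hij
      ((comp_strandPerm_castLE hm).2 ha) ((comp_strandPerm_castLE hm).2 hb)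
    by_contra hn
    rcases (not_lt.1 hn).eq_or_lt with h | h
    · exact hij.ne' (g.injective h)
    · exact lt_asymm hab (hx.lt_of_isPlanar hf hm hp h hb ha)
  have h := Subsingleton.elim (hmono.orderIsoOfSurjective g g.surjective) (OrderIso.refl (Fin m))
  exact Equiv.ext fun i => congrArg (fun e : Fin m ≃o Fin m => e i) h

theorem strandPerm_comp_labelTail (hf : IsTailLabel m f) (hm : m ≤ k) (g : Equiv.Perm (Fin m)) :
    comp (strandPerm hm g) (labelTail k m f) = comp (labelTail k m f) (strandPerm hm g) := by
  have h : ∀ g, comp (comp (labelTail k m f) (strandPerm hm g)) (labelTail k m f)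
      = comp (labelTail k m f) (strandPerm hm g) := fun g =>
    ((hasTail_labelTail hf).comp_strandPerm hf hm g).comp_labelTail hf
  have h' := congrArg transpose (h g⁻¹)
  rw [transpose_comp, transpose_comp, transpose_strandPerm, inv_inv, transpose_labelTail hf,
    ← comp_assoc, h] at h'
  exact h'.symm

end Tail

end Diagram

/-! ### Symmetric diagrams -/

section Place

variable {α β : Type*} [LinearOrder β] {P : Finset α} {key : α → β}

theorem card_filter_lt_lt_iff {B B' : α} (hB : B ∈ P) :
    (P.filter fun C => key C < key B).card < (P.filter fun C => key C < key B').card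
      ↔ key B < key B' := by
  classical
  constructor
  · intro h
    by_contra hn
    exact absurd h (not_lt.2 (Finset.card_le_card
      (Finset.monotone_filter_right _ fun C _ hC => lt_of_lt_of_le hC (not_lt.1 hn))))
  · intro h
    refine Finset.card_lt_card (Finset.ssubset_iff_of_subset
      (Finset.monotone_filter_right _ fun C _ hC => lt_trans hC h) |>.2 ⟨B, ?_, ?_⟩)
    · exact Finset.mem_filter.2 ⟨hB, h⟩
    · simp

theorem card_filter_lt_injOn (hk : Set.InjOn key P) :
    Set.InjOn (fun B => (P.filter fun C => key C < key B).card) P := by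
  intro B hB B' hB' h
  refine hk hB hB' (le_antisymm ?_ ?_)
  · by_contra hn
    exact ((card_filter_lt_lt_iff hB').2 (not_le.1 hn)).ne' h
  · by_contra hn
    exact ((card_filter_lt_lt_iff hB).2 (not_le.1 hn)).ne h

theorem card_filter_lt_lt_card {B : α} (hB : B ∈ P) :
    (P.filter fun C => key C < key B).card < P.card := by
  refine Finset.card_lt_card (Finset.ssubset_iff_of_subset (Finset.filter_subset _ _) |>.2
    ⟨B, hB, ?_⟩)
  simp

theorem exists_card_filter_lt_eq (hk : Set.InjOn key P) {i : ℕ} (hi : i < P.card) :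
    ∃ B ∈ P, (P.filter fun C => key C < key B).card = i := by
  have h := Finset.surjOn_of_injOn_of_card_le (s := P) (t := Finset.range P.card)
    (fun B => (P.filter fun C => key C < key B).card)
    (fun B hB => Finset.mem_coe.2 (Finset.mem_range.2 (card_filter_lt_lt_card hB)))
    (card_filter_lt_injOn hk) (by simp)
  obtain ⟨B, hB, h⟩ := h (Finset.mem_coe.2 (Finset.mem_range.2 hi))
  exact ⟨B, hB, h⟩

end Place

namespace Diagram

section Symmetric

variable {k m : ℕ} {w : Diagram k}

open Classical in
/-- The top part of the block of a top vertex. -/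
noncomputable def topBlock (w : Diagram k) (a : Fin k) : Finset (Fin k) :=
  Finset.univ.filter fun b => w (Sum.inl a) (Sum.inl b)

theorem mem_topBlock {a b : Fin k} : b ∈ topBlock w a ↔ w (Sum.inl a) (Sum.inl b) := by
  simp [topBlock]

theorem mem_propBlocks_iff {B : Finset (Fin k)} :
    B ∈ propBlocks w ↔ ∃ a ∈ propTop w, B = topBlock w a := by
  rw [mem_propBlocks]
  refine exists_congr fun a => and_congr_right fun _ => ?_
  rw [Finset.ext_iff]
  exact forall_congr' fun b => by rw [mem_topBlock]

theorem topBlock_mem {a : Fin k} (ha : a ∈ propTop w) : topBlock w a ∈ propBlocks w :=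
  mem_propBlocks_iff.2 ⟨a, ha, rfl⟩

theorem topBlock_eq_iff {a b : Fin k} :
    topBlock w a = topBlock w b ↔ w (Sum.inl a) (Sum.inl b) := by
  constructor
  · intro h
    rw [← mem_topBlock, h, mem_topBlock]
  · intro h
    ext c
    rw [mem_topBlock, mem_topBlock]
    exact ⟨fun hc => Setoid.trans' w (Setoid.symm' w h) hc, fun hc => Setoid.trans' w h hc⟩

theorem propBlocks_congr {w' : Diagram k} (h : topRel w = topRel w')
    (h' : propTop w = propTop w') : propBlocks w = propBlocks w' := by
  have hb : ∀ a, topBlock w a = topBlock w' a := fun a => Finset.ext fun b => by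
    rw [mem_topBlock, mem_topBlock]
    exact iff_of_eq (congrArg (fun s : Setoid (Fin k) => s a b) h)
  ext B
  rw [mem_propBlocks_iff, mem_propBlocks_iff, h']
  simp only [hb]

theorem max_injOn_propBlocks : Set.InjOn Finset.max (propBlocks w : Set (Finset (Fin k))) := by
  intro B hB B' hB' h
  obtain ⟨a, ha, rfl⟩ := mem_propBlocks_iff.1 hB
  obtain ⟨b, hb, rfl⟩ := mem_propBlocks_iff.1 hB'
  obtain ⟨c, hc⟩ := Finset.max_of_mem (mem_topBlock.2 (Setoid.refl' w (Sum.inl a)))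
  have h1 := mem_topBlock.1 (Finset.mem_of_max hc)
  have h2 := mem_topBlock.1 (Finset.mem_of_max (h ▸ hc))
  exact topBlock_eq_iff.2 (Setoid.trans' w h1 (Setoid.symm' w h2))

theorem blockIndex_injOn : Set.InjOn (blockIndex w) (propBlocks w : Set (Finset (Fin k))) :=
  card_filter_lt_injOn max_injOn_propBlocks

theorem exists_blockIndex {i : ℕ} (hi : i < rank w) :
    ∃ B ∈ propBlocks w, blockIndex w B = i :=
  exists_card_filter_lt_eq max_injOn_propBlocks hi

/-- The place of the block of `a`, counted from `0`, among the propagating blocks of `w`. -/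
noncomputable def topIndex (w : Diagram k) (a : Fin k) : ℕ := blockIndex w (topBlock w a)

theorem topIndex_lt {a : Fin k} (ha : a ∈ propTop w) : topIndex w a < rank w :=
  card_filter_lt_lt_card (topBlock_mem ha)

theorem topIndex_eq_iff {a b : Fin k} (ha : a ∈ propTop w) (hb : b ∈ propTop w) :
    topIndex w a = topIndex w b ↔ w (Sum.inl a) (Sum.inl b) :=
  ⟨fun h => topBlock_eq_iff.1 (blockIndex_injOn (topBlock_mem ha) (topBlock_mem hb) h),
    fun h => congrArg (blockIndex w) (topBlock_eq_iff.2 h)⟩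

theorem exists_topIndex {i : ℕ} (hi : i < rank w) : ∃ a ∈ propTop w, topIndex w a = i := by
  obtain ⟨B, hB, h⟩ := exists_blockIndex hi
  obtain ⟨a, ha, rfl⟩ := mem_propBlocks_iff.1 hB
  exact ⟨a, ha, h⟩

/-- A block with a larger index contains a vertex to the right of all vertices of the other. -/
theorem exists_lt_of_topIndex_lt {a b : Fin k} (hb : b ∈ propTop w)
    (h : topIndex w b < topIndex w a) :
    ∃ c, w (Sum.inl a) (Sum.inl c) ∧ ∀ e, w (Sum.inl b) (Sum.inl e) → e < c := by
  have hlt : (topBlock w b).max < (topBlock w a).max :=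
    (card_filter_lt_lt_iff (topBlock_mem hb)).1 h
  obtain ⟨c, hc⟩ := Finset.max_of_mem (mem_topBlock.2 (Setoid.refl' w (Sum.inl a)))
  refine ⟨c, mem_topBlock.1 (Finset.mem_of_max hc), fun e he => ?_⟩
  have := (Finset.le_max (mem_topBlock.2 he)).trans_lt hlt
  rw [hc] at this
  exact WithBot.coe_lt_coe.1 this

theorem IsSymmetricDiagram.botRel_eq (hw : w.IsSymmetricDiagram m) : botRel w = topRel w := by
  rw [← topRel_transpose, hw.1]

theorem IsSymmetricDiagram.inl_inr_iff (hw : w.IsSymmetricDiagram m) {a b : Fin k} :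
    w (Sum.inl a) (Sum.inr b) ↔ a ∈ propTop w ∧ w (Sum.inl a) (Sum.inl b) := by
  constructor
  · intro h
    refine ⟨⟨b, h⟩, ?_⟩
    have h2 : transpose w (Sum.inl a) (Sum.inr b) := hw.1.symm ▸ h
    exact Setoid.trans' w (hw.2.2 a ⟨b, h⟩) (Setoid.symm' w (transpose_inl_inr.1 h2))
  · rintro ⟨⟨j, hj⟩, h⟩
    exact Setoid.trans' w h (hw.2.2 b ⟨j, Setoid.trans' w (Setoid.symm' w h) hj⟩)

/-- A symmetric diagram is determined by its top half. -/
theorem IsSymmetricDiagram.ext {w' : Diagram k} {m' : ℕ} (hw : w.IsSymmetricDiagram m)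
    (hw' : w'.IsSymmetricDiagram m') (h : topRel w = topRel w') (h' : propTop w = propTop w') :
    w = w' := by
  refine ext_rel h (by rw [hw.botRel_eq, hw'.botRel_eq, h]) fun a b => ?_
  rw [hw.inl_inr_iff, hw'.inl_inr_iff, h']
  exact and_congr_right fun _ => iff_of_eq (congrArg (fun s : Setoid (Fin k) => s a b) h)

/-- The symmetric diagram `x ∘ xᵀ` with the same top half as `x`. -/
def double (x : Diagram k) : Diagram k := comp x (transpose x)

theorem mid_double (x : Diagram k) : mid x (transpose x) = botRel x := by
  rw [mid, topRel_transpose, sup_idem]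

theorem topRel_double (x : Diagram k) : topRel (double x) = topRel x := by
  ext a b
  refine comp_inl_inl.trans ⟨?_, Or.inl⟩
  rw [mid_double]
  rintro (h | ⟨i, j, h1, h2, h3⟩)
  · exact h
  · exact Setoid.trans' x h1 (Setoid.trans' x h2 (Setoid.symm' x h3))

theorem double_inl_inr {x : Diagram k} {a b : Fin k} :
    double x (Sum.inl a) (Sum.inr b) ↔ ∃ i, x (Sum.inl a) (Sum.inr i) ∧ x (Sum.inl b) (Sum.inr i) := by
  rw [double, comp_inl_inr, mid_double]
  simp only [transpose_inl_inr]
  constructor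
  · rintro ⟨i, j, h1, h2, h3⟩
    exact ⟨j, Setoid.trans' x h1 h2, h3⟩
  · rintro ⟨i, h1, h2⟩
    exact ⟨i, i, h1, Setoid.refl' _ _, h2⟩

theorem propTop_double (x : Diagram k) : propTop (double x) = propTop x := by
  ext a
  constructor
  · rintro ⟨b, h⟩
    obtain ⟨i, hi, _⟩ := double_inl_inr.1 h
    exact ⟨i, hi⟩
  · rintro ⟨i, hi⟩
    exact ⟨a, double_inl_inr.2 ⟨i, hi, hi⟩⟩

theorem rank_double (x : Diagram k) : rank (double x) = rank x := by
  rw [rank, rank, propBlocks_congr (topRel_double x) (propTop_double x)]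

theorem isSymmetricDiagram_double (x : Diagram k) : IsSymmetricDiagram (rank x) (double x) := by
  refine ⟨?_, rank_double x, ?_⟩
  · rw [double, transpose_comp, transpose_transpose]
  · rintro a ⟨b, h⟩
    obtain ⟨i, hi, _⟩ := double_inl_inr.1 h
    exact double_inl_inr.2 ⟨i, hi, hi⟩

theorem conj_double (d x : Diagram k) : conj d (double x) = double (comp d x) := by
  rw [conj, double, double, transpose_comp, comp_assoc, comp_assoc, comp_assoc]

theorem double_eq_iff {x y : Diagram k} :
    double x = double y ↔ topRel x = topRel y ∧ propTop x = propTop y := by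
  constructor
  · intro h
    rw [← topRel_double, ← topRel_double y, ← propTop_double, ← propTop_double y, h]
    exact ⟨rfl, rfl⟩
  · rintro ⟨h, h'⟩
    exact (isSymmetricDiagram_double x).ext (isSymmetricDiagram_double y)
      (by rw [topRel_double, topRel_double, h]) (by rw [propTop_double, propTop_double, h'])

theorem double_comp_strandPerm (x : Diagram k) (hm : m ≤ k) (g : Equiv.Perm (Fin m)) :
    double (comp x (strandPerm hm g)) = double x :=
  double_eq_iff.2 ⟨topRel_comp_permDiagram _ _, propTop_comp_permDiagram _ _⟩

/-! ### The half of a symmetric diagram -/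

variable {f : ℕ → ℕ}

open Classical in
/-- The diagram with the top half of `w` and the bottom half of a tail diagram, in which the
`i`-th strand is joined to the `i`-th propagating block of `w`. -/
noncomputable def halfDiagram (w : Diagram k) (m : ℕ) (f : ℕ → ℕ) : Diagram k :=
  Setoid.ker (Sum.elim
    (fun a => if a ∈ propTop w then Sum.inl (topIndex w a)
      else Sum.inr (Sum.inl (Quotient.mk (topRel w) a)))
    (fun i => if (i : ℕ) < m then Sum.inl (i : ℕ) else Sum.inr (Sum.inr (f i))) :
    Fin k ⊕ Fin k → ℕ ⊕ Quotient (topRel w) ⊕ ℕ)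

theorem mem_propTop_congr {a b : Fin k} (h : w (Sum.inl a) (Sum.inl b)) :
    a ∈ propTop w ↔ b ∈ propTop w :=
  ⟨fun ⟨j, hj⟩ => ⟨j, Setoid.trans' w (Setoid.symm' w h) hj⟩,
    fun ⟨j, hj⟩ => ⟨j, Setoid.trans' w h hj⟩⟩

theorem halfDiagram_inl_inl {a b : Fin k} :
    halfDiagram w m f (Sum.inl a) (Sum.inl b) ↔ w (Sum.inl a) (Sum.inl b) := by
  classical
  change (if _ then _ else _) = (if _ then _ else _) ↔ _
  by_cases ha : a ∈ propTop w <;> by_cases hb : b ∈ propTop w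
  · rw [if_pos ha, if_pos hb, Sum.inl.injEq, topIndex_eq_iff ha hb]
  · rw [if_pos ha, if_neg hb]
    exact iff_of_false (by simp) fun h => hb ((mem_propTop_congr h).1 ha)
  · rw [if_neg ha, if_pos hb]
    exact iff_of_false (by simp) fun h => ha ((mem_propTop_congr h).2 hb)
  · rw [if_neg ha, if_neg hb, Sum.inr.injEq, Sum.inl.injEq]
    exact Quotient.eq

theorem halfDiagram_inl_inr {a i : Fin k} :
    halfDiagram w m f (Sum.inl a) (Sum.inr i)
      ↔ a ∈ propTop w ∧ (i : ℕ) < m ∧ topIndex w a = i := by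
  classical
  change (if _ then _ else _) = (if _ then _ else _) ↔ _
  by_cases ha : a ∈ propTop w <;> by_cases hi : (i : ℕ) < m <;> simp [ha, hi]

theorem halfDiagram_inr_inr (hf : IsTailLabel m f) {i j : Fin k} :
    halfDiagram w m f (Sum.inr i) (Sum.inr j) ↔ f i = f j := by
  classical
  change (if _ then _ else _) = (if _ then _ else _) ↔ _
  by_cases hi : (i : ℕ) < m <;> by_cases hj : (j : ℕ) < m
  · rw [if_pos hi, if_pos hj, Sum.inl.injEq, hf.apply_of_lt _ hi, hf.apply_of_lt _ hj]
  · rw [if_pos hi, if_neg hj]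
    exact iff_of_false (by simp) fun h => hj ((hf.lt_iff h).1 hi)
  · rw [if_neg hi, if_pos hj]
    exact iff_of_false (by simp) fun h => hi ((hf.lt_iff h).2 hj)
  · rw [if_neg hi, if_neg hj, Sum.inr.injEq, Sum.inr.injEq]

theorem hasTail_halfDiagram (hf : IsTailLabel m f) (hw : rank w = m) :
    HasTail m f (halfDiagram w m f) where
  bot _ _ := halfDiagram_inr_inr hf
  prop i := by
    constructor
    · rintro ⟨a, ha⟩
      exact (halfDiagram_inl_inr.1 ha).2.1
    · intro hi
      obtain ⟨a, ha, h⟩ := exists_topIndex (hw.symm ▸ hi : (i : ℕ) < rank w)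
      exact ⟨a, halfDiagram_inl_inr.2 ⟨ha, hi, h⟩⟩

theorem topRel_halfDiagram : topRel (halfDiagram w m f) = topRel w :=
  Setoid.ext fun _ _ => halfDiagram_inl_inl

theorem propTop_halfDiagram (hw : rank w = m) (hm : m ≤ k) :
    propTop (halfDiagram w m f) = propTop w := by
  ext a
  constructor
  · rintro ⟨i, hi⟩
    exact (halfDiagram_inl_inr.1 hi).1
  · intro ha
    have hlt : topIndex w a < m := hw ▸ topIndex_lt ha
    exact ⟨⟨topIndex w a, hlt.trans_le hm⟩, halfDiagram_inl_inr.2 ⟨ha, hlt, rfl⟩⟩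

theorem double_halfDiagram (hw : w.IsSymmetricDiagram m) (hm : m ≤ k) :
    double (halfDiagram w m f) = w :=
  (isSymmetricDiagram_double _).ext hw (by rw [topRel_double, topRel_halfDiagram])
    (by rw [propTop_double, propTop_halfDiagram hw.2.1 hm])

/-- The twist of `d` at `w` describes how the concatenation of `d` with the half of `w` differs
from the half of `w`. -/
theorem twist_eq {d : Diagram k} (hw : w.IsSymmetricDiagram m) (hm : m ≤ k)
    (hc : conj d w = w) {σ : Equiv.Perm (Fin m)}
    (h : comp d (halfDiagram w m f) = comp (halfDiagram w m f) (strandPerm hm σ)) :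
    twist m d w = σ := by
  have hmid : mid d (halfDiagram w m f) = mid d w := by rw [mid, mid, topRel_halfDiagram]
  -- the position of a vertex `a` of `d` above `w` relative to the `i`-th block of `w`
  have key : ∀ (a b : Fin k) (i : Fin m), b ∈ propTop w → topIndex w b = i →
      (stack d w (Sum.inl a) (Sum.inr (Sum.inl b)) ↔ a ∈ propTop w ∧ topIndex w a = σ i) := by
    intro a b i hb hbi
    have h1 : comp d (halfDiagram w m f) (Sum.inl a) (Sum.inr (Fin.castLE hm i))
        ↔ stack d w (Sum.inl a) (Sum.inr (Sum.inl b)) := by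
      rw [comp_inl_inr, stack_inl_mid, hmid]
      constructor
      · rintro ⟨p, q, h1, h2, h3⟩
        obtain ⟨hq, _, hqi⟩ := halfDiagram_inl_inr.1 h3
        have hqb : w (Sum.inl q) (Sum.inl b) := (topIndex_eq_iff hq hb).1 (hqi.trans hbi.symm)
        exact ⟨p, h1, Setoid.trans' _ h2 (topRel_le_mid d w hqb)⟩
      · rintro ⟨p, h1, h2⟩
        exact ⟨p, b, h1, h2, halfDiagram_inl_inr.2 ⟨hb, i.2, hbi⟩⟩
    rw [← h1, h, comp_strandPerm_castLE, halfDiagram_inl_inr]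
    exact ⟨fun h => ⟨h.1, h.2.2⟩, fun h => ⟨h.1, (σ i).2, h.2⟩⟩
  have hex : ∃ τ : Equiv.Perm (Fin m), IsTwist d w τ := by
    refine ⟨σ, fun i => ?_⟩
    obtain ⟨b, hb, hbi⟩ := exists_topIndex (hw.2.1.symm ▸ i.2 : (i : ℕ) < rank w)
    obtain ⟨a, ha, hai⟩ := exists_topIndex (hw.2.1.symm ▸ (σ i).2 : (σ i : ℕ) < rank w)
    rw [hc]
    exact ⟨topBlock w b, topBlock_mem hb, topBlock w a, topBlock_mem ha, hbi, hai, b,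
      mem_topBlock.2 (Setoid.refl' w _), a, mem_topBlock.2 (Setoid.refl' w _),
      (key a b i hb hbi).2 ⟨ha, hai⟩⟩
  rw [twist, dif_pos hex]
  refine Equiv.ext fun i => Fin.ext ?_
  obtain ⟨B, hB, B', hB', hi, hi', b, hb, a, ha, hab⟩ := hex.choose_spec i
  rw [hc] at hB' hi'
  obtain ⟨b', hb', rfl⟩ := mem_propBlocks_iff.1 hB
  obtain ⟨a', ha', rfl⟩ := mem_propBlocks_iff.1 hB'
  have hbb := mem_topBlock.1 hb
  have haa := mem_topBlock.1 ha
  have hbp := (mem_propTop_congr hbb).1 hb'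
  have hbi : topIndex w b = i := ((topIndex_eq_iff hb' hbp).2 hbb).symm.trans hi
  obtain ⟨hap, hai⟩ := (key a b i hbp hbi).1 hab
  rw [← hai, ← hi']
  exact (topIndex_eq_iff ha' hap).2 haa

end Symmetric

end Diagram

/-! ### Halves of symmetric diagrams in the ten families -/

namespace Diagram

section HalfClosure

variable {k m : ℕ} {w : Diagram k} {f : ℕ → ℕ}

theorem rank_le (d : Diagram k) : rank d ≤ k := by
  classical
  refine (Finset.card_image_le.trans (Finset.card_filter_le _ _)).trans_eq ?_
  simp

theorem isRook_halfDiagram (hf : IsTailLabel m f) (hinj : Function.Injective f)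
    (hw : w.IsRook) : (halfDiagram w m f).IsRook := by
  rw [isRook_iff] at hw ⊢
  rintro (a | a) (b | b) h he
  · exact hw _ _ (halfDiagram_inl_inl.1 h) rfl
  · simp at he
  · simp at he
  · rw [Fin.ext (hinj ((halfDiagram_inr_inr hf).1 h))]

/-- In a rook-Brauer diagram the propagating blocks of a symmetric diagram are vertical edges. -/
theorem IsSymmetricDiagram.eq_of_rel (hw : w.IsSymmetricDiagram m) (hb : w.IsRookBrauer)
    {a b : Fin k} (ha : a ∈ propTop w) (h : w (Sum.inl a) (Sum.inl b)) : a = b := by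
  rw [isRookBrauer_iff] at hb
  by_contra hab
  have := hb (Sum.inl a) (Sum.inl b) (Sum.inr a) h (hw.2.2 a ha) (by simpa using hab) (by simp)
  simp at this

theorem isRookBrauer_halfDiagram (hf : IsTailLabel m f)
    (h3 : ∀ i j l, f i = f j → f i = f l → i ≠ j → i ≠ l → j = l)
    (hw : w.IsSymmetricDiagram m) (hb : w.IsRookBrauer) :
    (halfDiagram w m f).IsRookBrauer := by
  have hb' := hb
  rw [isRookBrauer_iff] at hb ⊢
  have hx := fun {a b c} => Setoid.trans' (halfDiagram w m f) (x := a) (y := b) (z := c)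
  have hs := fun {a b} => Setoid.symm' (halfDiagram w m f) (x := a) (y := b)
  -- a block with a vertex in each row has no further vertices
  have mixed : ∀ {a i : Fin k} {y}, halfDiagram w m f (Sum.inl a) (Sum.inr i) →
      halfDiagram w m f (Sum.inl a) y → y = Sum.inl a ∨ y = Sum.inr i := by
    intro a i y h h'
    obtain ⟨ha, hi, _⟩ := halfDiagram_inl_inr.1 h
    rcases y with b | j
    · rw [hw.eq_of_rel hb' ha (halfDiagram_inl_inl.1 h')]
      exact Or.inl rfl
    · have hij := (halfDiagram_inr_inr hf).1 (hx (hs h) h')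
      rw [Fin.ext (hf.eq_of_lt hi hij)]
      exact Or.inr rfl
  rintro (a | a) (b | b) (c | c) h h' n n'
  · exact hb _ _ _ (halfDiagram_inl_inl.1 h) (halfDiagram_inl_inl.1 h') n n'
  · rcases mixed h' h with e | e
    · exact absurd e.symm n
    · exact absurd e (by simp)
  · rcases mixed h h' with e | e
    · exact absurd e.symm n'
    · exact absurd e (by simp)
  · rcases mixed h h' with e | e
    · exact absurd e (by simp)
    · exact e.symm
  · rcases mixed (hs h) (hx (hs h) h') with e | e
    · exact e.symm
    · exact absurd e (by simp)
  · rcases mixed (hs h) (hx (hs h) h') with e | e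
    · exact absurd e (by simp)
    · exact absurd e.symm n'
  · rcases mixed (hs h') (hx (hs h') h) with e | e
    · exact absurd e (by simp)
    · exact absurd e.symm n
  · have := h3 a b c ((halfDiagram_inr_inr hf).1 h) ((halfDiagram_inr_inr hf).1 h')
      (fun e => n (by rw [Fin.ext e])) (fun e => n' (by rw [Fin.ext e]))
    rw [Fin.ext this]

theorem isBrauer_halfDiagram (hf : IsTailLabel m f)
    (h3 : ∀ i j l, f i = f j → f i = f l → i ≠ j → i ≠ l → j = l)
    (hp : ∀ i : Fin k, m ≤ (i : ℕ) → ∃ j : Fin k, j ≠ i ∧ f i = f j)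
    (hw : w.IsSymmetricDiagram m) (hb : w.IsBrauer) (hm : m ≤ k) :
    (halfDiagram w m f).IsBrauer := by
  rw [isBrauer_iff] at hb ⊢
  refine ⟨isRookBrauer_halfDiagram hf h3 hw hb.1, ?_⟩
  rintro (a | i)
  · by_cases ha : a ∈ propTop w
    · have hlt : topIndex w a < m := hw.2.1 ▸ topIndex_lt ha
      exact ⟨Sum.inr ⟨topIndex w a, hlt.trans_le hm⟩, halfDiagram_inl_inr.2 ⟨ha, hlt, rfl⟩,
        by simp⟩
    · obtain ⟨y, hy, hne⟩ := hb.2 (Sum.inl a)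
      rcases y with b | b
      · exact ⟨Sum.inl b, halfDiagram_inl_inl.2 hy, hne⟩
      · exact absurd ⟨b, hy⟩ ha
  · by_cases hi : (i : ℕ) < m
    · obtain ⟨a, ha, h⟩ := exists_topIndex (hw.2.1.symm ▸ hi : (i : ℕ) < rank w)
      exact ⟨Sum.inl a, Setoid.symm' _ (halfDiagram_inl_inr.2 ⟨ha, hi, h⟩), by simp⟩
    · obtain ⟨j, hj, h⟩ := hp i (not_lt.1 hi)
      exact ⟨Sum.inr j, (halfDiagram_inr_inr hf).2 h, by simpa using hj.symm⟩

open Classical in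
theorem IsSymmetricDiagram.card_propTop (hw : w.IsSymmetricDiagram m) (hb : w.IsRookBrauer) :
    (Finset.univ.filter fun a => a ∈ propTop w).card = m := by
  have h : propBlocks w = (Finset.univ.filter fun a => a ∈ propTop w).image (topBlock w) := by
    ext B
    rw [mem_propBlocks_iff, Finset.mem_image]
    simp [eq_comm]
  rw [← hw.2.1, rank, h, Finset.card_image_of_injOn]
  intro a ha b _ hab
  exact hw.eq_of_rel hb (by simpa using ha) (topBlock_eq_iff.1 hab)

/-- The top vertices of a Brauer diagram that do not propagate are paired with each other. -/
theorem IsSymmetricDiagram.even_sub (hw : w.IsSymmetricDiagram m) (hb : w.IsBrauer) :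
    Even (k - m) := by
  classical
  rw [isBrauer_iff] at hb
  have hcard : (Finset.univ.filter fun a => a ∉ propTop w).card = k - m := by
    have := Finset.card_filter_add_card_filter_not (s := (Finset.univ : Finset (Fin k)))
      (fun a => a ∈ propTop w)
    rw [hw.card_propTop hb.1, Finset.card_univ, Fintype.card_fin] at this
    omega
  have hex : ∀ a : Fin k, a ∉ propTop w → ∃ b, w (Sum.inl a) (Sum.inl b) ∧ a ≠ b := by
    intro a ha
    obtain ⟨y, hy, hne⟩ := hb.2 (Sum.inl a)
    rcases y with b | b
    · exact ⟨b, hy, by simpa using hne⟩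
    · exact absurd ⟨b, hy⟩ ha
  choose! g hg hne using hex
  have hmem : ∀ a, a ∉ propTop w → g a ∉ propTop w := fun a ha h =>
    ha ((mem_propTop_congr (hg a ha)).2 h)
  have hsum := Finset.sum_involution (s := Finset.univ.filter fun a => a ∉ propTop w)
    (f := fun _ => (1 : ZMod 2)) (fun a _ => g a) (fun _ _ => by decide)
    (fun a ha _ => (hne a (by simpa using ha)).symm)
    (fun a ha => by simpa using hmem a (by simpa using ha))
    (fun a ha => by
      have ha : a ∉ propTop w := by simpa using ha
      have h := (isRookBrauer_iff w).1 hb.1 (Sum.inl (g a)) (Sum.inl (g (g a))) (Sum.inl a)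
        (hg _ (hmem a ha)) (Setoid.symm' w (hg a ha)) (by simpa using hne _ (hmem a ha))
        (by simpa using (hne a ha).symm)
      simpa using h)
  rw [Finset.sum_const, hcard, nsmul_one] at hsum
  exact (ZMod.natCast_eq_zero_iff_even).1 hsum

theorem isPlanar_halfDiagram (hf : IsTailLabel m f) (hmono : Monotone f)
    (hw : w.IsPlanar) : (halfDiagram w m f).IsPlanar := by
  rintro (x | x) (y | y) (z | z) (t | t) hxy hyz hzt hxz hyt <;>
    simp only [position, Sum.elim_inl, Sum.elim_inr] at hxy hyz hzt
  · exact halfDiagram_inl_inl.2 (hw _ _ (Sum.inl z) (Sum.inl t) hxy hyz hzt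
      (halfDiagram_inl_inl.1 hxz) (halfDiagram_inl_inl.1 hyt))
  · obtain ⟨⟨j, hj⟩, _⟩ := halfDiagram_inl_inr.1 hyt
    exact halfDiagram_inl_inl.2 (hw _ _ (Sum.inl z) (Sum.inr j) hxy hyz
      (by simp only [position, Sum.elim_inl, Sum.elim_inr]; omega)
      (halfDiagram_inl_inl.1 hxz) hj)
  · omega
  · -- the block joined to the strand `z` reaches further to the right than that of `t`
    obtain ⟨_, _, hz⟩ := halfDiagram_inl_inr.1 hxz
    obtain ⟨hy, _, ht⟩ := halfDiagram_inl_inr.1 hyt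
    obtain ⟨c, hc, hmax⟩ := exists_lt_of_topIndex_lt (a := x) hy (by omega)
    have hyc := hmax y (Setoid.refl' w _)
    obtain ⟨j, hj⟩ := hy
    exact halfDiagram_inl_inl.2 (hw _ _ (Sum.inl c) (Sum.inr j) hxy hyc
      (by simp only [position, Sum.elim_inl, Sum.elim_inr]; omega) hc hj)
  · omega
  · omega
  · omega
  · obtain ⟨_, hz, _⟩ := halfDiagram_inl_inr.1 hxz
    have := hf.eq_of_lt (a := t) (by omega) ((halfDiagram_inr_inr hf).1 hyt).symm
    omega
  · omega
  · omega
  · omega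
  · omega
  · omega
  · omega
  · omega
  · rw [halfDiagram_inr_inr hf] at hxz ⊢
    exact le_antisymm (hxz.trans_le (hmono (by omega))) (hmono (by omega))

theorem isSymmetricDiagram_labelTail (hf : IsTailLabel m f) (hm : m ≤ k) :
    (labelTail k m f).IsSymmetricDiagram m := by
  refine ⟨transpose_labelTail hf, (hasTail_labelTail hf).rank hf hm, ?_⟩
  rintro i ⟨j, hj⟩
  obtain ⟨rfl, _⟩ := (labelTail_inl_inr hf).1 hj
  exact hj

theorem HasTail.double_transpose {x : Diagram k} (hf : IsTailLabel m f) (hx : HasTail m f x)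
    (hm : m ≤ k) : double (transpose x) = labelTail k m f := by
  refine (isSymmetricDiagram_double _).ext (isSymmetricDiagram_labelTail hf hm) ?_ ?_
  · rw [topRel_double, topRel_transpose]
    exact Setoid.ext fun a b => (hx.bot a b).trans labelTail_inl_inl.symm
  · rw [propTop_double, propTop_transpose, ← transpose_labelTail hf, propTop_transpose]
    exact Set.ext fun j => (hx.prop j).trans ((hasTail_labelTail hf).prop j).symm

end HalfClosure

end Diagram

namespace DiagramFamily

open Diagram

open Classical in
/-- The labels of the tail diagram of a family: they pair the vertices after the first `m` in the
Brauer and Temperley-Lieb cases and separate all vertices otherwise. -/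
noncomputable def tailLabel (F : DiagramFamily) (m : ℕ) : ℕ → ℕ :=
  if F.Paired then fun a => if a < m then a else m + (a - m) / 2 else id

/-- The permutations of the strands that are available in a family. -/
def strandGroup (F : DiagramFamily) (m : ℕ) : Subgroup (Equiv.Perm (Fin m)) where
  carrier := {g | F.Planar → g = 1}
  mul_mem' ha hb h := by rw [ha h, hb h, one_mul]
  one_mem' _ := rfl
  inv_mem' ha h := by rw [ha h, inv_one]

theorem isTailLabel (F : DiagramFamily) (m : ℕ) : IsTailLabel m (F.tailLabel m) := by
  unfold tailLabel
  split_ifs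
  · exact ⟨fun a ha => if_pos ha, fun a ha => by rw [if_neg (not_lt.2 ha)]; omega⟩
  · exact ⟨fun _ _ => rfl, fun _ h => h⟩

theorem monotone_tailLabel (F : DiagramFamily) (m : ℕ) : Monotone (F.tailLabel m) := by
  unfold tailLabel
  split_ifs
  · intro a b hab
    dsimp only
    split_ifs <;> omega
  · exact monotone_id

theorem tailLabel_small (F : DiagramFamily) (m : ℕ) (i j l : ℕ)
    (h : F.tailLabel m i = F.tailLabel m j) (h' : F.tailLabel m i = F.tailLabel m l)
    (hij : i ≠ j) (hil : i ≠ l) : j = l := by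
  unfold tailLabel at h h'
  split_ifs at h h'
  · dsimp only at h h'
    split_ifs at h h' <;> omega
  · exact absurd h hij

variable {F : DiagramFamily} {k m : ℕ}

theorem mem_isPlanar {d : Diagram k} (hF : F.Planar) (hd : d ∈ F.diagrams k) : d.IsPlanar := by
  cases F <;> first | exact hF.elim | exact hd | exact hd.2

theorem strandPerm_mem (hm : m ≤ k) {g : Equiv.Perm (Fin m)} (hg : g ∈ F.strandGroup m) :
    strandPerm hm g ∈ F.diagrams k := by
  by_cases hF : F.Planar
  · rw [hg hF, strandPerm_one]
    exact F.one_mem k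
  · have h1 : (strandPerm hm g).IsPermutation := isPermutation_permDiagram _
    have h2 := (isPermutation_iff _).1 h1
    cases F <;> first
      | exact absurd trivial hF
      | exact trivial
      | exact h1
      | exact h2.1
      | exact h2.2
      | exact ((isBrauer_iff _).1 h2.2).1

theorem mem_strandGroup_of_comp_mem (hm : m ≤ k) {x : Diagram k}
    (hx : HasTail m (F.tailLabel m) x) (h : x ∈ F.diagrams k) {g : Equiv.Perm (Fin m)}
    (h' : comp x (strandPerm hm g) ∈ F.diagrams k) : g ∈ F.strandGroup m := fun hF =>
  hx.strandPerm_eq_one (F.isTailLabel m) hm (mem_isPlanar hF h) (mem_isPlanar hF h')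

/-- The half of a symmetric diagram of a family belongs to the family. -/
theorem halfDiagram_mem {w : Diagram k} (h : w ∈ F.diagrams k) (hw : w.IsSymmetricDiagram m) :
    halfDiagram w m (F.tailLabel m) ∈ F.diagrams k := by
  have hf := F.isTailLabel m
  have hm : m ≤ k := hw.2.1 ▸ rank_le w
  have h3 := F.tailLabel_small m
  have planar : w.IsPlanar → (halfDiagram w m (F.tailLabel m)).IsPlanar :=
    isPlanar_halfDiagram hf (F.monotone_tailLabel m)
  have rookBrauer := isRookBrauer_halfDiagram hf h3 hw
  have rook : ¬ F.Paired → w.IsRook → (halfDiagram w m (F.tailLabel m)).IsRook := by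
    intro hF
    refine isRook_halfDiagram hf ?_
    rw [tailLabel, if_neg hF]
    exact Function.injective_id
  have brauer : F.Paired → w.IsBrauer → (halfDiagram w m (F.tailLabel m)).IsBrauer := by
    intro hF hb
    refine isBrauer_halfDiagram hf h3 (fun i hi => ?_) hw hb hm
    obtain ⟨r, hr⟩ := hw.even_sub hb
    have := i.2
    -- the partner of `i` is its neighbour to the right or to the left
    rcases Nat.even_or_odd' ((i : ℕ) - m) with ⟨q, hq | hq⟩
    · refine ⟨⟨i + 1, by omega⟩, by simp [Fin.ext_iff], ?_⟩
      rw [tailLabel, if_pos hF]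
      dsimp only
      rw [if_neg (by omega), if_neg (by omega)]
      omega
    · refine ⟨⟨i - 1, by omega⟩, by simp [Fin.ext_iff]; omega, ?_⟩
      rw [tailLabel, if_pos hF]
      dsimp only
      rw [if_neg (by omega), if_neg (by omega)]
      omega
  have permutation : ¬ F.Paired → w.IsPermutation →
      (halfDiagram w m (F.tailLabel m)).IsPermutation := by
    intro hF hp
    have hp' := (isPermutation_iff w).1 hp
    have hmk : m = k := by
      classical
      rw [← hw.card_propTop ((isBrauer_iff w).1 hp'.2).1, Finset.filter_true_of_mem,
        Finset.card_univ, Fintype.card_fin]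
      intro a _
      exact (hp (Sum.inl a)).2.exists
    refine (isPermutation_iff _).2 ⟨rook hF hp'.1, isBrauer_halfDiagram hf h3 ?_ hw hp'.2 hm⟩
    intro i hi
    have := i.2
    omega
  cases F
  exacts [trivial, permutation id h, rook id h, brauer trivial h, rookBrauer h, planar h,
    ⟨permutation id h.1, planar h.2⟩, ⟨brauer trivial h.1, planar h.2⟩,
    ⟨rook id h.1, planar h.2⟩, ⟨rookBrauer h.1, planar h.2⟩]

theorem double_mem {d : Diagram k} (h : d ∈ F.diagrams k) : double d ∈ F.diagrams k :=
  F.comp_mem h (F.transpose_mem h)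

theorem labelTail_mem (hm : m ∈ F.ranks k) : labelTail k m (F.tailLabel m) ∈ F.diagrams k := by
  obtain ⟨d, hd, rfl⟩ := hm
  have hf := F.isTailLabel (rank d)
  rw [← (hasTail_halfDiagram hf (rank_double d)).double_transpose hf (rank_le d)]
  exact double_mem (F.transpose_mem (halfDiagram_mem (double_mem hd)
    (isSymmetricDiagram_double d)))

end DiagramFamily

/-! ### A criterion for simplicity -/

/-- In a semisimple module, a vector `e` generates a simple submodule as soon as some element of
the ring maps the whole submodule to the line of `e` and fixes that line. -/
theorem isSimpleModule_span_singleton {R M : Type*} [Ring R] [Algebra ℂ R] [AddCommGroup M]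
    [Module ℂ M] [Module R M] [IsScalarTower ℂ R M] [IsSemisimpleModule R M] {e : M} (he : e ≠ 0)
    {E : R} {c : ℂ} (hc : c ≠ 0) (hE : E • e = c • e) (h : ∀ a : R, ∃ z : ℂ, E • a • e = z • e) :
    IsSimpleModule R (Submodule.span R {e}) := by
  have hsmul : ∀ (N : Submodule R M) (z : ℂ), z ≠ 0 → z • e ∈ N → e ∈ N := by
    intro N z hz hze
    have h1 := N.smul_mem (algebraMap ℂ R z⁻¹) hze
    rwa [algebraMap_smul, smul_smul, inv_mul_cancel₀ hz, one_smul] at h1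
  rw [isSimpleModule_iff_isAtom]
  refine ⟨fun h0 => he (Submodule.span_singleton_eq_bot.1 h0), fun N hN => ?_⟩
  obtain ⟨N', hN'⟩ := exists_isCompl N
  have hmem : ∀ L : Submodule R M, e ∈ L → Submodule.span R {e} ≤ L := fun L hL =>
    (Submodule.span_singleton_le_iff_mem _ _).2 hL
  obtain ⟨u, hu, u', hu', huu⟩ := Submodule.mem_sup.1
    (hN'.sup_eq_top.symm ▸ Submodule.mem_top : e ∈ N ⊔ N')
  have heS : e ∈ Submodule.span R {e} := Submodule.mem_span_singleton_self e
  obtain ⟨a, ha⟩ := Submodule.mem_span_singleton.1 (hN.le hu)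
  have hu'S : u' ∈ Submodule.span R {e} := by
    rw [← add_sub_cancel_left u u', huu]
    exact Submodule.sub_mem _ heS (hN.le hu)
  obtain ⟨a', ha'⟩ := Submodule.mem_span_singleton.1 hu'S
  obtain ⟨z, hz⟩ := h a
  obtain ⟨z', hz'⟩ := h a'
  rw [ha] at hz
  rw [ha'] at hz'
  have hz0 : z = 0 := by
    by_contra hz0
    exact hN.not_ge (hmem N (hsmul N z hz0 (hz ▸ N.smul_mem E hu)))
  have hsum : (z + z') • e = c • e := by rw [add_smul, ← hz, ← hz', ← smul_add, huu, hE]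
  have hz'0 : z' ≠ 0 := by
    rintro rfl
    rw [hz0, add_zero, zero_smul] at hsum
    exact smul_ne_zero hc he hsum.symm
  have h2 := hmem N' (hsmul N' z' hz'0 (hz' ▸ N'.smul_mem E hu'))
  exact eq_bot_iff.2 (hN'.inf_eq_bot ▸ le_inf le_rfl (hN.le.trans h2))

/-! ### The group algebra of the strands in the partition algebra -/

namespace DiagramFamily

open Diagram PartitionAlgebra

section Strands

variable {F : DiagramFamily} {k m : ℕ} {n : ℂ} {f : ℕ → ℕ}

theorem loops_strandPerm (hm : m ≤ k) (d : Diagram k) (g : Equiv.Perm (Fin m)) :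
    loops d (strandPerm hm g) = 0 := loops_permDiagram _ _

/-- The group algebra of `S_m`, acting on the first `m` strands. -/
noncomputable def strandHom (n : ℂ) (hm : m ≤ k) :
    MonoidAlgebra ℂ (Equiv.Perm (Fin m)) →ₐ[ℂ] PartitionAlgebra k n :=
  MonoidAlgebra.lift ℂ _ _
    { toFun := fun g => ofDiagram n (strandPerm hm g)
      map_one' := by rw [strandPerm_one]; rfl
      map_mul' := fun g h => by
        rw [ofDiagram_mul, strandPerm_comp, loops_strandPerm, pow_zero,
          one_smul] }

theorem strandHom_single (hm : m ≤ k) (g : Equiv.Perm (Fin m)) :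
    strandHom n hm (MonoidAlgebra.single g 1) = ofDiagram n (strandPerm hm g) := by
  rw [strandHom, MonoidAlgebra.lift_single, one_smul]
  rfl

theorem strandHom_apply (hm : m ≤ k) (p : MonoidAlgebra ℂ (Equiv.Perm (Fin m))) :
    strandHom n hm p = ∑ g, p.coeff g • ofDiagram n (strandPerm hm g) := by
  conv_lhs => rw [← MonoidAlgebra.sum_coeff_smul_single p]
  simp only [map_sum, map_smul, strandHom_single]

theorem ofDiagram_mul_strandHom (hm : m ≤ k) (x : Diagram k)
    (p : MonoidAlgebra ℂ (Equiv.Perm (Fin m))) :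
    ofDiagram n x * strandHom n hm p
      = ∑ g, p.coeff g • ofDiagram n (comp x (strandPerm hm g)) := by
  rw [strandHom_apply, Finset.mul_sum]
  refine Finset.sum_congr rfl fun g _ => ?_
  rw [mul_smul_comm, ofDiagram_mul, loops_strandPerm, pow_zero, one_smul]

theorem loops_transpose (d₁ d₂ : Diagram k) :
    loops (transpose d₂) (transpose d₁) = loops d₁ d₂ := by
  rw [loops_eq_classCount, loops_eq_classCount, mid_transpose, propBot_transpose,
    propTop_transpose]
  congr 1
  ext i
  exact and_comm

theorem strandHom_mul_labelTail (hf : IsTailLabel m f) (hm : m ≤ k)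
    (p : MonoidAlgebra ℂ (Equiv.Perm (Fin m))) :
    strandHom n hm p * ofDiagram n (labelTail k m f)
      = ofDiagram n (labelTail k m f) * strandHom n hm p := by
  rw [ofDiagram_mul_strandHom, strandHom_apply, Finset.sum_mul]
  refine Finset.sum_congr rfl fun g _ => ?_
  rw [smul_mul_assoc, ofDiagram_mul, strandPerm_comp_labelTail hf,
    ← loops_transpose, transpose_strandPerm, loops_strandPerm, pow_zero, one_smul]

theorem coord_ofDiagram [DecidableEq (Diagram k)] (x d : Diagram k) :
    (basis k n).coord x (ofDiagram n d) = if d = x then 1 else 0 := by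
  rw [← basis_apply, Module.Basis.coord_apply, Module.Basis.repr_self, Finsupp.single_apply]

theorem ofDiagram_mem_algebra {d : Diagram k} (hd : d ∈ F.diagrams k) :
    ofDiagram n d ∈ F.algebra k n := (element n d hd).2

theorem algebra_induction {p : PartitionAlgebra k n → Prop} {a : PartitionAlgebra k n}
    (ha : a ∈ F.algebra k n) (h0 : p 0) (hadd : ∀ a b, p a → p b → p (a + b))
    (hsmul : ∀ (c : ℂ) a, p a → p (c • a)) (hd : ∀ d ∈ F.diagrams k, p (ofDiagram n d)) :
    p a := by
  change a ∈ Submodule.span ℂ _ at ha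
  induction ha using Submodule.span_induction with
  | mem x hx =>
    obtain ⟨d, h, rfl⟩ := hx
    exact hd d h
  | zero => exact h0
  | add a b _ _ ha hb => exact hadd a b ha hb
  | smul c a _ ha => exact hsmul c a ha

theorem ofDiagram_mem_rankSpan {d : Diagram k} (hd : d ∈ F.diagrams k) (hr : rank d < m) :
    ofDiagram n d ∈ F.rankSpan k n m := Submodule.subset_span ⟨d, hd, hr, rfl⟩

theorem mul_mem_rankSpan_left {a b : PartitionAlgebra k n} (ha : a ∈ F.algebra k n)
    (hb : b ∈ F.rankSpan k n m) : a * b ∈ F.rankSpan k n m :=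
  (F.rankIdeal k n m).smul_mem ⟨a, ha⟩ hb

theorem mul_mem_rankSpan_right {a b : PartitionAlgebra k n} (ha : a ∈ F.rankSpan k n m)
    (hb : b ∈ F.algebra k n) : a * b ∈ F.rankSpan k n m := by
  change a ∈ Submodule.span ℂ _ at ha
  change b ∈ Submodule.span ℂ _ at hb
  change a * b ∈ Submodule.span ℂ _
  induction ha, hb using Submodule.span_induction₂ with
  | mem_mem a b ha hb =>
    obtain ⟨d₁, h₁, hr, rfl⟩ := ha
    obtain ⟨d₂, h₂, rfl⟩ := hb
    rw [PartitionAlgebra.ofDiagram_mul]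
    exact Submodule.smul_mem _ _ (Submodule.subset_span
      ⟨_, F.comp_mem h₁ h₂, (Diagram.rank_comp_le_left d₁ d₂).trans_lt hr, rfl⟩)
  | zero_left b _ => rw [zero_mul]; exact Submodule.zero_mem _
  | zero_right a _ => rw [mul_zero]; exact Submodule.zero_mem _
  | add_left a b c _ _ _ h h' => rw [add_mul]; exact Submodule.add_mem _ h h'
  | add_right a b c _ _ _ h h' => rw [mul_add]; exact Submodule.add_mem _ h h'
  | smul_left r a b _ _ h => rw [smul_mul_assoc]; exact Submodule.smul_mem _ _ h
  | smul_right r a b _ _ h => rw [mul_smul_comm]; exact Submodule.smul_mem _ _ h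

theorem coord_eq_zero_of_mem_rankSpan {x : Diagram k} (hx : m ≤ rank x)
    {a : PartitionAlgebra k n} (ha : a ∈ F.rankSpan k n m) : (basis k n).coord x a = 0 := by
  classical
  change a ∈ Submodule.span ℂ _ at ha
  induction ha using Submodule.span_induction with
  | mem a ha =>
    obtain ⟨d, _, hd, rfl⟩ := ha
    rw [coord_ofDiagram, if_neg]
    rintro rfl
    omega
  | zero => exact map_zero _
  | add a b _ _ ha hb => rw [map_add, ha, hb, add_zero]
  | smul c a _ ha => rw [map_smul, ha, smul_zero]

/-- The coordinate at a diagram of rank at least `m`, on the quotient by the diagrams of rank less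
than `m`. -/
noncomputable def quotientCoord (F : DiagramFamily) (n : ℂ) {x : Diagram k} (hx : m ≤ rank x) :
    (PartitionAlgebra k n ⧸ F.rankIdeal k n m) →ₗ[ℂ] ℂ :=
  (((F.rankIdeal k n m).restrictScalars ℂ).liftQ ((basis k n).coord x)
    fun _ ha => coord_eq_zero_of_mem_rankSpan hx ha) ∘ₗ
    (Submodule.Quotient.restrictScalarsEquiv ℂ (F.rankIdeal k n m)).symm.toLinearMap

/-- The data that enter the construction of the irreducible modules: `p` is, up to a scalar, an
idempotent of the group algebra of the strands whose corner is one-dimensional. -/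
structure IsMinimalSymmetrizer (F : DiagramFamily) (p : MonoidAlgebra ℂ (Equiv.Perm (Fin m)))
    (c : ℂ) : Prop where
  ne_zero : c ≠ 0
  mul_self : p * p = c • p
  coeff_one : p.coeff 1 = 1
  coeff_eq_zero : ∀ g, g ∉ F.strandGroup m → p.coeff g = 0
  corner : ∀ g ∈ F.strandGroup m, ∃ z : ℂ, p * MonoidAlgebra.single g 1 * p = z • p

theorem strandHom_mem_algebra (hm : m ≤ k) {p : MonoidAlgebra ℂ (Equiv.Perm (Fin m))}
    (hp : ∀ g, g ∉ F.strandGroup m → p.coeff g = 0) : strandHom n hm p ∈ F.algebra k n := by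
  rw [strandHom_apply]
  refine Subalgebra.sum_mem _ fun g _ => ?_
  by_cases hg : g ∈ F.strandGroup m
  · exact Subalgebra.smul_mem _ (ofDiagram_mem_algebra (strandPerm_mem hm hg)) _
  · rw [hp g hg, zero_smul]
    exact Subalgebra.zero_mem _

/-- The generator of the irreducible module, up to a scalar. -/
noncomputable def generator (F : DiagramFamily) (n : ℂ) (hm : m ≤ k)
    (p : MonoidAlgebra ℂ (Equiv.Perm (Fin m))) : PartitionAlgebra k n :=
  ofDiagram n (labelTail k m (F.tailLabel m)) * strandHom n hm p

section Generator

variable {p : MonoidAlgebra ℂ (Equiv.Perm (Fin m))} {c : ℂ}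

theorem generator_mem_algebra (hm : m ≤ k) (hr : m ∈ F.ranks k) (hp : IsMinimalSymmetrizer F p c) :
    generator F n hm p ∈ F.algebra k n :=
  Subalgebra.mul_mem _ (ofDiagram_mem_algebra (labelTail_mem hr))
    (strandHom_mem_algebra hm hp.coeff_eq_zero)

theorem ofDiagram_mul_generator (hm : m ≤ k) {x : Diagram k}
    (hx : HasTail m (F.tailLabel m) x) (p : MonoidAlgebra ℂ (Equiv.Perm (Fin m))) :
    ofDiagram n x * generator F n hm p
      = n ^ loops (labelTail k m (F.tailLabel m)) (labelTail k m (F.tailLabel m))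
        • (ofDiagram n x * strandHom n hm p) := by
  rw [generator, ← mul_assoc, ofDiagram_mul, hx.comp_labelTail (F.isTailLabel m),
    hx.loops_labelTail (F.isTailLabel m), smul_mul_assoc]

theorem generator_mul_self (hm : m ≤ k) (hp : IsMinimalSymmetrizer F p c) :
    generator F n hm p * generator F n hm p
      = (n ^ loops (labelTail k m (F.tailLabel m)) (labelTail k m (F.tailLabel m)) * c)
        • generator F n hm p := by
  have hf := F.isTailLabel m
  conv_lhs => lhs; rw [generator, ← strandHom_mul_labelTail hf]
  rw [mul_assoc, ofDiagram_mul_generator hm (hasTail_labelTail hf), mul_smul_comm, ← mul_assoc,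
    strandHom_mul_labelTail hf, mul_assoc, ← map_mul, hp.mul_self, map_smul, mul_smul_comm,
    smul_smul, generator]

theorem generator_notMem (hm : m ≤ k) (hp : IsMinimalSymmetrizer F p c) :
    generator F n hm p ∉ F.rankSpan k n m := by
  classical
  intro h
  have hf := F.isTailLabel m
  have ht := hasTail_labelTail (k := k) hf
  have h0 := coord_eq_zero_of_mem_rankSpan (x := labelTail k m (F.tailLabel m))
    (ht.rank hf hm).ge h
  rw [generator, ofDiagram_mul_strandHom, map_sum, Finset.sum_eq_single 1] at h0
  · rw [map_smul, coord_ofDiagram, strandPerm_one, comp_one, if_pos rfl, hp.coeff_one] at h0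
    simp at h0
  · intro g _ hg
    rw [map_smul, coord_ofDiagram, if_neg, smul_zero]
    intro hgt
    refine hg (ht.strandPerm_injective hf hm (hgt.trans ?_))
    dsimp only
    rw [strandPerm_one, comp_one]
  · exact fun h => absurd (Finset.mem_univ _) h

/-- Modulo diagrams of smaller rank, `t ∘ d ∘ t` is a permutation of the strands of the tail
diagram `t`; hence the corner of the generator is one-dimensional. -/
theorem exists_generator_mul_mul (hm : m ≤ k) (hr : m ∈ F.ranks k)
    (hp : IsMinimalSymmetrizer F p c) {a : PartitionAlgebra k n} (ha : a ∈ F.algebra k n) :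
    ∃ z : ℂ, generator F n hm p * (a * generator F n hm p) - z • generator F n hm p
      ∈ F.rankSpan k n m := by
  have hf := F.isTailLabel m
  have ht := hasTail_labelTail (k := k) hf
  have hsym := isSymmetricDiagram_labelTail hf hm
  have hp' := strandHom_mem_algebra (n := n) hm hp.coeff_eq_zero
  refine algebra_induction (p := fun a => ∃ z : ℂ, generator F n hm p * (a * generator F n hm p)
    - z • generator F n hm p ∈ F.rankSpan k n m) ha ⟨0, ?_⟩ ?_ ?_ ?_
  · rw [zero_mul, mul_zero, zero_smul, sub_zero]
    exact Submodule.zero_mem _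
  · rintro a b ⟨z, hz⟩ ⟨z', hz'⟩
    refine ⟨z + z', ?_⟩
    rw [add_mul, mul_add, add_smul, add_sub_add_comm]
    exact Submodule.add_mem _ hz hz'
  · rintro r a ⟨z, hz⟩
    refine ⟨r * z, ?_⟩
    rw [smul_mul_assoc, mul_smul_comm, mul_smul, ← smul_sub]
    exact Submodule.smul_mem _ _ hz
  · intro d hd
    set t := labelTail k m (F.tailLabel m) with htdef
    have htF : t ∈ F.diagrams k := labelTail_mem hr
    set y := comp t (comp d t) with hy
    have hyF : y ∈ F.diagrams k := F.comp_mem htF (F.comp_mem hd htF)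
    obtain ⟨s, hs⟩ : ∃ s : ℂ, generator F n hm p * (ofDiagram n d * generator F n hm p)
        = s • (strandHom n hm p * ofDiagram n y * strandHom n hm p) := by
      refine ⟨n ^ loops d t * n ^ loops t (comp d t), ?_⟩
      rw [generator, ← htdef]
      conv_lhs => lhs; rw [← strandHom_mul_labelTail hf]
      rw [← mul_assoc (ofDiagram n d), ofDiagram_mul, smul_mul_assoc, mul_smul_comm, mul_assoc,
        ← mul_assoc (ofDiagram n t), ofDiagram_mul, smul_mul_assoc, mul_smul_comm, smul_smul,
        mul_assoc]
    rw [hs]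
    by_cases hyr : rank y < m
    · refine ⟨0, ?_⟩
      rw [zero_smul, sub_zero]
      exact Submodule.smul_mem _ _ (mul_mem_rankSpan_right
        (mul_mem_rankSpan_left hp' (ofDiagram_mem_rankSpan hyF hyr)) hp')
    · have hle : rank y ≤ m := (rank_comp_le_left _ _).trans_eq (ht.rank hf hm)
      have hyr' : rank y = m := le_antisymm hle (not_lt.1 hyr)
      have hty : HasTail m (F.tailLabel m) y := by
        rw [hy, ← comp_assoc] at hyr' ⊢
        exact hasTail_of_rank_comp hf hm hyr'
      have hty' : HasTail m (F.tailLabel m) (transpose y) := by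
        have e : transpose y = comp (comp t (transpose d)) t := by
          rw [hy, transpose_comp, transpose_comp, htdef, transpose_labelTail hf]
        rw [← rank_transpose, e] at hyr'
        rw [e]
        exact hasTail_of_rank_comp hf hm hyr'
      obtain ⟨g, hg⟩ := ht.exists_strandPerm hf hty hm
        (Setoid.ext fun a b => labelTail_inl_inl.trans (hty'.bot a b).symm)
        (by
          rw [← propBot_transpose y, ← propBot_transpose t, hsym.1]
          exact Set.ext fun j => (ht.prop j).trans (hty'.prop j).symm)
      have hgH : g ∈ F.strandGroup m :=
        mem_strandGroup_of_comp_mem hm ht htF (hg ▸ hyF)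
      obtain ⟨z, hz⟩ := hp.corner g hgH
      refine ⟨s * z, ?_⟩
      have e : ofDiagram n y = ofDiagram n t * strandHom n hm (MonoidAlgebra.single g 1) := by
        rw [strandHom_single, ofDiagram_mul, loops_strandPerm, pow_zero, one_smul,
          hg]
      rw [e, ← mul_assoc, strandHom_mul_labelTail hf, mul_assoc, mul_assoc, ← map_mul, ← map_mul,
        ← mul_assoc, hz, map_smul, mul_smul_comm, smul_smul, ← generator, sub_self]
      exact Submodule.zero_mem _

open Classical in
/-- The diagrams of the family with the prescribed bottom half; they form a basis of the left
ideal generated by the tail diagram, modulo diagrams of smaller rank. -/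
noncomputable def halves (F : DiagramFamily) (k m : ℕ) : Finset (Diagram k) :=
  Finset.univ.filter fun x => x ∈ F.diagrams k ∧ HasTail m (F.tailLabel m) x

theorem mem_halves {x : Diagram k} :
    x ∈ halves F k m ↔ x ∈ F.diagrams k ∧ HasTail m (F.tailLabel m) x := by
  simp [halves]

theorem rank_of_mem_halves (hm : m ≤ k) {x : Diagram k} (hx : x ∈ halves F k m) : rank x = m :=
  (mem_halves.1 hx).2.rank (F.isTailLabel m) hm

/-- The elements of the left ideal of the generator are, modulo diagrams of smaller rank,
combinations of the diagrams with the prescribed bottom half. -/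
theorem mul_generator_sub_mem (hm : m ≤ k) (hr : m ∈ F.ranks k)
    (hp : IsMinimalSymmetrizer F p c) {a : PartitionAlgebra k n} (ha : a ∈ F.algebra k n) :
    a * generator F n hm p
      - ∑ x ∈ halves F k m, (basis k n).coord x (a * generator F n hm p) • ofDiagram n x
      ∈ F.rankSpan k n m := by
  classical
  have hf := F.isTailLabel m
  have ht := hasTail_labelTail (k := k) hf
  let Q : PartitionAlgebra k n →ₗ[ℂ] PartitionAlgebra k n :=
    LinearMap.id - ∑ x ∈ halves F k m, ((basis k n).coord x).smulRight (ofDiagram n x)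
  have hQ : ∀ b, Q b = b - ∑ x ∈ halves F k m, (basis k n).coord x b • ofDiagram n x := by
    intro b
    simp [Q]
  rw [← hQ]
  refine algebra_induction (p := fun a => Q (a * generator F n hm p) ∈ F.rankSpan k n m) ha
    ?_ ?_ ?_ ?_
  · rw [zero_mul, map_zero]
    exact Submodule.zero_mem _
  · intro a b h h'
    rw [add_mul, map_add]
    exact Submodule.add_mem _ h h'
  · intro r a h
    rw [smul_mul_assoc, map_smul]
    exact Submodule.smul_mem _ _ h
  · intro d hd
    rw [generator, ofDiagram_mul_strandHom, Finset.mul_sum, map_sum]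
    refine Submodule.sum_mem _ fun g _ => ?_
    by_cases hg : g ∈ F.strandGroup m
    · rw [mul_smul_comm, ofDiagram_mul, map_smul, map_smul]
      refine Submodule.smul_mem _ _ (Submodule.smul_mem _ _ ?_)
      set x := comp d (comp (labelTail k m (F.tailLabel m)) (strandPerm hm g)) with hx
      have htg := ht.comp_strandPerm hf hm g
      have hxF : x ∈ F.diagrams k :=
        F.comp_mem hd (F.comp_mem (labelTail_mem hr) (strandPerm_mem hm hg))
      have hle : rank x ≤ m := (rank_comp_le _ _).trans_eq (htg.rank hf hm)
      rw [hQ]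
      rcases hle.lt_or_eq with hlt | heq
      · rw [Finset.sum_eq_zero, sub_zero]
        · exact ofDiagram_mem_rankSpan hxF hlt
        · intro y hy
          rw [coord_ofDiagram, if_neg, zero_smul]
          rintro rfl
          rw [rank_of_mem_halves hm hy] at hlt
          exact lt_irrefl _ hlt
      · rw [Finset.sum_eq_single x]
        · rw [coord_ofDiagram, if_pos rfl, one_smul, sub_self]
          exact Submodule.zero_mem _
        · intro y _ hyx
          rw [coord_ofDiagram, if_neg hyx.symm, zero_smul]
        · exact fun h => absurd (mem_halves.2 ⟨hxF, htg.comp_left hf hm heq⟩) h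
    · rw [hp.coeff_eq_zero g hg, zero_smul, mul_zero, map_zero]
      exact Submodule.zero_mem _

/-- The module generated by the generator in the quotient by the diagrams of smaller rank. -/
noncomputable def halfModule (F : DiagramFamily) (n : ℂ) (hm : m ≤ k)
    (p : MonoidAlgebra ℂ (Equiv.Perm (Fin m))) :
    Submodule (F.algebra k n) (PartitionAlgebra k n ⧸ F.rankIdeal k n m) :=
  Submodule.span _ {(F.rankIdeal k n m).mkQ (generator F n hm p)}

theorem isSimpleModule_halfModule {N : ℕ} (hN : 2 * k ≤ N) (hm : m ≤ k) (hr : m ∈ F.ranks k)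
    (hp : IsMinimalSymmetrizer F p c) (hs : (N : ℂ) ^ loops (labelTail k m (F.tailLabel m))
      (labelTail k m (F.tailLabel m)) ≠ 0) :
    IsSimpleModule (F.algebra k (N : ℂ)) (halfModule F (N : ℂ) hm p) := by
  have := F.isSemisimpleModule hN
  have hE := generator_mem_algebra (n := (N : ℂ)) hm hr hp
  refine isSimpleModule_span_singleton (E := ⟨_, hE⟩) (c := (N : ℂ) ^ loops
    (labelTail k m (F.tailLabel m)) (labelTail k m (F.tailLabel m)) * c) ?_
    (mul_ne_zero hs hp.ne_zero) ?_ ?_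
  · intro h
    exact generator_notMem hm hp ((Submodule.Quotient.mk_eq_zero _).1 h)
  · exact congrArg (F.rankIdeal k (N : ℂ) m).mkQ (generator_mul_self hm hp)
  · rintro ⟨a, ha⟩
    obtain ⟨z, hz⟩ := exists_generator_mul_mul hm hr hp ha
    exact ⟨z, (Submodule.Quotient.eq _).2 hz⟩

open Classical in
/-- The character of the module, as a sum over the diagrams with the prescribed bottom half. -/
theorem moduleCharacter_halfModule (hm : m ≤ k) (hr : m ∈ F.ranks k)
    (hp : IsMinimalSymmetrizer F p c) (hs : n ^ loops (labelTail k m (F.tailLabel m))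
      (labelTail k m (F.tailLabel m)) ≠ 0) {d : Diagram k} (hd : d ∈ F.diagrams k) :
    moduleCharacter (halfModule F n hm p) (element n d hd)
      = ∑ x ∈ halves F k m, n ^ loops d x * ∑ g, c⁻¹ * p.coeff g *
          if comp (comp d x) (strandPerm hm g) = x then 1 else 0 := by
  set S := n ^ loops (labelTail k m (F.tailLabel m)) (labelTail k m (F.tailLabel m)) with hS
  set J := F.rankIdeal k n m with hJ
  set e := generator F n hm p with he
  have heA : e ∈ F.algebra k n := generator_mem_algebra hm hr hp
  have hee : e * ((S * c)⁻¹ • e) = e := by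
    rw [mul_smul_comm, generator_mul_self hm hp, smul_smul,
      inv_mul_cancel₀ (mul_ne_zero hs hp.ne_zero), one_smul]
  have hrank : ∀ x : halves F k m, m ≤ rank x.1 := fun x => (rank_of_mem_halves hm x.2).ge
  let ι : halfModule F n hm p →ₗ[ℂ] halves F k m → ℂ := LinearMap.pi fun x =>
    quotientCoord F n (hrank x) ∘ₗ ((halfModule F n hm p).restrictScalars ℂ).subtype
  let v : halves F k m → halfModule F n hm p := fun x =>
    ⟨J.mkQ (ofDiagram n x.1 * ((S * c)⁻¹ • e)), by
      rw [mul_smul_comm, ← smul_mul_assoc]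
      exact Submodule.smul_mem _ (⟨(S * c)⁻¹ • ofDiagram n x.1, Subalgebra.smul_mem _
        (ofDiagram_mem_algebra (mem_halves.1 x.2).1) _⟩ : F.algebra k n)
        (Submodule.mem_span_singleton_self _)⟩
  have hv : ∀ u, ∑ x, ι u x • v x = u := by
    rintro ⟨u, hu⟩
    refine Subtype.ext ?_
    obtain ⟨⟨a, ha⟩, rfl⟩ := Submodule.mem_span_singleton.1 hu
    rw [Submodule.coe_sum]
    have e1 : ∀ x : halves F k m, ((ι ⟨_, hu⟩ x • v x : halfModule F n hm p) : _ ⧸ J)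
        = J.mkQ ((basis k n).coord x.1 (a * e) • (ofDiagram n x.1 * ((S * c)⁻¹ • e))) :=
      fun _ => rfl
    simp only [e1]
    rw [← map_sum, Finset.sum_coe_sort (halves F k m)
      fun x => (basis k n).coord x (a * e) • (ofDiagram n x * ((S * c)⁻¹ • e))]
    refine (Submodule.Quotient.eq _).2 ?_
    rw [← neg_mem_iff, neg_sub]
    have h1 := mul_mem_rankSpan_right (mul_generator_sub_mem hm hr hp ha)
      (Subalgebra.smul_mem _ heA (S * c)⁻¹)
    rw [sub_mul, ← he, mul_assoc, hee, Finset.sum_mul] at h1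
    simp only [smul_mul_assoc] at h1
    exact h1
  rw [moduleCharacter, trace_eq_sum_of_reproducing _ ι v hv, ← Finset.sum_coe_sort (halves F k m)]
  refine Finset.sum_congr rfl fun x _ => ?_
  change (basis k n).coord x.1 (ofDiagram n d * (ofDiagram n x.1 * ((S * c)⁻¹ • e))) = _
  rw [mul_smul_comm, he, ofDiagram_mul_generator hm (mem_halves.1 x.2).2, ← hS, smul_smul,
    mul_inv_rev, mul_assoc, inv_mul_cancel₀ hs, mul_one, mul_smul_comm, ← mul_assoc,
    ofDiagram_mul, smul_mul_assoc, ofDiagram_mul_strandHom, map_smul, map_smul, map_sum,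
    smul_eq_mul, smul_eq_mul, mul_left_comm, Finset.mul_sum]
  refine congrArg _ (Finset.sum_congr rfl fun g _ => ?_)
  rw [map_smul, coord_ofDiagram, smul_eq_mul, mul_assoc]

/-- Left multiplication by `d` moves the half of a fixed symmetric diagram by the twist. -/
theorem comp_halfDiagram (F : DiagramFamily) (hm : m ≤ k) {d w : Diagram k}
    (hws : w.IsSymmetricDiagram m) (hwc : conj d w = w) :
    comp d (halfDiagram w m (F.tailLabel m))
      = comp (halfDiagram w m (F.tailLabel m)) (strandPerm hm (twist m d w)) := by
  have hf := F.isTailLabel m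
  set h := halfDiagram w m (F.tailLabel m) with hh
  have hht : HasTail m (F.tailLabel m) h := hasTail_halfDiagram hf hws.2.1
  have hhd : double h = w := double_halfDiagram hws hm
  have hdh : double (comp d h) = w := by rw [← conj_double, hhd, hwc]
  have hdt : HasTail m (F.tailLabel m) (comp d h) :=
    hht.comp_left hf hm (by rw [← rank_double, hdh, hws.2.1])
  obtain ⟨e1, e2⟩ := double_eq_iff.1 (hhd.trans hdh.symm)
  obtain ⟨σ, hσ⟩ := hht.exists_strandPerm hf hdt hm e1 e2
  rw [hσ, twist_eq hws hm hwc hσ]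

theorem twist_mem_strandGroup (hm : m ≤ k) {d w : Diagram k} (hd : d ∈ F.diagrams k)
    (hw : w ∈ F.fixedDiagrams m d) : twist m d w ∈ F.strandGroup m := by
  obtain ⟨hwF, hws, hwc⟩ : w ∈ F.diagrams k ∧ w.IsSymmetricDiagram m ∧ conj d w = w := by
    simpa [fixedDiagrams] using hw
  have hhF : halfDiagram w m (F.tailLabel m) ∈ F.diagrams k := halfDiagram_mem hwF hws
  exact mem_strandGroup_of_comp_mem hm (hasTail_halfDiagram (F.isTailLabel m) hws.2.1) hhF
    (comp_halfDiagram F hm hws hwc ▸ F.comp_mem hd hhF)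

/-- The halves lying over a symmetric diagram form a torsor under the group of the strands, on
which `d` acts through its twist. -/
theorem sum_halves_eq_sum_fixedDiagrams (hm : m ≤ k) (d : Diagram k)
    (q : Equiv.Perm (Fin m) → ℂ) [DecidableEq (Diagram k)]
    [DecidablePred fun τ => τ ∈ F.strandGroup m] :
    ∑ x ∈ halves F k m, n ^ loops d x * ∑ g, q g *
        (if comp (comp d x) (strandPerm hm g) = x then 1 else 0)
      = ∑ w ∈ F.fixedDiagrams m d, n ^ loops d w *
        ∑ τ with τ ∈ F.strandGroup m, q ((twist m d w * τ)⁻¹ * τ) := by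
  have hf := F.isTailLabel m
  have hfix : ∀ w, w ∈ F.fixedDiagrams m d ↔
      w ∈ F.diagrams k ∧ w.IsSymmetricDiagram m ∧ conj d w = w := fun w => by
    simp [fixedDiagrams]
  -- a half contributes only if its symmetric diagram is fixed
  have hsub : ∑ x ∈ halves F k m with double x ∈ F.fixedDiagrams m d,
      n ^ loops d x * ∑ g, q g * (if comp (comp d x) (strandPerm hm g) = x then 1 else 0)
      = ∑ x ∈ halves F k m, n ^ loops d x * ∑ g, q g *
        (if comp (comp d x) (strandPerm hm g) = x then 1 else 0) := by
    refine Finset.sum_subset (Finset.filter_subset _ _) fun x hx hx' => ?_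
    have hxF := mem_halves.1 hx
    rw [Finset.sum_eq_zero, mul_zero]
    intro g _
    rw [if_neg, mul_zero]
    intro h
    refine hx' (Finset.mem_filter.2 ⟨hx, (hfix _).2 ⟨double_mem hxF.1, ?_, ?_⟩⟩)
    · rw [← rank_of_mem_halves hm hx]
      exact isSymmetricDiagram_double x
    · rw [conj_double]
      conv_rhs => rw [← h, double_comp_strandPerm]
  rw [← hsub, ← Finset.sum_fiberwise_of_maps_to (t := F.fixedDiagrams m d) (g := double)
    fun x hx => (Finset.mem_filter.1 hx).2]
  refine Finset.sum_congr rfl fun w hw => ?_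
  obtain ⟨hwF, hws, hwc⟩ := (hfix w).1 hw
  set h := halfDiagram w m (F.tailLabel m) with hh
  have hhF : h ∈ F.diagrams k := halfDiagram_mem hwF hws
  have hht : HasTail m (F.tailLabel m) h := hasTail_halfDiagram hf hws.2.1
  have hhd : double h = w := double_halfDiagram hws hm
  have hσ := comp_halfDiagram F hm hws hwc
  rw [← hh] at hσ
  set σ := twist m d w with hσdef
  rw [Finset.mul_sum, Finset.filter_filter]
  symm
  refine Finset.sum_nbij (fun τ => comp h (strandPerm hm τ)) ?_ ?_ ?_ ?_
  · intro τ hτ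
    have hτ : τ ∈ F.strandGroup m := (Finset.mem_filter.1 hτ).2
    have hdw : double (comp h (strandPerm hm τ)) = w := by rw [double_comp_strandPerm, hhd]
    refine Finset.mem_filter.2 ⟨mem_halves.2 ⟨F.comp_mem hhF (strandPerm_mem hm hτ),
      hht.comp_strandPerm hf hm τ⟩, ?_, hdw⟩
    rwa [hdw]
  · exact (hht.strandPerm_injective hf hm).injOn
  · intro x hx
    obtain ⟨hx, _, hxw⟩ := Finset.mem_filter.1 hx
    obtain ⟨hxF, hxt⟩ := mem_halves.1 hx
    obtain ⟨e1, e2⟩ := double_eq_iff.1 (hhd.trans hxw.symm)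
    obtain ⟨τ, rfl⟩ := hht.exists_strandPerm hf hxt hm e1 e2
    exact ⟨τ, Finset.mem_coe.2 (Finset.mem_filter.2 ⟨Finset.mem_univ _,
      mem_strandGroup_of_comp_mem hm hht hhF hxF⟩), rfl⟩
  · intro τ _
    have hl : loops d w = loops d (comp h (strandPerm hm τ)) := by
      obtain ⟨e1, e2⟩ := double_eq_iff.1 (double_comp_strandPerm h hm τ)
      rw [loops_congr_right d e1 e2, ← hhd,
        loops_congr_right d (topRel_double h) (propTop_double h)]
    rw [← hl]
    congr 1
    have hiff : ∀ g, comp (comp d (comp h (strandPerm hm τ))) (strandPerm hm g)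
        = comp h (strandPerm hm τ) ↔ g = (σ * τ)⁻¹ * τ := by
      intro g
      rw [← comp_assoc d, hσ, comp_assoc, comp_assoc, strandPerm_comp, strandPerm_comp,
        (hht.strandPerm_injective hf hm).eq_iff, eq_inv_mul_iff_mul_eq, mul_assoc]
    simp only [hiff, mul_ite, mul_one, mul_zero, Finset.sum_ite_eq', Finset.mem_univ, if_true]

end Generator

end Strands

end DiagramFamily

/-! ### The irreducible modules and their characters -/

namespace DiagramFamily

open Diagram PartitionAlgebra

open Classical in
/-- The Young symmetrizer of a label or, for the planar families, the identity. -/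
noncomputable def symmetrizer (F : DiagramFamily) (μ : YoungDiagram) :
    MonoidAlgebra ℂ (Equiv.Perm (Fin μ.card)) :=
  if F.Planar then 1 else μ.groupSymmetrizer

theorem exists_isMinimalSymmetrizer (F : DiagramFamily) (μ : YoungDiagram) :
    ∃ c, IsMinimalSymmetrizer F (F.symmetrizer μ) c := by
  classical
  by_cases hF : F.Planar
  · refine ⟨1, one_ne_zero, ?_, ?_, fun g hg => ?_, fun g hg => ⟨1, ?_⟩⟩
    · rw [symmetrizer, if_pos hF, one_mul, one_smul]
    · rw [symmetrizer, if_pos hF, MonoidAlgebra.one_def, MonoidAlgebra.coeff_single,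
        Finsupp.single_eq_same]
    · rw [symmetrizer, if_pos hF, MonoidAlgebra.one_def, MonoidAlgebra.coeff_single,
        Finsupp.single_apply, if_neg]
      rintro rfl
      exact hg (Subgroup.one_mem _)
    · rw [symmetrizer, if_pos hF, hg hF, one_mul, mul_one, one_smul]
      rfl
  · obtain ⟨c, hc, hcc⟩ := μ.groupSymmetrizer_mul_self
    rw [symmetrizer, if_neg hF]
    exact ⟨c, hc, hcc, μ.coeff_groupSymmetrizer_one, fun g hg => absurd (fun h => absurd h hF) hg,
      fun g _ => ⟨_, YoungDiagram.groupSymmetrizer_mul_mul _⟩⟩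

/-- A character value of the symmetric group in terms of the symmetrizer. In the planar case the
label has one row and the twist is trivial. -/
theorem symmetricCharacter_eq_symmetrizer {F : DiagramFamily} {μ : YoungDiagram} {c : ℂ}
    (hc : IsMinimalSymmetrizer F (F.symmetrizer μ) c)
    (hμ : F.Planar → ∀ x ∈ μ.cells, x.1 = 0) {σ : Equiv.Perm (Fin μ.card)}
    (hσ : σ ∈ F.strandGroup μ.card) [DecidablePred fun τ => τ ∈ F.strandGroup μ.card] :
    ∑ τ with τ ∈ F.strandGroup μ.card, c⁻¹ * (F.symmetrizer μ).coeff ((σ * τ)⁻¹ * τ)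
      = μ.symmetricCharacter σ := by
  by_cases hF : F.Planar
  · have hc1 : c = 1 := by
      have := congrArg (fun z => z.coeff 1) hc.mul_self
      rw [symmetrizer, if_pos hF] at this
      simpa [MonoidAlgebra.one_def] using this.symm
    rw [YoungDiagram.symmetricCharacter_eq_one (hμ hF), hσ hF, Finset.sum_eq_single 1]
    · rw [mul_one, mul_one, inv_one, hc.coeff_one, hc1, inv_one, mul_one]
    · intro τ hτ h1
      exact absurd ((Finset.mem_filter.1 hτ).2 hF) h1
    · exact fun h => absurd (Finset.mem_filter.2 ⟨Finset.mem_univ _, Subgroup.one_mem _⟩) h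
  · have hp : F.symmetrizer μ = μ.groupSymmetrizer := if_neg hF
    rw [YoungDiagram.symmetricCharacter_eq_sum hc.ne_zero (hp ▸ hc.mul_self), hp,
      Finset.filter_true_of_mem fun τ _ h => absurd h hF]

theorem labelElement_eq_smul_generator (F : DiagramFamily) {k : ℕ} {n : ℂ}
    (hn : n ≠ 0 ∨ k = 0) {lam : YoungDiagram} (hm : lam.removeFirstRow.card ≤ k) :
    ∃ a : ℂ, a ≠ 0 ∧ F.labelElement k n lam
      = a • generator F n hm (F.symmetrizer lam.removeFirstRow) := by
  generalize hμ : lam.removeFirstRow = μ at hm ⊢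
  have hpow : ∀ r ≤ k, n ^ r ≠ 0 := by
    intro r hr
    rcases hn with hn | hn
    · exact pow_ne_zero _ hn
    · rw [hn, Nat.le_zero] at hr
      rw [hr, pow_zero]
      exact one_ne_zero
  have h1 : F.labelSymmetrizer k n μ = strandHom n hm (F.symmetrizer μ) := by
    rw [labelSymmetrizer, symmetrizer]
    split_ifs
    · rw [map_one]
    · simp only [YoungDiagram.groupSymmetrizer, YoungDiagram.youngSymmetrizer, map_sum, map_smul,
        strandHom_single, ofPerm_extendDomain hm]
  have h2 : ∃ a : ℂ, a ≠ 0 ∧ F.tailIdempotent k n μ.card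
      = a • ofDiagram n (labelTail k μ.card (F.tailLabel μ.card)) := by
    rw [tailIdempotent, tailLabel]
    split_ifs
    · exact ⟨_, inv_ne_zero (hpow _ (by omega)), rfl⟩
    · exact ⟨_, inv_ne_zero (hpow _ (by omega)), rfl⟩
  obtain ⟨a, ha, h2⟩ := h2
  refine ⟨a, ha, ?_⟩
  subst hμ
  rw [labelElement, h1, h2, mul_smul_comm, strandHom_mul_labelTail (F.isTailLabel _),
    generator]

theorem irreducibleModule_eq_halfModule (F : DiagramFamily) {k : ℕ} {n : ℂ}
    (hn : n ≠ 0 ∨ k = 0) {lam : YoungDiagram} (hm : lam.removeFirstRow.card ≤ k) :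
    F.irreducibleModule k n lam = halfModule F n hm (F.symmetrizer lam.removeFirstRow) := by
  obtain ⟨a, ha, h⟩ := F.labelElement_eq_smul_generator hn hm
  have h1 : IsUnit (algebraMap ℂ (F.algebra k n) a) := (IsUnit.mk0 a ha).map _
  rw [irreducibleModule, Submodule.map_span, Set.image_singleton, halfModule, h,
    ← algebraMap_smul (F.algebra k n) a, map_smul, Submodule.span_singleton_smul_eq h1]

end DiagramFamily

theorem mainTheorem5 (F : DiagramFamily) (k n : ℕ) (hn : 2 * k ≤ n) (lam : YoungDiagram)
    (hlam : lam ∈ F.shiftedLabels k n) (d : Diagram k) (hd : d ∈ F.diagrams k) :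
    IsSimpleModule (F.algebra k (n : ℂ)) (F.irreducibleModule k (n : ℂ) lam) ∧
      moduleCharacter (F.irreducibleModule k (n : ℂ) lam) (DiagramFamily.element (n : ℂ) d hd)
        = ∑ w ∈ F.fixedDiagrams lam.removeFirstRow.card d,
            (n : ℂ) ^ Diagram.loops d w *
              lam.removeFirstRow.symmetricCharacter
                (Diagram.twist lam.removeFirstRow.card d w) := by
  classical
  obtain ⟨_, hr, hμ⟩ := hlam
  set m := lam.removeFirstRow.card with hmdef
  have hm : m ≤ k := by
    obtain ⟨x, _, hx⟩ := hr
    rw [← hx]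
    exact Diagram.rank_le x
  have hn0 : (n : ℂ) ≠ 0 ∨ k = 0 := by
    rcases Nat.eq_zero_or_pos k with h | h
    · exact Or.inr h
    · exact Or.inl (Nat.cast_ne_zero.2 (by omega))
  obtain ⟨c, hc⟩ := F.exists_isMinimalSymmetrizer lam.removeFirstRow
  have hs : (n : ℂ) ^ Diagram.loops (Diagram.labelTail k m (F.tailLabel m))
      (Diagram.labelTail k m (F.tailLabel m)) ≠ 0 := by
    rcases hn0 with h | rfl
    · exact pow_ne_zero _ h
    · -- there are no vertices, hence no loops
      rw [Diagram.loops_eq_zero_of_propTop _ (Set.eq_univ_of_forall fun i => i.elim0), pow_zero]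
      exact one_ne_zero
  rw [F.irreducibleModule_eq_halfModule hn0 hm]
  refine ⟨DiagramFamily.isSimpleModule_halfModule hn hm hr hc hs, ?_⟩
  rw [DiagramFamily.moduleCharacter_halfModule hm hr hc hs hd,
    DiagramFamily.sum_halves_eq_sum_fixedDiagrams hm d
      fun g => c⁻¹ * (F.symmetrizer lam.removeFirstRow).coeff g]
  refine Finset.sum_congr rfl fun w hw => ?_
  rw [DiagramFamily.symmetricCharacter_eq_symmetrizer hc hμ
    (DiagramFamily.twist_mem_strandGroup hm hd hw)]
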